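/- **Theorem 3.3.** Let $n\ge 1$ and let $s>0$ be non-integer, with integer part $[s]$ and fractional part $\{s\}=s-[s]$. A Young function is a convex, left-continuous function $A:[0,\infty)\to[0,\infty]$ with $A(0)=0$ that is neither identically $0$ nor identically $\infty$ on $(0,\infty)$. For a measurable scalar- or vector-valued function $v$ on $\mathbb R^n$ and $\sigma\in(0,1)$ set $$\|v\|_{L^A}=\inf\Big\{\lambda>0:\int_{\mathbb R^n}A\Big(\frac{|v(x)|}{\lambda}\Big)\,dx\le 1\Big\},$$ $$|v|_{\sigma,A}=\inf\Big\{\lambda>0:\int_{\mathbb R^n}\int_{\mathbb R^n}A\Big(\frac{|v(x)-v(y)|}{\lambda|x-y|^{\sigma}}\Big)\frac{d(x,y)}{|x-y|^n}\le 1\Big\}.$$ Let $W^{s,A}(\mathbb R^n)$ be the space of (a.e. classes of) real-valued measurable functions $u$ whose weak derivatives up to order $[s]$ exist and for which $$\|u\|_{W^{s,A}}=\sum_{k=0}^{[s]}\|\nabla^k u\|_{L^A}+\big|\nabla^{[s]}u\big|_{\{s\},A}<\infty,$$ where $\nabla^k u$ is the vector of all $k$-th order weak derivatives of $u$ and $\nabla^0u=u$.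 Fix a real-valued $\varphi_0\in C_0^\infty(B_2(0))$ with $\varphi_0=1$ in $B_1(0)$, and set $\varphi_i(\xi)=\varphi_0(2^{-i}\xi)-\varphi_0(2^{-i+1}\xi)$ for $i\ge 1$. For a tempered distribution $u$ put $\varphi_i(D)u=\mathfrak F^{-1}(\varphi_i\widehat u)$, where $\widehat u(\xi)=\int e^{-\mathrm i x\cdot\xi}u(x)\,dx$ for integrable $u$. Let $F^{s,A}(\mathbb R^n)$ be the space of all real tempered distributions $u$ (real on real test functions) for which $$\|u\|_{F^{s,A}}=\inf\Big\{\lambda>0:\sum_{i=0}^\infty\int_{\mathbb R^n}A\Big(\frac{2^{is}|\varphi_i(D)u|}{\lambda}\Big)\,dx\le1\Big\}<\infty .$$ Then, for every Young function $A$, $$F^{s,A}(\mathbb R^n)=W^{s,A}(\mathbb R^n)$$ under the usual identification of functions with distributions: every $u\in W^{s,A}(\mathbb R^n)$ defines a tempered distribution, which belongs to $F^{s,A}(\mathbb R^n)$, and every $u\in F^{s,A}(\mathbb R^n)$ is given by a function in $W^{s,A}(\mathbb R^n)$. Moreover, there are constants $c,C>0$, depending only on $n$, $s$ and the fixed function $\varphi_0$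 (in particular, not on $A$ or $u$), such that $$c\,\|u\|_{W^{s,A}}\le\|u\|_{F^{s,A}}\le C\,\|u\|_{W^{s,A}}$$ for all $u$ in this common space. -/

import Mathlib

open MeasureTheory
open scoped NNReal ENNReal ContDiff SchwartzMap

noncomputable section

namespace FracOrlicz

/-- The Euclidean space `ℝⁿ`. -/
abbrev E (n : ℕ) : Type := EuclideanSpace ℝ (Fin n)

/-- Young functions `A : [0, ∞) → [0, ∞]`: convex, left-continuous, vanishing at `0`, and on
`(0, ∞)` neither identically `0` nor identically `∞`. -/
structure IsYoung (A : ℝ≥0 → ℝ≥0∞) : Prop where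
  convex : ConvexOn ℝ≥0 Set.univ A
  left_cont : ∀ t, ContinuousWithinAt A (Set.Iic t) t
  map_zero : A 0 = 0
  not_zero : ∃ t, 0 < t ∧ A t ≠ 0
  not_top : ∃ t, 0 < t ∧ A t ≠ ⊤

/-- `inf {l > 0 : ρ l ≤ 1}`, with value `∞` if there is no such `l`. -/
def luxInf (ρ : ℝ≥0 → ℝ≥0∞) : ℝ≥0∞ :=
  ⨅ (l : ℝ≥0) (_ : 0 < l) (_ : ρ l ≤ 1), (l : ℝ≥0∞)

/-- The Luxemburg norm `inf {l > 0 : ∫ A(|v(x)| / l) dx ≤ 1}`, for scalar or vector valued `v`. -/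
def luxNorm {n : ℕ} {F : Type*} [NormedAddCommGroup F] (A : ℝ≥0 → ℝ≥0∞) (v : E n → F) : ℝ≥0∞ :=
  luxInf fun l => ∫⁻ x, A (‖v x‖₊ / l)

/-- The Gagliardo-Slobodeckij seminorm of order `σ`:
`inf {l > 0 : ∬ A(|v(x) - v(y)| / (l |x - y|^σ)) |x - y|^(-n) d(x,y) ≤ 1}`. -/
def gagliardo {n : ℕ} {F : Type*} [NormedAddCommGroup F] (σ : ℝ) (A : ℝ≥0 → ℝ≥0∞)
    (v : E n → F) : ℝ≥0∞ :=
  luxInf fun l => ∫⁻ p : E n × E n,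
    A (‖v p.1 - v p.2‖₊ / (l * ‖p.1 - p.2‖₊ ^ σ)) / (‖p.1 - p.2‖₊ : ℝ≥0∞) ^ n

/-- `v` is the vector `∇ᵏu` of all weak derivatives of order `k` of `u`. Its entries are indexed
by `I : Fin k → Fin n`; the entry `I` is the weak derivative `∂_{I 0} ⋯ ∂_{I (k-1)} u`. The length
of the vector is Euclidean. For `k = 0` the condition says that `v = u` almost everywhere. -/
structure HasWeakGrad {n : ℕ} (k : ℕ) (u : E n → ℝ)
    (v : E n → EuclideanSpace ℝ (Fin k → Fin n)) : Prop where
  locInt : LocallyIntegrable u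
  locInt_grad : LocallyIntegrable v
  parts : ∀ (I : Fin k → Fin n) (η : E n → ℝ), ContDiff ℝ ∞ η → HasCompactSupport η →
    ∫ x, u x * iteratedFDeriv ℝ k η x (fun j => EuclideanSpace.single (I j) 1)
      = (-1) ^ k * ∫ x, v x I * η x

/-- The Luxemburg norm of `∇ᵏu`, equal to `∞` if `u` has no weak derivatives of order `k`.
The infimum is over representatives of `∇ᵏu`, which agree almost everywhere. -/
def gradLuxNorm {n : ℕ} (k : ℕ) (A : ℝ≥0 → ℝ≥0∞) (u : E n → ℝ) : ℝ≥0∞ :=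
  ⨅ (v : E n → EuclideanSpace ℝ (Fin k → Fin n)) (_ : HasWeakGrad k u v), luxNorm A v

/-- The Gagliardo-Slobodeckij seminorm of order `σ` of `∇ᵏu`, equal to `∞` if `u` has no weak
derivatives of order `k`. -/
def gradGagliardo {n : ℕ} (k : ℕ) (σ : ℝ) (A : ℝ≥0 → ℝ≥0∞) (u : E n → ℝ) : ℝ≥0∞ :=
  ⨅ (v : E n → EuclideanSpace ℝ (Fin k → Fin n)) (_ : HasWeakGrad k u v), gagliardo σ A v

/-- The norm of `W^{s,A}(ℝⁿ)`: the sum of the Luxemburg norms of `u, ∇u, …, ∇^[s]u` and of the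
Gagliardo-Slobodeckij seminorm of order `{s} = s - [s]` of `∇^[s]u`. -/
def WNorm {n : ℕ} (s : ℝ) (A : ℝ≥0 → ℝ≥0∞) (u : E n → ℝ) : ℝ≥0∞ :=
  luxNorm A u + (∑ k ∈ Finset.Icc 1 ⌊s⌋₊, gradLuxNorm k A u) + gradGagliardo ⌊s⌋₊ (s - ⌊s⌋₊) A u

/-- Membership in the fractional Orlicz-Sobolev space `W^{s,A}(ℝⁿ)` of real valued functions. -/
def MemW {n : ℕ} (s : ℝ) (A : ℝ≥0 → ℝ≥0∞) (u : E n → ℝ) : Prop :=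
  AEStronglyMeasurable u volume ∧ WNorm s A u < ⊤

/-- `T` is the distribution given by the locally integrable function `f`. -/
def Represents {n : ℕ} (T : 𝓢'(E n, ℂ)) (f : E n → ℂ) : Prop :=
  LocallyIntegrable f ∧
    ∀ g : 𝓢(E n, ℂ), HasCompactSupport (g : E n → ℂ) → T g = ∫ x, g x * f x

/-- A tempered distribution is real if it takes real values on real test functions. -/
def IsRealDistribution {n : ℕ} (T : 𝓢'(E n, ℂ)) : Prop :=
  ∀ g : 𝓢(E n, ℂ), (∀ x, (g x).im = 0) → (T g).im = 0

/-- The generating function `φ₀ ∈ C₀^∞(B₂(0))` with `φ₀ = 1` in `B₁(0)`. -/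
structure IsGenerator {n : ℕ} (φ₀ : E n → ℝ) : Prop where
  smooth : ContDiff ℝ ∞ φ₀
  supp : tsupport φ₀ ⊆ Metric.ball 0 2
  eq_one : ∀ ξ ∈ Metric.ball (0 : E n) 1, φ₀ ξ = 1

/-- The dyadic partition of unity: `φ₀`, and `φᵢ(ξ) = φ₀(2^{-i} ξ) - φ₀(2^{-i+1} ξ)`, `i ≥ 1`. -/
def dyadic {n : ℕ} (φ₀ : E n → ℝ) : ℕ → E n → ℝ
  | 0, ξ => φ₀ ξ
  | i + 1, ξ => φ₀ (((2 : ℝ) ^ (i + 1))⁻¹ • ξ) - φ₀ (((2 : ℝ) ^ i)⁻¹ • ξ)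

/-- `φᵢ(D)T = 𝓕⁻¹(φᵢ 𝓕T)` with `𝓕T(ξ) = ∫ T(x) e^{-i x·ξ} dx`. As Mathlib's Fourier transform has
the kernel `e^{-2πi x·ξ}`, the multiplier is `ξ ↦ φᵢ(2πξ)` there. -/
def dyadicOp {n : ℕ} (φ₀ : E n → ℝ) (i : ℕ) (T : 𝓢'(E n, ℂ)) : 𝓢'(E n, ℂ) :=
  TemperedDistribution.fourierMultiplierCLM ℂ
    (fun ξ : E n => ((dyadic φ₀ i ((2 * Real.pi) • ξ) : ℝ) : ℂ)) T

/-- The norm of `F^{s,A}(ℝⁿ)`: `inf {l > 0 : ∑ᵢ ∫ A(2^{is} |φᵢ(D)T(x)| / l) dx ≤ 1}`. The outer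
infimum is over functions `f i` that represent `φᵢ(D)T`, which are unique almost everywhere. -/
def FNorm {n : ℕ} (φ₀ : E n → ℝ) (s : ℝ) (A : ℝ≥0 → ℝ≥0∞) (T : 𝓢'(E n, ℂ)) : ℝ≥0∞ :=
  ⨅ (f : ℕ → E n → ℂ) (_ : ∀ i, Represents (dyadicOp φ₀ i T) (f i)),
    luxInf fun l => ∑' i : ℕ, ∫⁻ x, A ((2 : ℝ≥0) ^ ((i : ℝ) * s) * ‖f i x‖₊ / l)

/-- Membership in the Littlewood-Paley space `F^{s,A}(ℝⁿ)` of real tempered distributions. -/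
def MemF {n : ℕ} (φ₀ : E n → ℝ) (s : ℝ) (A : ℝ≥0 → ℝ≥0∞) (T : 𝓢'(E n, ℂ)) : Prop :=
  IsRealDistribution T ∧ FNorm φ₀ s A T < ⊤

end FracOrlicz

end

noncomputable section

namespace FracOrlicz

/-! ### Young functions as suprema of affine minorants; Jensen's inequality -/

section Young

variable {A : ℝ≥0 → ℝ≥0∞}

/-! The engine is Jensen's inequality. A Young function is the supremum of its affine minorants
(`IsYoung.exists_minorant`), so its extension `yext` to `[0, ∞]` obeys Jensen for weights of total
mass at most one, with no finiteness to check. All constants are masses of weights, hence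
independent of `A`. At least linear growth of `A` makes every function involved integrable against
`wt`, so that it defines a tempered distribution. Write `m = [s]`, `σ = {s}`, `v = ∇ᵐu`.

Bounding the `F`-norm: for `i ≥ 1` the symbol `φᵢ` vanishes near the origin, so it is `2^{-im}`
times a sum of symbols of derivatives of order `m` multiplied by dilated Schwartz symbols vanishing
at `0` (`exists_factorization`). Thus `φᵢ(D)u` is `2^{-im}` times a convolution of `v` with kernels
of mean zero, and is controlled by averages of `|v(x) - v(x - z)|` at scale `2^{-i}`. The remaining
`2^{iσ}` becomes `(2^i|z|)^σ |z|^{-σ}`. After Jensen in `z`, the sum over `i` only sees `∑ᵢ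
ω(2^i|z|)`, which is bounded uniformly in `z`, and the Gagliardo modular is left
(`tsum_lintegral_yext_kernel_le`). The block `i = 0` is a plain convolution of `u` with an
integrable kernel.

Bounding the `W`-norm: `u` is the sum of its blocks, and each block is reproduced by convolution
with a fixed kernel at scale `2^{-i}` (`IsGenerator.dyadicOp_multOp_wide`). Its derivatives of order
`k` therefore cost `2^{ik}` times an average of the block, and their differences gain a factor
`min(1, 2^i|h|)`. For `k < s`, Jensen along the geometric series `∑ 2^{i(k-s)}` gives the Luxemburg
norms. For the seminorm, `(2^i|h|)^{-σ} min(1, 2^i|h|) ≤ ω(2^i|h|)` with exponent `min(σ, 1 - σ)`,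
positive because `s` is not an integer; Jensen over `i` and the dilation invariance of `dh/|h|ⁿ`
finish the estimate (`lintegral_yext_difference_le`). -/

theorem IsYoung.combo_le (hA : IsYoung A) {a b : ℝ≥0} (hab : a + b = 1) (x y : ℝ≥0) :
    A (a * x + b * y) ≤ a * A x + b * A y := by
  simpa [ENNReal.smul_def] using
    hA.convex.2 (Set.mem_univ x) (Set.mem_univ y) (zero_le (a := a)) (zero_le (a := b)) hab

theorem IsYoung.mono (hA : IsYoung A) : Monotone A := by
  intro x y hxy
  rcases eq_or_ne y 0 with rfl | hy
  · rw [le_antisymm hxy (zero_le (a := x))]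
  have h1 : x / y ≤ 1 := div_le_one_of_le₀ hxy (zero_le (a := y))
  have h := hA.combo_le (add_tsub_cancel_of_le h1) y 0
  rw [div_mul_cancel₀ _ hy, mul_zero, add_zero, hA.map_zero, mul_zero, add_zero] at h
  calc A x ≤ _ := h
    _ ≤ 1 * A y := by gcongr; exact_mod_cast h1
    _ = A y := one_mul _

theorem IsYoung.exists_lt (hA : IsYoung A) {t : ℝ≥0} {c : ℝ≥0∞} (hc : c < A t) :
    ∃ r < t, c < A r := by
  have ht : 0 < t := by
    rcases eq_or_ne t 0 with rfl | h
    · simp [hA.map_zero] at hc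
    · exact pos_iff_ne_zero.2 h
  have h := (hA.left_cont t).eventually (lt_mem_nhds hc)
  have h2 : ∀ᶠ r in nhdsWithin t (Set.Iio t), c < A r :=
    h.filter_mono (nhdsWithin_mono _ Set.Iio_subset_Iic_self)
  have : (nhdsWithin t (Set.Iio t)).NeBot := nhdsLT_neBot_of_exists_lt ⟨0, ht⟩
  obtain ⟨r, hr1, hr2⟩ := (h2.and self_mem_nhdsWithin).exists
  exact ⟨r, hr2, hr1⟩

/-- The affine minorants `x ↦ a x - b` of `A` with `a, b ≥ 0`. -/
def affineMinorants (A : ℝ≥0 → ℝ≥0∞) : Set (ℝ≥0 × ℝ≥0) :=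
  {p | ∀ x, (p.1 : ℝ≥0∞) * x ≤ A x + p.2}

/-- A steep line vanishing at `r` works: it is nonpositive before `r`, and `A` is infinite from `r`
on. -/
theorem IsYoung.exists_minorant_of_top (hA : IsYoung A) {r t c : ℝ≥0}
    (hr : A r = ⊤) (hrt : r < t) : ∃ p ∈ affineMinorants A, c + p.2 < p.1 * t := by
  have htr : 0 < t - r := tsub_pos_of_lt hrt
  refine ⟨((c + 1) / (t - r), (c + 1) / (t - r) * r), fun x => ?_, ?_⟩
  · rcases le_total x r with h | h
    · refine le_add_left ?_
      simp only
      exact_mod_cast mul_le_mul_right h _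
    · simp [top_le_iff.1 (hr ▸ hA.mono h : ⊤ ≤ A x)]
  · have : (c + 1) / (t - r) * t = (c + 1) / (t - r) * r + (c + 1) := by
      nth_rw 3 [← div_mul_cancel₀ (c + 1) htr.ne']
      rw [← mul_add, add_tsub_cancel_of_le hrt.le]
    simp only
    rw [this, add_comm]
    gcongr
    exact lt_add_one c

/-- Slopes of a convex function increase; the denominators are cleared. -/
theorem IsYoung.chord (hA : IsYoung A) {q r x : ℝ≥0} (hqr : q < r) (hrx : r < x)
    (hx : A x ≠ ⊤) :
    ((A r).toReal - (A q).toReal) * (x - r) ≤ ((A x).toReal - (A r).toReal) * (r - q) := by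
  have hr : A r ≠ ⊤ := ne_top_of_le_ne_top hx (hA.mono hrx.le)
  have hq : A q ≠ ⊤ := ne_top_of_le_ne_top hr (hA.mono hqr.le)
  have hqx : 0 < x - q := tsub_pos_of_lt (hqr.trans hrx)
  have hqr' : (q : ℝ) < r := by exact_mod_cast hqr
  have hrx' : (r : ℝ) < x := by exact_mod_cast hrx
  have hab : (x - r) / (x - q) + (r - q) / (x - q) = 1 := by
    rw [← add_div, div_eq_one_iff_eq hqx.ne', tsub_add_tsub_cancel hrx.le hqr.le]
  have hcomb : (x - r) / (x - q) * q + (r - q) / (x - q) * x = r := by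
    rw [← NNReal.coe_inj]
    push_cast [NNReal.coe_sub hrx.le, NNReal.coe_sub hqr.le, NNReal.coe_sub (hqr.trans hrx).le]
    have : (x : ℝ) - q ≠ 0 := by linarith
    field_simp
    ring
  have h := hA.combo_le hab q x
  rw [hcomb] at h
  have h2 := ENNReal.toReal_mono (by finiteness) h
  rw [ENNReal.toReal_add (by finiteness) (by finiteness), ENNReal.toReal_mul,
    ENNReal.toReal_mul] at h2
  simp only [ENNReal.coe_toReal] at h2
  push_cast [NNReal.coe_sub hrx.le, NNReal.coe_sub hqr.le, NNReal.coe_sub (hqr.trans hrx).le] at h2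
  have h3 : (0 : ℝ) < x - q := by linarith
  rw [div_mul_eq_mul_div, div_mul_eq_mul_div, ← add_div, le_div_iff₀ h3] at h2
  nlinarith

/-- A supporting line at a point `r` slightly left of `t` is used. Left-continuity keeps `A r` above
`c`, and an intermediate `r'` with `A r'` finite bounds the left slopes at `r`; if `A r'` is
infinite the previous construction applies. -/
theorem IsYoung.exists_minorant (hA : IsYoung A) {t c : ℝ≥0} (hc : (c : ℝ≥0∞) < A t) :
    ∃ p ∈ affineMinorants A, c + p.2 < p.1 * t := by
  obtain ⟨r, hrt, hcr⟩ := hA.exists_lt hc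
  obtain ⟨r', hrr', hrt'⟩ := exists_between hrt
  by_cases hr' : A r' = ⊤
  · exact hA.exists_minorant_of_top hr' hrt'
  have hr : A r ≠ ⊤ := ne_top_of_le_ne_top hr' (hA.mono hrr'.le)
  have hr0 : 0 < r := by
    rcases eq_or_ne r 0 with rfl | h
    · simp [hA.map_zero] at hcr
    · exact pos_iff_ne_zero.2 h
  -- The slope of the supporting line is the left derivative at `r`, the supremum of the difference
  -- quotients in `S`.
  let S : Set ℝ := (fun x : ℝ≥0 => ((A r).toReal - (A x).toReal) / (r - x)) '' Set.Iio r
  have hub : ∀ x, r < x → A x ≠ ⊤ →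
      ((A x).toReal - (A r).toReal) / (x - r) ∈ upperBounds S := by
    rintro x hx hxt _ ⟨q, hq, rfl⟩
    have h := hA.chord hq hx hxt
    have h1 : (0 : ℝ) < r - q := sub_pos.2 (by exact_mod_cast hq)
    have h2 : (0 : ℝ) < x - r := sub_pos.2 (by exact_mod_cast hx)
    simp only
    rw [div_le_div_iff₀ h1 h2]
    exact h
  have hbdd : BddAbove S := ⟨_, hub r' hrr' hr'⟩
  have hne : S.Nonempty := ⟨_, 0, hr0, rfl⟩
  have hleft : ∀ x, x < r → (A r).toReal - (A x).toReal ≤ sSup S * (r - x) := by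
    intro x hx
    have h1 : (0 : ℝ) < r - x := sub_pos.2 (by exact_mod_cast hx)
    rw [← div_le_iff₀ h1]
    exact le_csSup hbdd ⟨x, hx, rfl⟩
  have hright : ∀ x, r < x → A x ≠ ⊤ → sSup S * (x - r) ≤ (A x).toReal - (A r).toReal := by
    intro x hx hxt
    have h1 : (0 : ℝ) < x - r := sub_pos.2 (by exact_mod_cast hx)
    rw [← le_div_iff₀ h1]
    exact csSup_le hne (hub x hx hxt)
  have hb0 : 0 ≤ sSup S * r - (A r).toReal := by
    have := hleft 0 hr0
    simp [hA.map_zero] at this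
    linarith
  have ha0 : 0 ≤ sSup S := by
    have h1 : (0 : ℝ) ≤ (A r).toReal := ENNReal.toReal_nonneg
    have h2 : (0 : ℝ) < r := by exact_mod_cast hr0
    by_contra h
    push Not at h
    nlinarith
  refine ⟨(⟨sSup S, ha0⟩, ⟨sSup S * r - (A r).toReal, hb0⟩), fun x => ?_, ?_⟩
  · by_cases hxt : A x = ⊤
    · simp [hxt]
    rw [← ENNReal.coe_toNNReal hxt]
    rw [← ENNReal.coe_mul, ← ENNReal.coe_add, ENNReal.coe_le_coe, ← NNReal.coe_le_coe]
    push_cast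
    change sSup S * x ≤ (A x).toReal + (sSup S * r - (A r).toReal)
    rcases lt_trichotomy x r with h | rfl | h
    · linarith [hleft x h]
    · linarith
    · linarith [hright x h hxt]
  · rw [← NNReal.coe_lt_coe]
    push_cast
    have h1 : (c : ℝ) < (A r).toReal := by
      have := (ENNReal.toReal_lt_toReal (by finiteness) hr).2 hcr
      simpa using this
    have h2 : (r : ℝ) < t := by exact_mod_cast hrt
    change (c : ℝ) + (sSup S * r - (A r).toReal) < sSup S * t
    nlinarith

/-- The extension of a Young function to `[0, ∞]` as the supremum of its affine minorants. -/
def yext (A : ℝ≥0 → ℝ≥0∞) (t : ℝ≥0∞) : ℝ≥0∞ :=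
  ⨆ p ∈ affineMinorants A, (p.1 * t - p.2)

theorem mul_le_yext_add {p : ℝ≥0 × ℝ≥0} (hp : p ∈ affineMinorants A) (t : ℝ≥0∞) :
    p.1 * t ≤ yext A t + p.2 :=
  tsub_le_iff_right.1 (le_iSup₂ (f := fun (p : ℝ≥0 × ℝ≥0) (_ : p ∈ affineMinorants A) =>
    ((p.1 : ℝ≥0∞) * t - p.2)) p hp)

theorem yext_le {t c : ℝ≥0∞} (h : ∀ p ∈ affineMinorants A, p.1 * t ≤ c + p.2) : yext A t ≤ c :=
  iSup₂_le fun p hp => tsub_le_iff_right.2 (h p hp)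

theorem IsYoung.yext_coe (hA : IsYoung A) (t : ℝ≥0) : yext A t = A t := by
  apply le_antisymm
  · exact yext_le fun p hp => hp t
  · refine ENNReal.le_of_forall_nnreal_lt fun c hc => ?_
    obtain ⟨p, hp, h⟩ := hA.exists_minorant hc
    have h1 := mul_le_yext_add hp (t : ℝ≥0∞)
    have h2 : (c : ℝ≥0∞) + p.2 ≤ p.1 * t := by exact_mod_cast h.le
    exact ENNReal.le_of_add_le_add_right ENNReal.coe_ne_top (h2.trans h1)

theorem yext_mono : Monotone (yext A) := fun _ _ h =>
  yext_le fun _ hp => le_trans (by gcongr) (mul_le_yext_add hp _)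

@[fun_prop]
theorem measurable_yext : Measurable (yext A) := yext_mono.measurable

@[simp]
theorem yext_zero : yext A 0 = 0 := by
  simp [yext]

/-- Jensen's inequality for weighted integrals. -/
theorem yext_lintegral_le {α : Type*} [MeasurableSpace α] {μ : Measure α} {w f : α → ℝ≥0∞}
    (hw : AEMeasurable w μ) (h1 : ∫⁻ x, w x ∂μ ≤ 1) :
    yext A (∫⁻ x, w x * f x ∂μ) ≤ ∫⁻ x, w x * yext A (f x) ∂μ := by
  refine yext_le fun p hp => ?_
  calc (p.1 : ℝ≥0∞) * ∫⁻ x, w x * f x ∂μ ≤ ∫⁻ x, p.1 * (w x * f x) ∂μ :=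
        lintegral_const_mul_le _ _
    _ ≤ ∫⁻ x, (w x * yext A (f x) + w x * p.2) ∂μ := by
        refine lintegral_mono fun x => ?_
        have := mul_le_mul_right (mul_le_yext_add hp (f x)) (w x)
        rw [mul_add] at this
        refine le_trans (le_of_eq ?_) this
        ring
    _ = (∫⁻ x, w x * yext A (f x) ∂μ) + (∫⁻ x, w x ∂μ) * p.2 := by
        rw [lintegral_add_right' _ (hw.mul_const _), lintegral_mul_const'' _ hw]
    -- Since the constant `p.2` subtracted in a minorant is nonnegative, mass at most one suffices;
    -- mass exactly one is not needed.
    _ ≤ _ := by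
        gcongr
        exact mul_le_of_le_one_left (zero_le (a := (p.2 : ℝ≥0∞))) h1

/-- Jensen's inequality for series. -/
theorem yext_tsum_le {ι : Type*} {w f : ι → ℝ≥0∞} (h1 : ∑' i, w i ≤ 1) :
    yext A (∑' i, w i * f i) ≤ ∑' i, w i * yext A (f i) := by
  let _ : MeasurableSpace ι := ⊤
  simp only [← lintegral_count]
  rw [← lintegral_count] at h1
  exact yext_lintegral_le (measurable_from_top).aemeasurable h1

theorem yext_mul_le {c : ℝ≥0∞} (hc : c ≤ 1) (t : ℝ≥0∞) : yext A (c * t) ≤ c * yext A t := by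
  simpa using yext_tsum_le (A := A) (ι := Unit) (w := fun _ => c) (f := fun _ => t) (by simpa)

theorem yext_half_add_le (s t : ℝ≥0∞) :
    yext A (2⁻¹ * (s + t)) ≤ 2⁻¹ * (yext A s + yext A t) := by
  have := yext_tsum_le (A := A) (ι := Bool) (w := fun _ => 2⁻¹) (f := fun b => if b then s else t)
    (by simp)
  simpa [mul_add] using this

/-- A minorant that is positive at a point where `A` does not vanish must have positive slope. -/
theorem IsYoung.exists_growth (hA : IsYoung A) :
    ∃ a b : ℝ≥0, 0 < a ∧ ∀ t : ℝ≥0∞, a * t ≤ yext A t + b := by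
  obtain ⟨t, ht, ht0⟩ := hA.not_zero
  obtain ⟨p, hp, h⟩ := hA.exists_minorant (t := t) (c := 0) (by simpa using pos_iff_ne_zero.2 ht0)
  refine ⟨p.1, p.2, ?_, mul_le_yext_add hp⟩
  rcases eq_or_ne p.1 0 with h0 | h0
  · simp [h0] at h
  · exact pos_iff_ne_zero.2 h0

/-- The Luxemburg functional in terms of the extended Young function. -/
theorem IsYoung.apply_div (hA : IsYoung A) (a : ℝ≥0) {l : ℝ≥0} (hl : l ≠ 0) :
    A (a / l) = yext A (a / l) := by
  rw [← hA.yext_coe, ENNReal.coe_div hl]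

end Young

end FracOrlicz

namespace FracOrlicz

/-! ### Weights, dilated convolutions and the bump `omega` -/

section Weights

variable {n : ℕ}

/-- The integrable weight `(1 + |x|)^(-(n + 1))`. -/
def wt (x : E n) : ℝ≥0∞ := ((1 + ‖x‖ₑ) ^ (n + 1))⁻¹

@[fun_prop]
theorem measurable_wt : Measurable (wt : E n → ℝ≥0∞) := by
  unfold wt; fun_prop

theorem wt_le_one (x : E n) : wt x ≤ 1 := by
  rw [wt, ENNReal.inv_le_one]
  exact one_le_pow₀ le_self_add

theorem wt_ne_top (x : E n) : wt x ≠ ⊤ := ne_top_of_le_ne_top ENNReal.one_ne_top (wt_le_one x)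

theorem wt_ne_zero (x : E n) : wt x ≠ 0 := by
  rw [wt, ENNReal.inv_ne_zero]
  finiteness

/-- Peetre's inequality `1 + |x + y| ≤ (1 + |x|)(1 + |y|)`, which lets the weight be transported by
convolutions. -/
theorem wt_mul_wt_le (x y : E n) : wt x * wt y ≤ wt (x + y) := by
  rw [wt, wt, wt, ← ENNReal.mul_inv (by left; positivity) (by left; finiteness), ← mul_pow,
    ENNReal.inv_le_inv]
  gcongr
  calc 1 + ‖x + y‖ₑ ≤ 1 + (‖x‖ₑ + ‖y‖ₑ) := by gcongr; exact enorm_add_le x y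
    _ ≤ 1 + (‖x‖ₑ + ‖y‖ₑ) + ‖x‖ₑ * ‖y‖ₑ := le_self_add
    _ = (1 + ‖x‖ₑ) * (1 + ‖y‖ₑ) := by ring

theorem wt_neg (x : E n) : wt (-x) = wt x := by simp [wt]

theorem lintegral_wt_lt_top : ∫⁻ x : E n, wt x < ⊤ := by
  have h := finite_integral_one_add_norm (E := E n) (μ := volume) (r := n + 1) (by simp)
  refine lt_of_le_of_lt (le_of_eq (lintegral_congr fun x => ?_)) h
  rw [Real.rpow_neg (by positivity), ENNReal.ofReal_inv_of_pos (by positivity), wt]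
  congr 1
  rw [← Nat.cast_add_one, Real.rpow_natCast, ENNReal.ofReal_pow (by positivity),
    ENNReal.ofReal_add zero_le_one (norm_nonneg x), ENNReal.ofReal_one, ofReal_norm]

theorem lintegral_dilate {c : ℝ} (hc : c ≠ 0) (W : E n → ℝ≥0∞) :
    ∫⁻ z, ‖c‖ₑ ^ n * W (c • z) = ∫⁻ z, W z := by
  have hcn : ‖c‖ₑ ^ n ≠ ⊤ := by finiteness
  have h0 : ‖c‖ₑ ^ n ≠ 0 := by simp [hc]
  rw [lintegral_const_mul' _ _ hcn]
  have h1 : ∫⁻ z, W (c • z) = ∫⁻ z, W z ∂(volume.map (c • · : E n → E n)) :=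
    (lintegral_map_equiv W (MeasurableEquiv.smul₀ c hc)).symm
  rw [h1, Measure.map_addHaar_smul _ hc, lintegral_smul_measure, smul_eq_mul, ← mul_assoc]
  have h2 : ‖c‖ₑ ^ n * ENNReal.ofReal |(c ^ Module.finrank ℝ (E n))⁻¹| = 1 := by
    rw [← Real.enorm_eq_ofReal_abs, enorm_inv (by simp [hc]), enorm_pow]
    simp only [finrank_euclideanSpace, Fintype.card_fin]
    exact ENNReal.mul_inv_cancel h0 hcn
  rw [h2, one_mul]

/-- The convolution of the `L¹`-dilation of `W` with `F`. -/
def sconv (c : ℝ) (W F : E n → ℝ≥0∞) (x : E n) : ℝ≥0∞ :=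
  ∫⁻ z, ‖c‖ₑ ^ n * W (c • z) * F (x - z)

@[fun_prop]
theorem measurable_sconv {c : ℝ} {W F : E n → ℝ≥0∞} (hW : Measurable W) (hF : Measurable F) :
    Measurable (sconv c W F) := by
  unfold sconv
  refine Measurable.lintegral_prod_right' (f := fun p : E n × E n =>
    ‖c‖ₑ ^ n * W (c • p.2) * F (p.1 - p.2)) ?_
  fun_prop

theorem lintegral_sconv {c : ℝ} (hc : c ≠ 0) {W F : E n → ℝ≥0∞} (hW : Measurable W)
    (hF : Measurable F) : ∫⁻ x, sconv c W F x = (∫⁻ z, W z) * ∫⁻ x, F x := by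
  unfold sconv
  rw [lintegral_lintegral_swap (by fun_prop)]
  rw [← lintegral_dilate hc W, ← lintegral_mul_const _ (by fun_prop)]
  refine lintegral_congr fun z => ?_
  rw [lintegral_const_mul _ (by fun_prop), lintegral_sub_right_eq_self]

/-- Dilation preserves the mass of `W`, so dividing by `M` turns the convolution into averaging
against a weight of mass at most one, whatever the scale `c`. Jensen pointwise and Tonelli give the
bound. -/
theorem lintegral_yext_sconv_le {A : ℝ≥0 → ℝ≥0∞} {c : ℝ} (hc : c ≠ 0) {W F : E n → ℝ≥0∞}
    (hW : Measurable W) (hF : Measurable F) {M : ℝ≥0∞} (hM0 : M ≠ 0) (hM : M ≠ ⊤)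
    (hWM : ∫⁻ z, W z ≤ M) :
    ∫⁻ x, yext A (M⁻¹ * sconv c W F x) ≤ ∫⁻ x, yext A (F x) := by
  have hMi : M⁻¹ ≠ ⊤ := ENNReal.inv_ne_top.2 hM0
  have h1 : ∀ x, yext A (M⁻¹ * sconv c W F x) ≤ M⁻¹ * sconv c W (fun x => yext A (F x)) x := by
    intro x
    unfold sconv
    rw [← lintegral_const_mul' _ _ hMi, ← lintegral_const_mul' _ _ hMi]
    simp only [← mul_assoc]
    refine yext_lintegral_le (f := fun z => F (x - z)) (by fun_prop) ?_
    simp only [mul_assoc]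
    rw [lintegral_const_mul' _ _ hMi, lintegral_dilate hc]
    calc M⁻¹ * ∫⁻ z, W z ≤ M⁻¹ * M := by gcongr
      _ = 1 := ENNReal.inv_mul_cancel hM0 hM
  calc ∫⁻ x, yext A (M⁻¹ * sconv c W F x)
      ≤ ∫⁻ x, M⁻¹ * sconv c W (fun x => yext A (F x)) x := lintegral_mono h1
    _ = M⁻¹ * ((∫⁻ z, W z) * ∫⁻ x, yext A (F x)) := by
        rw [lintegral_const_mul' _ _ hMi, lintegral_sconv hc hW (by fun_prop)]
    _ ≤ M⁻¹ * (M * ∫⁻ x, yext A (F x)) := by gcongr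
    _ = ∫⁻ x, yext A (F x) := by rw [← mul_assoc, ENNReal.inv_mul_cancel hM0 hM, one_mul]

theorem lintegral_yext_tsum_le {α : Type*} [MeasurableSpace α] {μ : Measure α} {A : ℝ≥0 → ℝ≥0∞}
    {F : ℕ → α → ℝ≥0∞} (hF : ∀ i, Measurable (F i)) {θ : ℕ → ℝ≥0∞} {K : ℝ≥0∞}
    (hK0 : K ≠ 0) (hK : K ≠ ⊤) (hθ : ∑' i, θ i ≤ K) :
    ∫⁻ x, yext A (K⁻¹ * ∑' i, θ i * F i x) ∂μ ≤ ∑' i, ∫⁻ x, yext A (F i x) ∂μ := by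
  have h1 : ∑' i, K⁻¹ * θ i ≤ 1 := by
    rw [ENNReal.tsum_mul_left]
    calc K⁻¹ * ∑' i, θ i ≤ K⁻¹ * K := by gcongr
      _ = 1 := ENNReal.inv_mul_cancel hK0 hK
  calc ∫⁻ x, yext A (K⁻¹ * ∑' i, θ i * F i x) ∂μ
      ≤ ∫⁻ x, ∑' i, K⁻¹ * θ i * yext A (F i x) ∂μ := by
        refine lintegral_mono fun x => ?_
        simp only
        rw [← ENNReal.tsum_mul_left]
        simp only [← mul_assoc]
        exact yext_tsum_le h1
    _ = ∑' i, K⁻¹ * θ i * ∫⁻ x, yext A (F i x) ∂μ := by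
        rw [lintegral_tsum fun i => by fun_prop]
        exact tsum_congr fun i => lintegral_const_mul _ (by fun_prop)
    _ ≤ _ := by
        refine ENNReal.tsum_le_tsum fun i => mul_le_of_le_one_left' ?_
        exact le_trans (ENNReal.le_tsum i) h1

/-- The bump `t ↦ min (t ^ α) (t ^ (-α))`. -/
def omega (α : ℝ) (t : ℝ≥0∞) : ℝ≥0∞ := min (t ^ α) (t ^ (-α))

@[fun_prop]
theorem measurable_omega {α : ℝ} : Measurable (omega α) := by
  unfold omega; fun_prop

theorem omega_zero {α : ℝ} (hα : 0 < α) : omega α 0 = 0 := by simp [omega, hα]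

/-- On a dyadic shell `omega` decays geometrically in the distance of the shell from `1`, on both
sides. -/
theorem omega_le_pow {α : ℝ} (hα : 0 < α) {t : ℝ≥0∞} {k : ℤ} (h1 : (2 : ℝ≥0∞) ^ k ≤ t)
    (h2 : t ≤ 2 ^ (k + 1)) : omega α t ≤ 2 ^ α * (2 ^ (-α)) ^ k.natAbs := by
  have e1 : ∀ j : ℤ, (2 : ℝ≥0∞) ^ j = 2 ^ (j : ℝ) := fun j => (ENNReal.rpow_intCast _ _).symm
  rw [e1] at h1 h2
  rw [← ENNReal.rpow_natCast, ← ENNReal.rpow_mul, ← ENNReal.rpow_add _ _ (by simp) (by simp)]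
  rcases le_total 0 k with hk | hk
  · have hk' : (k.natAbs : ℝ) = k := by
      rw [Nat.cast_natAbs, abs_of_nonneg hk]
    refine (min_le_right _ _).trans ?_
    rw [hk']
    calc t ^ (-α) ≤ (2 ^ (k : ℝ)) ^ (-α) := by
          rw [ENNReal.rpow_neg, ENNReal.rpow_neg, ENNReal.inv_le_inv]
          gcongr
      _ = 2 ^ ((k : ℝ) * -α) := (ENNReal.rpow_mul _ _ _).symm
      _ ≤ _ := by
        apply ENNReal.rpow_le_rpow_of_exponent_le (by norm_num)
        nlinarith
  · have hk' : (k.natAbs : ℝ) = -k := by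
      rw [Nat.cast_natAbs, abs_of_nonpos hk, Int.cast_neg]
    refine (min_le_left _ _).trans ?_
    rw [hk']
    calc t ^ α ≤ (2 ^ ((k + 1 : ℤ) : ℝ)) ^ α := by gcongr
      _ = 2 ^ (((k + 1 : ℤ) : ℝ) * α) := (ENNReal.rpow_mul _ _ _).symm
      _ ≤ _ := by
        apply ENNReal.rpow_le_rpow_of_exponent_le (by norm_num)
        push_cast
        nlinarith

theorem tsum_natAbs_pow_le (r : ℝ≥0∞) :
    ∑' k : ℤ, r ^ k.natAbs ≤ 2 * ∑' k : ℕ, r ^ k := by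
  rw [← (Equiv.intEquivNatSumNat.symm).tsum_eq, ENNReal.summable.tsum_sum ENNReal.summable, two_mul]
  refine add_le_add (le_of_eq ?_) ?_
  · exact tsum_congr fun k => by simp [Equiv.intEquivNatSumNat]
  · calc _ = ∑' k : ℕ, r ^ (k + 1) := tsum_congr fun k => by simp [Equiv.intEquivNatSumNat]
      _ ≤ _ := ENNReal.tsum_comp_le_tsum_of_injective (add_left_injective 1) (fun k => r ^ k)

/-- Shifting by the dyadic shell of `t` embeds the sum into a two-sided geometric series, so the
bound is uniform in `t`. -/
theorem exists_tsum_omega_le {α : ℝ} (hα : 0 < α) :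
    ∃ K : ℝ≥0∞, K ≠ ⊤ ∧ ∀ t, ∑' i : ℕ, omega α (2 ^ i * t) ≤ K := by
  refine ⟨2 ^ α * (2 * ∑' k : ℕ, ((2 : ℝ≥0∞) ^ (-α)) ^ k), ?_, fun t => ?_⟩
  · rw [ENNReal.tsum_geometric]
    have h1 : (2 : ℝ≥0∞) ^ (-α) < 1 :=
      ENNReal.rpow_lt_one_of_one_lt_of_neg (by norm_num) (by linarith)
    have h2 : (1 : ℝ≥0∞) - 2 ^ (-α) ≠ 0 := (tsub_pos_of_lt h1).ne'
    finiteness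
  · rcases eq_or_ne t 0 with rfl | h0
    · simp [omega_zero hα]
    rcases eq_or_ne t ⊤ with rfl | ht
    · have : ∀ i : ℕ, (2 : ℝ≥0∞) ^ i * ⊤ = ⊤ := fun i => ENNReal.mul_top (by simp)
      simp [this, omega, hα]
    obtain ⟨j, hj1, hj2⟩ := ENNReal.exists_mem_Ico_zpow h0 ht (y := 2) (by norm_num) (by simp)
    calc ∑' i : ℕ, omega α (2 ^ i * t)
        ≤ ∑' i : ℕ, 2 ^ α * ((2 : ℝ≥0∞) ^ (-α)) ^ ((i : ℤ) + j).natAbs := by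
          refine ENNReal.tsum_le_tsum fun i => omega_le_pow hα ?_ ?_
          · rw [ENNReal.zpow_add (by simp) (by simp), zpow_natCast]
            gcongr
          · rw [add_assoc, ENNReal.zpow_add (by simp) (by simp), zpow_natCast]
            gcongr
      _ = 2 ^ α * ∑' i : ℕ, ((2 : ℝ≥0∞) ^ (-α)) ^ ((i : ℤ) + j).natAbs := ENNReal.tsum_mul_left
      _ ≤ 2 ^ α * ∑' k : ℤ, ((2 : ℝ≥0∞) ^ (-α)) ^ k.natAbs := by
          gcongr
          exact ENNReal.tsum_comp_le_tsum_of_injective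
            (f := fun i : ℕ => (i : ℤ) + j) (fun a b h => by simpa using h)
            (fun k : ℤ => ((2 : ℝ≥0∞) ^ (-α)) ^ k.natAbs)
      _ ≤ _ := by gcongr; exact tsum_natAbs_pow_le _

/-- In polar coordinates the integrand is `min(t^α, t^{-α}) / t`, integrable at `0` and at infinity.
-/
theorem lintegral_omega_lt_top (hn : 1 ≤ n) {α : ℝ} (hα : 0 < α) :
    ∫⁻ h : E n, omega α ‖h‖ₑ / ‖h‖ₑ ^ n < ⊤ := by
  have : Nontrivial (E n) := by
    have : Nonempty (Fin n) := ⟨⟨0, hn⟩⟩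
    infer_instance
  let f : ℝ → ℝ := fun t => min (t ^ α) (t ^ (-α)) / t ^ n
  have hint : Integrable (fun h : E n => f ‖h‖) := by
    rw [integrable_fun_norm_addHaar]
    simp only [finrank_euclideanSpace, Fintype.card_fin]
    have h1 : IntegrableOn (fun t : ℝ => t ^ (α - 1)) (Set.Ioc 0 1) := by
      rw [← intervalIntegrable_iff_integrableOn_Ioc_of_le zero_le_one]
      exact intervalIntegral.intervalIntegrable_rpow' (by linarith)
    have h2 : IntegrableOn (fun t : ℝ => t ^ (-α - 1)) (Set.Ioi 1) :=
      integrableOn_Ioi_rpow_of_lt (by linarith) zero_lt_one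
    have hm : Measurable fun y : ℝ => y ^ (n - 1) • f y := by
      simp only [f]; fun_prop
    have hpos : ∀ y : ℝ, 0 < y → y ^ (n - 1) • f y = min (y ^ α) (y ^ (-α)) / y := by
      intro y hy
      obtain ⟨m, rfl⟩ : ∃ m, n = m + 1 := ⟨n - 1, by omega⟩
      simp only [f, smul_eq_mul, Nat.add_sub_cancel, pow_succ]
      field_simp
    rw [← Set.Ioc_union_Ioi_eq_Ioi zero_le_one]
    refine IntegrableOn.union (Integrable.mono' h1 hm.aestronglyMeasurable ?_)
      (Integrable.mono' h2 hm.aestronglyMeasurable ?_)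
    · filter_upwards [ae_restrict_mem measurableSet_Ioc] with y hy
      rw [hpos y hy.1, Real.norm_of_nonneg (by have := hy.1; positivity), Real.rpow_sub_one hy.1.ne']
      have := hy.1.le
      gcongr
      exact min_le_left _ _
    · filter_upwards [ae_restrict_mem measurableSet_Ioi] with y hy
      have hy0 : (0 : ℝ) < y := lt_trans zero_lt_one hy
      rw [hpos y hy0, Real.norm_of_nonneg (by positivity), Real.rpow_sub_one hy0.ne']
      gcongr
      exact min_le_right _ _
  refine lt_of_le_of_lt (lintegral_mono fun h => ?_) hint.2
  rcases eq_or_ne h 0 with rfl | hh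
  · simp [omega_zero hα]
  have hp : 0 < ‖h‖ := norm_pos_iff.2 hh
  rw [Real.enorm_eq_ofReal (by positivity), ENNReal.ofReal_div_of_pos (by positivity),
    ENNReal.ofReal_pow hp.le, ofReal_norm]
  gcongr
  rw [omega, ← ofReal_norm, ENNReal.ofReal_rpow_of_pos hp, ENNReal.ofReal_rpow_of_pos hp]
  exact (ENNReal.ofReal_min _ _).ge

/-- The measure `dh/|h|ⁿ` is invariant under dilations. -/
theorem lintegral_omega_dilate {α : ℝ} {c : ℝ} (hc : c ≠ 0) :
    ∫⁻ h : E n, omega α (‖c‖ₑ * ‖h‖ₑ) / ‖h‖ₑ ^ n = ∫⁻ h : E n, omega α ‖h‖ₑ / ‖h‖ₑ ^ n := by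
  rw [← lintegral_dilate hc fun h : E n => omega α ‖h‖ₑ / ‖h‖ₑ ^ n]
  refine lintegral_congr fun h => ?_
  rw [enorm_smul, mul_pow, ← mul_div_assoc, ENNReal.mul_div_mul_left _ _ (by simp [hc])
    (by finiteness)]

end Weights

end FracOrlicz

namespace FracOrlicz

/-! ### The two modular estimates behind the norm equivalence -/

section Modulars

variable {n : ℕ} {A : ℝ≥0 → ℝ≥0∞}

theorem enorm_two_pow (i : ℕ) : ‖(2 : ℝ) ^ i‖ₑ = 2 ^ i := by
  rw [enorm_pow]
  congr 1
  rw [Real.enorm_eq_ofReal zero_le_two]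
  simp

/-- Core of the bound for the Gagliardo seminorm. `K` plays two roles: it bounds `∑ᵢ ω(2^i|h|)`,
which allows Jensen over `i` for fixed `h`, and it bounds `∫ ω(2^i|h|) dh/|h|ⁿ`, the same number for
every `i`, when `h` is integrated. Translation invariance in `x` identifies the two terms `F i x`
and `F i (x - h)`. -/
theorem lintegral_yext_difference_le {α : ℝ} {F : ℕ → E n → ℝ≥0∞} (hF : ∀ i, Measurable (F i))
    (hF1 : ∑' i, ∫⁻ x, yext A (F i x) ≤ 1) {K : ℝ≥0∞} (hK0 : K ≠ 0) (hK : K ≠ ⊤)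
    (hsum : ∀ t, ∑' i : ℕ, omega α (2 ^ i * t) ≤ K)
    (hint : ∫⁻ h : E n, omega α ‖h‖ₑ / ‖h‖ₑ ^ n ≤ K) :
    ∫⁻ x : E n, ∫⁻ h : E n, yext A (K⁻¹ * (2⁻¹ *
      ∑' i : ℕ, omega α (2 ^ i * ‖h‖ₑ) * (F i x + F i (x - h)))) / ‖h‖ₑ ^ n ≤ 1 := by
  have hpt : ∀ x h : E n, yext A (K⁻¹ * (2⁻¹ *
      ∑' i : ℕ, omega α (2 ^ i * ‖h‖ₑ) * (F i x + F i (x - h)))) / ‖h‖ₑ ^ n ≤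
      ∑' i : ℕ, K⁻¹ * (omega α (2 ^ i * ‖h‖ₑ) / ‖h‖ₑ ^ n) *
        (2⁻¹ * (yext A (F i x) + yext A (F i (x - h)))) := by
    intro x h
    have h1 : ∑' i : ℕ, K⁻¹ * omega α (2 ^ i * ‖h‖ₑ) ≤ 1 := by
      rw [ENNReal.tsum_mul_left]
      calc _ ≤ K⁻¹ * K := by gcongr; exact hsum _
        _ = 1 := ENNReal.inv_mul_cancel hK0 hK
    have h2 : K⁻¹ * (2⁻¹ * ∑' i : ℕ, omega α (2 ^ i * ‖h‖ₑ) * (F i x + F i (x - h))) =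
        ∑' i : ℕ, K⁻¹ * omega α (2 ^ i * ‖h‖ₑ) * (2⁻¹ * (F i x + F i (x - h))) := by
      rw [← mul_assoc, ← ENNReal.tsum_mul_left]
      exact tsum_congr fun i => by ring
    rw [h2]
    calc _ ≤ (∑' i : ℕ, K⁻¹ * omega α (2 ^ i * ‖h‖ₑ) *
            (2⁻¹ * (yext A (F i x) + yext A (F i (x - h))))) / ‖h‖ₑ ^ n := by
          gcongr
          refine (yext_tsum_le h1).trans ?_
          gcongr
          exact yext_half_add_le _ _
      _ = _ := by
          rw [div_eq_mul_inv, ← ENNReal.tsum_mul_right]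
          refine tsum_congr fun i => ?_
          rw [div_eq_mul_inv]
          ring
  have hmeas : ∀ i, Measurable fun p : E n × E n => K⁻¹ * (omega α (2 ^ i * ‖p.2‖ₑ) / ‖p.2‖ₑ ^ n) *
        (2⁻¹ * (yext A (F i p.1) + yext A (F i (p.1 - p.2)))) := fun i => by fun_prop
  calc _ ≤ ∫⁻ x : E n, ∫⁻ h : E n, ∑' i : ℕ, K⁻¹ * (omega α (2 ^ i * ‖h‖ₑ) / ‖h‖ₑ ^ n) *
        (2⁻¹ * (yext A (F i x) + yext A (F i (x - h)))) :=
        lintegral_mono fun x => lintegral_mono fun h => hpt x h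
    _ = ∑' i : ℕ, ∫⁻ x : E n, ∫⁻ h : E n, K⁻¹ * (omega α (2 ^ i * ‖h‖ₑ) / ‖h‖ₑ ^ n) *
        (2⁻¹ * (yext A (F i x) + yext A (F i (x - h)))) := by
        rw [← lintegral_tsum]
        · refine lintegral_congr fun x => lintegral_tsum fun i => ?_
          exact ((hmeas i).comp measurable_prodMk_left).aemeasurable
        · exact fun i => (hmeas i).lintegral_prod_right'.aemeasurable
    _ ≤ ∑' i : ℕ, ∫⁻ x, yext A (F i x) := by
        refine ENNReal.tsum_le_tsum fun i => ?_
        rw [lintegral_lintegral_swap (hmeas i).aemeasurable]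
        have h3 : ∀ h : E n, ∫⁻ x : E n, K⁻¹ * (omega α (2 ^ i * ‖h‖ₑ) / ‖h‖ₑ ^ n) *
            (2⁻¹ * (yext A (F i x) + yext A (F i (x - h)))) =
            K⁻¹ * (omega α (2 ^ i * ‖h‖ₑ) / ‖h‖ₑ ^ n) * ∫⁻ x, yext A (F i x) := by
          intro h
          rw [lintegral_const_mul _ (by fun_prop), lintegral_const_mul _ (by fun_prop),
            lintegral_add_left (by fun_prop),
            lintegral_sub_right_eq_self (fun x => yext A (F i x)), ← two_mul,
            ← mul_assoc 2⁻¹, ENNReal.inv_mul_cancel two_ne_zero ENNReal.ofNat_ne_top, one_mul]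
        simp only [h3]
        rw [lintegral_mul_const _ (by fun_prop), lintegral_const_mul _ (by fun_prop)]
        have h4 := lintegral_omega_dilate (n := n) (α := α) (c := (2 : ℝ) ^ i) (by positivity)
        rw [enorm_two_pow] at h4
        rw [h4]
        refine mul_le_of_le_one_left' ?_
        calc _ ≤ K⁻¹ * K := by gcongr
          _ = 1 := ENNReal.inv_mul_cancel hK0 hK
    _ ≤ 1 := hF1

/-- Core of the bound for the Littlewood-Paley norm. For each `i`, Jensen in `z` uses the dilated
`Θ`, whose mass is at most `L`. Then `hΘω` replaces this dilated kernel by `C ω(2^i|z|)/|z|ⁿ`, and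
summing over `i` leaves the factor `C K`. -/
theorem tsum_lintegral_yext_kernel_le (hn : 1 ≤ n) {α : ℝ} {Θ : E n → ℝ≥0∞} (hΘ : Measurable Θ)
    {D : E n → E n → ℝ≥0∞} (hD : Measurable (Function.uncurry D)) {C K M : ℝ≥0∞}
    (hΘω : ∀ z, Θ z * ‖z‖ₑ ^ n ≤ C * omega α ‖z‖ₑ) (hΘM : ∫⁻ z, Θ z ≤ M)
    (hsum : ∀ t, ∑' i : ℕ, omega α (2 ^ i * t) ≤ K) {L : ℝ≥0∞} (hL0 : L ≠ 0) (hL : L ≠ ⊤)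
    (hML : M ≤ L) :
    ∑' i : ℕ, ∫⁻ x : E n, yext A (L⁻¹ * ∫⁻ z, ‖(2 : ℝ) ^ i‖ₑ ^ n * Θ ((2 : ℝ) ^ i • z) * D x z) ≤
      L⁻¹ * (C * K) * ∫⁻ x : E n, ∫⁻ z : E n, yext A (D x z) / ‖z‖ₑ ^ n := by
  have hLi : L⁻¹ ≠ ⊤ := ENNReal.inv_ne_top.2 hL0
  have : Nontrivial (E n) := by
    have : Nonempty (Fin n) := ⟨⟨0, hn⟩⟩
    infer_instance
  have hz : ∀ᵐ z : E n, z ≠ 0 := by simp [ae_iff]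
  have hpt : ∀ (i : ℕ) (x : E n),
      yext A (L⁻¹ * ∫⁻ z, ‖(2 : ℝ) ^ i‖ₑ ^ n * Θ ((2 : ℝ) ^ i • z) * D x z) ≤
      ∫⁻ z, L⁻¹ * C * (omega α (2 ^ i * ‖z‖ₑ) * (yext A (D x z) / ‖z‖ₑ ^ n)) := by
    intro i x
    obtain ⟨c, hc⟩ : ∃ c, c = (2 : ℝ) ^ i := ⟨_, rfl⟩
    have hc0 : c ≠ 0 := by rw [hc]; positivity
    have hce : ‖c‖ₑ = 2 ^ i := by rw [hc, enorm_two_pow]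
    rw [← hc]
    have hw : Measurable fun z : E n => L⁻¹ * (‖c‖ₑ ^ n * Θ (c • z)) := by
      fun_prop
    have hw1 : ∫⁻ z : E n, L⁻¹ * (‖c‖ₑ ^ n * Θ (c • z)) ≤ 1 := by
      rw [lintegral_const_mul' _ _ hLi, lintegral_dilate hc0 Θ]
      calc L⁻¹ * ∫⁻ z, Θ z ≤ L⁻¹ * L := by gcongr; exact hΘM.trans hML
        _ = 1 := ENNReal.inv_mul_cancel hL0 hL
    have h1 := yext_lintegral_le (A := A) (f := D x) hw.aemeasurable hw1
    rw [← lintegral_const_mul' _ _ hLi]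
    simp only [mul_assoc] at h1 ⊢
    refine h1.trans (lintegral_mono_ae ?_)
    · filter_upwards [hz] with z hz
      have hz0 : ‖z‖ₑ ^ n ≠ 0 := by simp [hz]
      have hzt : ‖z‖ₑ ^ n ≠ ⊤ := by finiteness
      have key : ‖c‖ₑ ^ n * Θ (c • z) ≤
          C * omega α (2 ^ i * ‖z‖ₑ) / ‖z‖ₑ ^ n := by
        rw [ENNReal.le_div_iff_mul_le (Or.inl hz0) (Or.inl hzt)]
        have := hΘω (c • z)
        rw [enorm_smul, hce] at this
        rw [hce]
        refine le_trans (le_of_eq ?_) this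
        ring
      generalize yext A (D x z) = y
      generalize Θ (c • z) = θ at key ⊢
      generalize omega α (2 ^ i * ‖z‖ₑ) = o at key ⊢
      calc L⁻¹ * (‖c‖ₑ ^ n * (θ * y)) = L⁻¹ * (‖c‖ₑ ^ n * θ) * y := by ring
        _ ≤ L⁻¹ * (C * o / ‖z‖ₑ ^ n) * y := by gcongr
        _ = L⁻¹ * (C * (o * (y / ‖z‖ₑ ^ n))) := by simp only [div_eq_mul_inv]; ring
  have hDx : ∀ x, Measurable (D x) := fun x => hD.comp measurable_prodMk_left
  have hmeas : Measurable fun p : E n × E n => yext A (D p.1 p.2) / ‖p.2‖ₑ ^ n := by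
    have : Measurable fun p : E n × E n => D p.1 p.2 := hD
    fun_prop
  have hmeas2 : ∀ x, Measurable fun z : E n => yext A (D x z) / ‖z‖ₑ ^ n :=
    fun x => by have := hDx x; fun_prop
  have hmeas3 : ∀ i : ℕ, Measurable fun p : E n × E n =>
      L⁻¹ * C * (omega α (2 ^ i * ‖p.2‖ₑ) * (yext A (D p.1 p.2) / ‖p.2‖ₑ ^ n)) := by
    intro i; fun_prop
  calc _ ≤ ∑' i : ℕ, ∫⁻ x : E n, ∫⁻ z, L⁻¹ * C *
        (omega α (2 ^ i * ‖z‖ₑ) * (yext A (D x z) / ‖z‖ₑ ^ n)) :=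
        ENNReal.tsum_le_tsum fun i => lintegral_mono fun x => hpt i x
    _ = ∫⁻ x : E n, ∫⁻ z, ∑' i : ℕ, L⁻¹ * C *
        (omega α (2 ^ i * ‖z‖ₑ) * (yext A (D x z) / ‖z‖ₑ ^ n)) := by
        rw [← lintegral_tsum fun i => (hmeas3 i).lintegral_prod_right'.aemeasurable]
        refine lintegral_congr fun x => (lintegral_tsum fun i => ?_).symm
        have := hDx x
        fun_prop
    _ ≤ ∫⁻ x : E n, ∫⁻ z, L⁻¹ * (C * K) * (yext A (D x z) / ‖z‖ₑ ^ n) := by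
        refine lintegral_mono fun x => lintegral_mono fun z => ?_
        simp only
        rw [ENNReal.tsum_mul_left, ENNReal.tsum_mul_right]
        calc _ ≤ L⁻¹ * C * (K * (yext A (D x z) / ‖z‖ₑ ^ n)) := by gcongr; exact hsum _
          _ = _ := by ring
    _ = _ := by
        rw [← lintegral_const_mul _ hmeas.lintegral_prod_right']
        exact lintegral_congr fun x => lintegral_const_mul _ (hmeas2 x)

/-- The modular behind the Gagliardo-Slobodeckij seminorm, in the variables `x` and `h = x - y`. -/
theorem IsYoung.lintegral_gagliardo_eq (hA : IsYoung A) {F : Type*} [NormedAddCommGroup F]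
    [MeasurableSpace F] [BorelSpace F] [SecondCountableTopology F] {σ : ℝ} (hσ : 0 ≤ σ)
    {v : E n → F} (hv : Measurable v) {l : ℝ≥0} (hl : l ≠ 0) :
    ∫⁻ p : E n × E n, A (‖v p.1 - v p.2‖₊ / (l * ‖p.1 - p.2‖₊ ^ σ)) /
        (‖p.1 - p.2‖₊ : ℝ≥0∞) ^ n =
      ∫⁻ x : E n, ∫⁻ h : E n,
        yext A (‖v x - v (x - h)‖ₑ / (l * ‖h‖ₑ ^ σ)) / ‖h‖ₑ ^ n := by
  have h1 : ∀ p : E n × E n, A (‖v p.1 - v p.2‖₊ / (l * ‖p.1 - p.2‖₊ ^ σ)) /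
        (‖p.1 - p.2‖₊ : ℝ≥0∞) ^ n =
      yext A (‖v p.1 - v p.2‖ₑ / (l * ‖p.1 - p.2‖ₑ ^ σ)) / ‖p.1 - p.2‖ₑ ^ n := by
    intro p
    rcases eq_or_ne p.1 p.2 with h | h
    · simp [h, hA.map_zero]
    · have h0 : ‖p.1 - p.2‖₊ ≠ 0 := by simpa [sub_eq_zero] using h
      have h2 : l * ‖p.1 - p.2‖₊ ^ σ ≠ 0 := mul_ne_zero hl (by simp [NNReal.rpow_eq_zero_iff, h0])
      rw [hA.apply_div _ h2, ENNReal.coe_mul, ENNReal.coe_rpow_of_nonneg _ hσ]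
      rfl
  simp only [h1]
  rw [Measure.volume_eq_prod, lintegral_prod _ (by fun_prop)]
  refine lintegral_congr fun x => ?_
  rw [← lintegral_sub_left_eq_self _ x]
  simp

theorem IsYoung.lintegral_luxNorm_eq (hA : IsYoung A) {F : Type*} [NormedAddCommGroup F]
    (v : E n → F) {l : ℝ≥0} (hl : l ≠ 0) :
    ∫⁻ x, A (‖v x‖₊ / l) = ∫⁻ x, yext A (‖v x‖ₑ / l) :=
  lintegral_congr fun _ => hA.apply_div _ hl

end Modulars

end FracOrlicz

namespace FracOrlicz

/-! ### Tempered functions, their distributions, and cut-offs -/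

section Tempered

variable {n : ℕ}

/-- Functions that are integrable against the weight `(1 + |x|)^(-(n + 1))`. -/
def TempInt {F : Type*} [NormedAddCommGroup F] (f : E n → F) : Prop :=
  AEStronglyMeasurable f volume ∧ ∫⁻ x, ‖f x‖ₑ * wt x < ⊤

theorem TempInt.congr {F : Type*} [NormedAddCommGroup F] {f g : E n → F} (hf : TempInt f)
    (h : f =ᵐ[volume] g) : TempInt g := by
  refine ⟨hf.1.congr h, lt_of_le_of_lt (le_of_eq (lintegral_congr_ae ?_)) hf.2⟩
  filter_upwards [h] with x hx
  rw [hx]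

theorem TempInt.mono {F G : Type*} [NormedAddCommGroup F] [NormedAddCommGroup G] {f : E n → F}
    {g : E n → G} (hf : TempInt f) (hg : AEStronglyMeasurable g volume)
    (h : ∀ x, ‖g x‖ₑ ≤ ‖f x‖ₑ) : TempInt g :=
  ⟨hg, lt_of_le_of_lt (lintegral_mono fun x => by gcongr; exact h x) hf.2⟩

theorem TempInt.locallyIntegrable {F : Type*} [NormedAddCommGroup F] {f : E n → F}
    (hf : TempInt f) : LocallyIntegrable f volume := by
  rw [locallyIntegrable_iff]
  intro k hk
  obtain ⟨R, hR⟩ := hk.isBounded.exists_norm_le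
  refine ⟨hf.1.restrict, ?_⟩
  let C : ℝ≥0∞ := (1 + ENNReal.ofReal R) ^ (n + 1)
  have hC : C ≠ ⊤ := by simp only [C]; finiteness
  have hb : ∀ x ∈ k, ‖f x‖ₑ ≤ C * (‖f x‖ₑ * wt x) := by
    intro x hx
    have h1 : (wt x)⁻¹ ≤ C := by
      simp only [wt, inv_inv, C]
      gcongr
      rw [← ofReal_norm]
      exact ENNReal.ofReal_le_ofReal (hR x hx)
    calc ‖f x‖ₑ = (wt x)⁻¹ * wt x * ‖f x‖ₑ := by
          rw [ENNReal.inv_mul_cancel (wt_ne_zero x) (wt_ne_top x), one_mul]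
      _ ≤ C * wt x * ‖f x‖ₑ := by gcongr
      _ = _ := by ring
  calc ∫⁻ x in k, ‖f x‖ₑ ≤ ∫⁻ x in k, C * (‖f x‖ₑ * wt x) :=
        setLIntegral_mono_ae' hk.measurableSet (.of_forall hb)
    _ ≤ ∫⁻ x, C * (‖f x‖ₑ * wt x) := setLIntegral_le_lintegral _ _
    _ = C * ∫⁻ x, ‖f x‖ₑ * wt x := lintegral_const_mul' _ _ hC
    _ < ⊤ := ENNReal.mul_lt_top hC.lt_top hf.2

theorem schwartz_enorm_le (g : 𝓢(E n, ℂ)) (k : ℕ) (x : E n) :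
    ‖g x‖ₑ ≤ ENNReal.ofReal (2 ^ ((n + 1) * k) * (Finset.Iic ((n + 1) * k, 0)).sup
      (fun m => SchwartzMap.seminorm ℂ m.1 m.2) g) * wt x ^ k := by
  have h := SchwartzMap.one_add_le_sup_seminorm_apply (𝕜 := ℂ) (m := ((n + 1) * k, 0))
    le_rfl le_rfl g x
  simp only [norm_iteratedFDeriv_zero] at h
  set S := 2 ^ ((n + 1) * k) * (Finset.Iic ((n + 1) * k, 0)).sup
      (fun m => SchwartzMap.seminorm ℂ m.1 m.2) g with hS
  have h2 := ENNReal.ofReal_le_ofReal h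
  rw [ENNReal.ofReal_mul (by positivity), ENNReal.ofReal_pow (by positivity),
    ENNReal.ofReal_add zero_le_one (norm_nonneg x), ENNReal.ofReal_one, ofReal_norm,
    ofReal_norm] at h2
  rw [wt, ← ENNReal.inv_pow, ← pow_mul, ← div_eq_mul_inv,
    ENNReal.le_div_iff_mul_le (by left; positivity) (by left; finiteness), mul_comm]
  exact h2

theorem exists_schwartz_enorm_le (g : 𝓢(E n, ℂ)) (k : ℕ) :
    ∃ C : ℝ≥0∞, C ≠ ⊤ ∧ ∀ x, ‖g x‖ₑ ≤ C * wt x ^ k :=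
  ⟨_, ENNReal.ofReal_ne_top, schwartz_enorm_le g k⟩

theorem TempInt.lintegral_mul_le {f : E n → ℂ} (g : 𝓢(E n, ℂ)) :
    ∫⁻ x, ‖g x * f x‖ₑ ≤ ENNReal.ofReal (2 ^ (n + 1) * (Finset.Iic (n + 1, 0)).sup
      (fun m => SchwartzMap.seminorm ℂ m.1 m.2) g) * ∫⁻ x, ‖f x‖ₑ * wt x := by
  rw [← lintegral_const_mul' _ _ ENNReal.ofReal_ne_top]
  refine lintegral_mono fun x => ?_
  have h := schwartz_enorm_le g 1 x
  simp only [mul_one, pow_one] at h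
  simp only [enorm_mul]
  calc _ ≤ _ * ‖f x‖ₑ := mul_le_mul_left h _
    _ = _ := by ring

theorem TempInt.integrable_mul {f : E n → ℂ} (hf : TempInt f) (g : 𝓢(E n, ℂ)) :
    Integrable (fun x => g x * f x) := by
  refine ⟨g.continuous.aestronglyMeasurable.mul hf.1, ?_⟩
  exact lt_of_le_of_lt (TempInt.lintegral_mul_le g) (ENNReal.mul_lt_top ENNReal.ofReal_lt_top hf.2)

/-- The tempered distribution `g ↦ ∫ g f`. -/
def TempInt.toDist {f : E n → ℂ} (hf : TempInt f) : 𝓢'(E n, ℂ) :=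
  ContinuousLinearMap.toPointwiseConvergenceCLM _ _ _ _
    (SchwartzMap.mkCLMtoNormedSpace (𝕜 := ℂ) (σ := RingHom.id ℂ)
      (fun g : 𝓢(E n, ℂ) => ∫ x, g x * f x)
      (fun g h => by
        simp only [add_apply, add_mul]
        exact integral_add (hf.integrable_mul g) (hf.integrable_mul h))
      (fun a g => by
        simp only [smul_apply, smul_eq_mul, mul_assoc, RingHom.id_apply]
        exact integral_const_mul _ _)
      ⟨Finset.Iic (n + 1, 0), 2 ^ (n + 1) * (∫⁻ x, ‖f x‖ₑ * wt x).toReal, by positivity, fun g => by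
        have h1 := enorm_integral_le_lintegral_enorm (fun x => g x * f x) (μ := volume)
        have h2 := h1.trans (TempInt.lintegral_mul_le g)
        have h3 := ENNReal.toReal_mono (ENNReal.mul_ne_top ENNReal.ofReal_ne_top hf.2.ne) h2
        rw [toReal_enorm, ENNReal.toReal_mul, ENNReal.toReal_ofReal (by positivity)] at h3
        refine h3.trans (le_of_eq ?_)
        change _ = _ * (Finset.Iic (n + 1, 0)).sup (fun m => SchwartzMap.seminorm ℂ m.1 m.2) g
        ring⟩)

theorem TempInt.toDist_apply {f : E n → ℂ} (hf : TempInt f) (g : 𝓢(E n, ℂ)) :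
    hf.toDist g = ∫ x, g x * f x := rfl

theorem TempInt.represents {f : E n → ℂ} (hf : TempInt f) : Represents hf.toDist f :=
  ⟨hf.locallyIntegrable, fun g _ => hf.toDist_apply g⟩

theorem IsGenerator.hasCompactSupport {φ₀ : E n → ℝ} (h : IsGenerator φ₀) :
    HasCompactSupport φ₀ :=
  (isCompact_closedBall 0 2).of_isClosed_subset (isClosed_tsupport _)
    (h.supp.trans Metric.ball_subset_closedBall)

/-- The cut-off function as a Schwartz function. -/
def IsGenerator.toSchwartz {φ₀ : E n → ℝ} (h : IsGenerator φ₀) : 𝓢(E n, ℂ) :=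
  HasCompactSupport.toSchwartzMap (f := fun x => (φ₀ x : ℂ))
    (h.hasCompactSupport.comp_left Complex.ofReal_zero)
    (Complex.ofRealCLM.contDiff.comp h.smooth)

theorem IsGenerator.toSchwartz_apply {φ₀ : E n → ℝ} (h : IsGenerator φ₀) (x : E n) :
    h.toSchwartz x = (φ₀ x : ℂ) := rfl

theorem IsGenerator.hasCompactSupport_toSchwartz {φ₀ : E n → ℝ} (h : IsGenerator φ₀) :
    HasCompactSupport h.toSchwartz :=
  h.hasCompactSupport.comp_left Complex.ofReal_zero

theorem IsGenerator.toSchwartz_eq_one {φ₀ : E n → ℝ} (h : IsGenerator φ₀) :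
    ∀ x ∈ Metric.ball 0 1, h.toSchwartz x = 1 := fun x hx => by
  rw [h.toSchwartz_apply, h.eq_one x hx, Complex.ofReal_one]

theorem hasTemperateGrowth_smul (c : ℝ) : (fun x : E n => c • x).HasTemperateGrowth := by
  fun_prop

theorem hasTemperateGrowth_comp_smul (ψ : 𝓢(E n, ℂ)) (c : ℝ) :
    (fun x => ψ (c • x)).HasTemperateGrowth :=
  ψ.hasTemperateGrowth.comp (hasTemperateGrowth_smul c)

/-- Either `|c x| < 1`, where `1 - χ(c ·)` vanishes identically nearby, or `c|x| ≥ 1` and a plain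
bound may be multiplied by `c|x|`. The factor `c` forces convergence as `c → 0`; the factor `|x|` is
absorbed by the decay of a Schwartz function. -/
theorem exists_iteratedFDeriv_one_sub_le (χ : 𝓢(E n, ℂ)) (h1 : ∀ x ∈ Metric.ball 0 1, χ x = 1)
    (j : ℕ) : ∃ B, 0 ≤ B ∧ ∀ c : ℝ, 0 ≤ c → c ≤ 1 → ∀ x,
      ‖iteratedFDeriv ℝ j (fun x => 1 - χ (c • x)) x‖ ≤ B * (c * ‖x‖) := by
  refine ⟨1 + SchwartzMap.seminorm ℝ 0 j χ, by positivity, fun c hc hc1 x => ?_⟩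
  rcases lt_or_ge ‖c • x‖ 1 with hx | hx
  · have hev : (fun x => 1 - χ (c • x)) =ᶠ[nhds x] fun _ => 0 := by
      have hcont : Continuous fun y : E n => ‖c • y‖ := by fun_prop
      filter_upwards [hcont.continuousAt.eventually (gt_mem_nhds hx)] with y hy
      rw [h1 _ (by simpa using hy), sub_self]
    rw [(hev.iteratedFDeriv ℝ j).eq_of_nhds]
    simp only [iteratedFDeriv_fun_zero, Pi.zero_apply, norm_zero]
    positivity
  · have hx' : 1 ≤ c * ‖x‖ := by rwa [norm_smul, Real.norm_of_nonneg hc] at hx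
    have hs : ContDiff ℝ j (fun y => 1 - χ y) := contDiff_const.sub (χ.smooth j)
    have h2 := congrFun (iteratedFDeriv_comp_const_smul (𝕜 := ℝ) (i := j) c hs) x
    rw [h2, norm_smul, norm_pow, Real.norm_of_nonneg hc]
    have h3 : ‖iteratedFDeriv ℝ j (fun y => 1 - χ y) (c • x)‖ ≤
        1 + SchwartzMap.seminorm ℝ 0 j χ := by
      have h4 : (fun y => 1 - χ y) = (fun _ : E n => (1 : ℂ)) - (χ : E n → ℂ) := rfl
      rw [h4, iteratedFDeriv_sub_apply contDiff_const.contDiffAt (χ.smooth j).contDiffAt]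
      refine (norm_sub_le _ _).trans (add_le_add ?_ (χ.norm_iteratedFDeriv_le_seminorm ℝ j _))
      rcases eq_or_ne j 0 with rfl | hj
      · simp
      · simp [iteratedFDeriv_const_of_ne hj]
    calc c ^ j * ‖iteratedFDeriv ℝ j (fun y => 1 - χ y) (c • x)‖
        ≤ 1 * (1 + SchwartzMap.seminorm ℝ 0 j χ) := by
          gcongr
          exact pow_le_one₀ hc hc1
      _ ≤ _ := by
        rw [one_mul]
        exact le_mul_of_one_le_right (by positivity) hx'

/-- Multiplication by `χ(c x)`, where `χ = 1` near the origin, tends to the identity as `c → 0`. -/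
theorem tendsto_smulLeftCLM_cutoff (χ : 𝓢(E n, ℂ)) (h1 : ∀ x ∈ Metric.ball 0 1, χ x = 1)
    {c : ℕ → ℝ} (hc0 : ∀ N, 0 ≤ c N) (hc1 : ∀ N, c N ≤ 1)
    (hc : Filter.Tendsto c Filter.atTop (nhds 0)) (g : 𝓢(E n, ℂ)) :
    Filter.Tendsto (fun N => SchwartzMap.smulLeftCLM ℂ (fun x => χ (c N • x)) g)
      Filter.atTop (nhds g) := by
  rw [(schwartz_withSeminorms ℝ (E n) ℂ).tendsto_nhds]
  rintro ⟨k, m⟩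
  rw [SchwartzMap.schwartzSeminormFamily_apply]
  choose B hB0 hB using exists_iteratedFDeriv_one_sub_le χ h1
  -- The extra factor `|x|` in Leibniz' formula raises the weight exponent from `k` to `k + 1`.
  let M : ℝ := ∑ i ∈ Finset.range (m + 1), (m.choose i : ℝ) * B i *
    SchwartzMap.seminorm ℝ (k + 1) (m - i) g
  have hbound : ∀ N, SchwartzMap.seminorm ℝ k m
      (SchwartzMap.smulLeftCLM ℂ (fun x => χ (c N • x)) g - g) ≤ c N * M := by
    intro N
    refine SchwartzMap.seminorm_le_bound ℝ k m _ ?_ fun x => ?_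
    · exact mul_nonneg (hc0 N) (Finset.sum_nonneg fun i _ => by have := hB0 i; positivity)
    have hfun : ⇑(SchwartzMap.smulLeftCLM ℂ (fun x => χ (c N • x)) g - g) =
        -fun x => (1 - χ (c N • x)) * g x := by
      ext y
      rw [sub_apply, SchwartzMap.smulLeftCLM_apply_apply (hasTemperateGrowth_comp_smul χ _)]
      simp only [smul_eq_mul, Pi.neg_apply]
      ring
    have hs : ContDiff ℝ ∞ (fun y => 1 - χ (c N • y)) :=
      contDiff_const.sub ((χ.smooth ⊤).comp (contDiff_const_smul _))
    rw [hfun, iteratedFDeriv_neg, Pi.neg_apply, norm_neg]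
    have h2 := norm_iteratedFDeriv_mul_le hs (g.smooth ⊤) x (n := m) (by exact_mod_cast le_top)
    calc _ ≤ ‖x‖ ^ k * ∑ i ∈ Finset.range (m + 1), (m.choose i : ℝ) * (B i * (c N * ‖x‖)) *
          ‖iteratedFDeriv ℝ (m - i) g x‖ := by
          gcongr
          refine h2.trans ?_
          gcongr with i hi
          exact hB i (c N) (hc0 N) (hc1 N) x
      _ = c N * ∑ i ∈ Finset.range (m + 1), (m.choose i : ℝ) * B i *
          (‖x‖ ^ (k + 1) * ‖iteratedFDeriv ℝ (m - i) g x‖) := by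
          rw [Finset.mul_sum, Finset.mul_sum]
          refine Finset.sum_congr rfl fun i _ => ?_
          ring
      _ ≤ c N * M := by
          refine mul_le_mul_of_nonneg_left ?_ (hc0 N)
          refine Finset.sum_le_sum fun i _ => ?_
          have := hB0 i
          gcongr
          exact g.le_seminorm ℝ _ _ x
  have hlim : Filter.Tendsto (fun N => c N * M) Filter.atTop (nhds 0) := by
    simpa using hc.mul_const M
  intro ε hε
  filter_upwards [hlim.eventually (gt_mem_nhds hε)] with N hN
  exact (hbound N).trans_lt hN

theorem tendsto_two_pow_inv :
    Filter.Tendsto (fun N : ℕ => ((2 : ℝ) ^ N)⁻¹) Filter.atTop (nhds 0) := by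
  simpa using tendsto_pow_atTop_nhds_zero_of_lt_one (r := (2⁻¹ : ℝ)) (by norm_num) (by norm_num)

theorem hasCompactSupport_smulLeftCLM {χ : 𝓢(E n, ℂ)} (hχ : HasCompactSupport χ) {c : ℝ}
    (hc : c ≠ 0) (g : 𝓢(E n, ℂ)) :
    HasCompactSupport (SchwartzMap.smulLeftCLM ℂ (fun x => χ (c • x)) g) := by
  have h : ⇑(SchwartzMap.smulLeftCLM ℂ (fun x => χ (c • x)) g) = fun x => χ (c • x) * g x := by
    ext y
    rw [SchwartzMap.smulLeftCLM_apply_apply (hasTemperateGrowth_comp_smul χ _), smul_eq_mul]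
  rw [h]
  exact (hχ.comp_smul hc).mul_right

/-- A tempered distribution represented by `f` is given by `f` on all Schwartz functions. -/
theorem Represents.apply {φ₀ : E n → ℝ} (hφ : IsGenerator φ₀) {T : 𝓢'(E n, ℂ)} {f : E n → ℂ}
    (hT : Represents T f) (hf : TempInt f) (g : 𝓢(E n, ℂ)) : T g = ∫ x, g x * f x := by
  have ht := tendsto_smulLeftCLM_cutoff hφ.toSchwartz hφ.toSchwartz_eq_one
    (c := fun N => ((2 : ℝ) ^ N)⁻¹) (fun N => by positivity)
    (fun N => inv_le_one_of_one_le₀ (one_le_pow₀ one_le_two)) tendsto_two_pow_inv g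
  have hT1 : Filter.Tendsto (fun N : ℕ => T (SchwartzMap.smulLeftCLM ℂ
      (fun x => hφ.toSchwartz (((2 : ℝ) ^ N)⁻¹ • x)) g)) Filter.atTop (nhds (T g)) :=
    ((map_continuous T).tendsto g).comp ht
  have hT2 : Filter.Tendsto (fun N : ℕ => hf.toDist (SchwartzMap.smulLeftCLM ℂ
      (fun x => hφ.toSchwartz (((2 : ℝ) ^ N)⁻¹ • x)) g)) Filter.atTop (nhds (hf.toDist g)) :=
    ((map_continuous hf.toDist).tendsto g).comp ht
  rw [← hf.toDist_apply]
  refine tendsto_nhds_unique (hT1.congr fun N => ?_) hT2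
  rw [hf.toDist_apply]
  have hN : ((2 : ℝ) ^ N)⁻¹ ≠ 0 := by positivity
  exact hT.2 _ (hasCompactSupport_smulLeftCLM hφ.hasCompactSupport_toSchwartz hN g)

end Tempered

end FracOrlicz

namespace FracOrlicz

/-! ### Convolution with Schwartz kernels and Fourier multipliers -/

section Convolution

variable {n : ℕ}

open FourierTransform

/-- The `L¹`-dilation `x ↦ cⁿ κ(c x)` of a Schwartz function. -/
def dil (c : ℝ) (hc : c ≠ 0) (κ : 𝓢(E n, ℂ)) : 𝓢(E n, ℂ) :=
  ((c : ℂ) ^ n) • SchwartzMap.compCLMOfContinuousLinearEquiv ℂ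
    (ContinuousLinearEquiv.smulLeft (Units.mk0 c hc)) κ

theorem dil_apply (c : ℝ) (hc : c ≠ 0) (κ : 𝓢(E n, ℂ)) (x : E n) :
    dil c hc κ x = (c : ℂ) ^ n * κ (c • x) := rfl

theorem enorm_dil (c : ℝ) (hc : c ≠ 0) (κ : 𝓢(E n, ℂ)) (x : E n) :
    ‖dil c hc κ x‖ₑ = ‖c‖ₑ ^ n * ‖κ (c • x)‖ₑ := by
  rw [dil_apply, enorm_mul, enorm_pow]
  congr 2
  rw [← ofReal_norm, Complex.norm_real, ofReal_norm]

/-- The convolution `κ * f`. -/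
def kconv (κ : 𝓢(E n, ℂ)) (f : E n → ℂ) (x : E n) : ℂ := ∫ y, κ (x - y) * f y

theorem enorm_kconv_dil_le (c : ℝ) (hc : c ≠ 0) (κ : 𝓢(E n, ℂ)) (f : E n → ℂ) (x : E n) :
    ‖kconv (dil c hc κ) f x‖ₑ ≤ sconv c (fun z => ‖κ z‖ₑ) (fun y => ‖f y‖ₑ) x := by
  refine (enorm_integral_le_lintegral_enorm _).trans (le_of_eq ?_)
  rw [sconv, ← lintegral_sub_left_eq_self _ x]
  refine lintegral_congr fun z => ?_
  rw [sub_sub_cancel, enorm_mul, enorm_dil]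

/-- One factor `wt (y - x)` trades the weight at `y` for the weight at `x`, the other is integrated
in `y`. This is why convolution with a Schwartz kernel preserves `TempInt`. -/
theorem lintegral_wt_conv_le (x : E n) :
    ∫⁻ y : E n, wt (y - x) ^ 2 * wt y ≤ (∫⁻ y : E n, wt y) * wt x := by
  calc ∫⁻ y : E n, wt (y - x) ^ 2 * wt y ≤ ∫⁻ y : E n, wt (y - x) * wt x := by
        refine lintegral_mono fun y => ?_
        have h := wt_mul_wt_le (x - y) y
        rw [sub_add_cancel, ← neg_sub y x, wt_neg] at h
        calc wt (y - x) ^ 2 * wt y = wt (y - x) * (wt (y - x) * wt y) := by ring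
          _ ≤ _ := by gcongr
    _ = _ := by
        rw [lintegral_mul_const _ (by fun_prop), lintegral_sub_right_eq_self (fun y => wt y)]

theorem TempInt.lintegral_lintegral_lt_top {f : E n → ℂ} (hf : TempInt f) (κ : 𝓢(E n, ℂ)) :
    ∫⁻ x, ∫⁻ y, ‖κ (y - x)‖ₑ * ‖f x‖ₑ * wt y < ⊤ := by
  obtain ⟨C, hC, h⟩ := exists_schwartz_enorm_le κ 2
  let I := ∫⁻ y : E n, wt y
  have hI : I ≠ ⊤ := lintegral_wt_lt_top.ne
  have hfm := hf.1.enorm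
  calc ∫⁻ x, ∫⁻ y, ‖κ (y - x)‖ₑ * ‖f x‖ₑ * wt y
      ≤ ∫⁻ x, C * I * (‖f x‖ₑ * wt x) := by
        refine lintegral_mono fun x => ?_
        calc ∫⁻ y, ‖κ (y - x)‖ₑ * ‖f x‖ₑ * wt y
            ≤ ∫⁻ y, C * ‖f x‖ₑ * (wt (y - x) ^ 2 * wt y) := by
              refine lintegral_mono fun y => ?_
              calc ‖κ (y - x)‖ₑ * ‖f x‖ₑ * wt y ≤ C * wt (y - x) ^ 2 * ‖f x‖ₑ * wt y := by
                    gcongr; exact h _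
                _ = _ := by ring
          _ = C * ‖f x‖ₑ * ∫⁻ y, wt (y - x) ^ 2 * wt y :=
              lintegral_const_mul' _ _ (by finiteness)
          _ ≤ C * ‖f x‖ₑ * (I * wt x) := by gcongr; exact lintegral_wt_conv_le x
          _ = _ := by ring
    _ = C * I * ∫⁻ x, ‖f x‖ₑ * wt x := lintegral_const_mul' _ _ (by finiteness)
    _ < ⊤ := ENNReal.mul_lt_top (by finiteness) hf.2

theorem aestronglyMeasurable_kernel {f : E n → ℂ} (hf : AEStronglyMeasurable f volume)
    (κ : 𝓢(E n, ℂ)) :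
    AEStronglyMeasurable (fun p : E n × E n => κ (p.1 - p.2) * f p.2) (volume.prod volume) := by
  refine AEStronglyMeasurable.mul ?_ hf.comp_snd
  exact (κ.continuous.comp (continuous_fst.sub continuous_snd)).aestronglyMeasurable

theorem TempInt.kconv {f : E n → ℂ} (hf : TempInt f) (κ : 𝓢(E n, ℂ)) : TempInt (kconv κ f) := by
  refine ⟨(aestronglyMeasurable_kernel hf.1 κ).integral_prod_right', ?_⟩
  refine lt_of_le_of_lt ?_ (hf.lintegral_lintegral_lt_top κ)
  rw [lintegral_lintegral_swap]
  · refine lintegral_mono fun y => ?_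
    rw [lintegral_mul_const' _ _ (wt_ne_top y)]
    gcongr
    refine (enorm_integral_le_lintegral_enorm _).trans (le_of_eq ?_)
    exact lintegral_congr fun x => enorm_mul _ _
  · have h1 : AEMeasurable (fun p : E n × E n => ‖f p.1‖ₑ) (volume.prod volume) :=
      hf.1.enorm.comp_fst
    have h2 : Measurable fun p : E n × E n => ‖κ (p.2 - p.1)‖ₑ :=
      (κ.continuous.comp (continuous_snd.sub continuous_fst)).enorm.measurable
    have h3 : Measurable fun p : E n × E n => wt p.2 := by fun_prop
    exact (h2.aemeasurable.mul h1).mul h3.aemeasurable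

/-- Convolution with `κ` is dual to convolution with the reflection of `κ`. -/
theorem TempInt.integral_conv_mul {f : E n → ℂ} (hf : TempInt f) (κ g : 𝓢(E n, ℂ)) :
    ∫ x, (∫ y, κ (y - x) * g y) * f x = ∫ y, g y * FracOrlicz.kconv κ f y := by
  obtain ⟨C, hC, h⟩ := exists_schwartz_enorm_le g 1
  have hint : Integrable (Function.uncurry fun x y => κ (y - x) * g y * f x)
      (volume.prod volume) := by
    have hm : AEStronglyMeasurable (Function.uncurry fun x y => κ (y - x) * g y * f x)
        (volume.prod volume) := by
      refine AEStronglyMeasurable.mul ?_ hf.1.comp_fst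
      exact ((κ.continuous.comp (continuous_snd.sub continuous_fst)).mul
        (g.continuous.comp continuous_snd)).aestronglyMeasurable
    refine ⟨hm, ?_⟩
    refine lt_of_le_of_lt (lintegral_prod_le _) ?_
    refine lt_of_le_of_lt ?_ (ENNReal.mul_lt_top hC.lt_top (hf.lintegral_lintegral_lt_top κ))
    rw [← lintegral_const_mul' _ _ hC]
    refine lintegral_mono fun x => ?_
    rw [← lintegral_const_mul' _ _ hC]
    refine lintegral_mono fun y => ?_
    simp only [Function.uncurry, enorm_mul]
    have := h y
    rw [pow_one] at this
    calc ‖κ (y - x)‖ₑ * ‖g y‖ₑ * ‖f x‖ₑ ≤ ‖κ (y - x)‖ₑ * (C * wt y) * ‖f x‖ₑ := by gcongr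
      _ = _ := by ring
  calc ∫ x, (∫ y, κ (y - x) * g y) * f x = ∫ x, ∫ y, κ (y - x) * g y * f x := by
        simp only [integral_mul_const]
    _ = ∫ y, ∫ x, κ (y - x) * g y * f x := integral_integral_swap hint
    _ = _ := by
        refine integral_congr_ae (.of_forall fun y => ?_)
        simp only [FracOrlicz.kconv]
        rw [← integral_const_mul]
        refine integral_congr_ae (.of_forall fun x => ?_)
        simp only
        ring

-- Moving the Fourier transform from one factor of an integral to the other turns the modulated
-- symbol into its inverse transform. The kernel appears at `y - x` rather than `x - y` because this
-- is the action on test functions, transposed to the action on distributions.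
open VectorFourier in
theorem fourier_smulLeftCLM_fourierInv (ψ g : 𝓢(E n, ℂ)) {c : ℝ} (hc : 0 < c) (x : E n) :
    (𝓕 (SchwartzMap.smulLeftCLM ℂ (fun ξ => ψ (c⁻¹ • ξ)) (𝓕⁻ g))) x =
      ∫ y, dil c hc.ne' (𝓕⁻ ψ) (y - x) * g y := by
  let h : E n → ℂ := fun ξ => Real.fourierChar (-inner ℝ ξ x) • ψ (c⁻¹ • ξ)
  have hψ : Integrable fun ξ => ψ (c⁻¹ • ξ) :=
    (ψ.integrable (μ := volume)).comp_smul (inv_ne_zero hc.ne')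
  have hint : Integrable h := by
    refine hψ.congr' ?_ ?_
    · refine Continuous.aestronglyMeasurable ?_
      have : Continuous fun ξ => ψ (c⁻¹ • ξ) := ψ.continuous.comp (continuous_const_smul _)
      simp only [h]
      fun_prop
    · exact .of_forall fun ξ => (Circle.norm_smul _ _).symm
  have hflip := integral_fourierIntegral_smul_eq_flip (μ := (volume : Measure (E n)))
    (ν := (volume : Measure (E n))) (L := -innerₗ (E n)) (e := Real.fourierChar) (f := g) (g := h)
    Real.continuous_fourierChar (by simp only [LinearMap.neg_apply, innerₗ_apply_apply]; fun_prop)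
    g.integrable hint
  rw [SchwartzMap.fourier_coe, Real.fourier_eq]
  calc _ = ∫ ξ, fourierIntegral Real.fourierChar volume (-innerₗ (E n)) g ξ • h ξ := by
        refine integral_congr_ae (.of_forall fun ξ => ?_)
        simp only [h]
        rw [SchwartzMap.smulLeftCLM_apply_apply (hasTemperateGrowth_comp_smul ψ _),
          SchwartzMap.fourierInv_coe]
        change _ = (𝓕⁻ (g : E n → ℂ)) ξ • _
        simp only [Circle.smul_def, smul_eq_mul]
        ring
    _ = _ := hflip
    _ = _ := by
        refine integral_congr_ae (.of_forall fun y => ?_)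
        simp only [smul_eq_mul]
        rw [mul_comm, dil_apply]
        congr 1
        rw [SchwartzMap.fourierInv_coe, Real.fourierInv_eq, fourierIntegral]
        have h1 := Measure.integral_comp_inv_smul_of_nonneg volume
          (fun ξ => Real.fourierChar (inner ℝ ξ (c • (y - x))) • ψ ξ) hc.le
        simp only [finrank_euclideanSpace, Fintype.card_fin] at h1
        rw [← Complex.ofReal_pow, ← Complex.real_smul, ← h1]
        refine integral_congr_ae (.of_forall fun ξ => ?_)
        simp only [h]
        rw [smul_smul, ← AddChar.map_add_eq_mul]
        congr 2
        simp only [LinearMap.flip_apply, LinearMap.neg_apply, innerₗ_apply_apply, neg_neg]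
        rw [real_inner_smul_left, real_inner_smul_right, inner_sub_right, real_inner_comm]
        field_simp
        ring

/-- A Fourier multiplier applied to a function is convolution with the dilated kernel. -/
theorem TempInt.integral_multiplier_mul {f : E n → ℂ} (hf : TempInt f) (ψ g : 𝓢(E n, ℂ)) {c : ℝ}
    (hc : 0 < c) :
    ∫ x, (𝓕 (SchwartzMap.smulLeftCLM ℂ (fun ξ => ψ (c⁻¹ • ξ)) (𝓕⁻ g))) x * f x =
      ∫ y, g y * FracOrlicz.kconv (dil c hc.ne' (𝓕⁻ ψ)) f y := by
  simp only [fourier_smulLeftCLM_fourierInv ψ g hc]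
  exact hf.integral_conv_mul _ g

end Convolution

end FracOrlicz

namespace FracOrlicz

/-! ### Symbols of derivatives and weak derivatives against Schwartz functions -/

section Derivatives

variable {n : ℕ}

open FourierTransform LineDeriv

/-- The symbol `∏ⱼ (-2πi ⟨ξ, mⱼ⟩)`. -/
def symb {k : ℕ} (m : Fin k → E n) (ξ : E n) : ℂ :=
  ∏ j, (-(2 * Real.pi * Complex.I) * ((inner ℝ ξ (m j) : ℝ) : ℂ))

theorem symb_succ {k : ℕ} (m : Fin (k + 1) → E n) :
    symb m = fun ξ => (-(2 * Real.pi * Complex.I) * ((inner ℝ ξ (m 0) : ℝ) : ℂ)) *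
      symb (Fin.tail m) ξ := by
  ext ξ
  rw [symb, Fin.prod_univ_succ]
  rfl

@[fun_prop]
theorem symb_hasTemperateGrowth {k : ℕ} (m : Fin k → E n) : (symb m).HasTemperateGrowth := by
  induction k with
  | zero =>
    have : symb m = fun _ => 1 := by ext ξ; simp [symb]
    rw [this]
    fun_prop
  | succ k ih =>
    rw [symb_succ]
    have := ih (Fin.tail m)
    fun_prop

theorem symb_smul {k : ℕ} (m : Fin k → E n) (c : ℝ) (ξ : E n) :
    symb m (c • ξ) = (c : ℂ) ^ k * symb m ξ := by
  simp only [symb, real_inner_smul_left, Complex.ofReal_mul]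
  calc _ = ∏ j : Fin k, (c : ℂ) * (-(2 * Real.pi * Complex.I) * ((inner ℝ ξ (m j) : ℝ) : ℂ)) :=
        Finset.prod_congr rfl fun j _ => by ring
    _ = _ := by rw [Finset.prod_mul_distrib, Finset.prod_const, Finset.card_univ, Fintype.card_fin]

theorem smulLeftCLM_symb_succ {k : ℕ} (m : Fin (k + 1) → E n) (f : 𝓢(E n, ℂ)) :
    SchwartzMap.smulLeftCLM ℂ (symb m) f =
      -(2 * Real.pi * Complex.I) • SchwartzMap.smulLeftCLM ℂ (inner ℝ · (m 0))
        (SchwartzMap.smulLeftCLM ℂ (symb (Fin.tail m)) f) := by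
  ext ξ
  have h0 : (fun ξ : E n => inner ℝ ξ (m 0)).HasTemperateGrowth := by fun_prop
  rw [SchwartzMap.smulLeftCLM_apply_apply (symb_hasTemperateGrowth m), smul_apply,
    SchwartzMap.smulLeftCLM_apply_apply h0,
    SchwartzMap.smulLeftCLM_apply_apply (symb_hasTemperateGrowth _), symb_succ]
  simp only [smul_eq_mul, Complex.real_smul]
  ring

/-- The sign in `symb` is the one produced by differentiating the kernel `e^{-2πi x·ξ}` of the
Fourier transform. -/
theorem iteratedLineDerivOp_fourier {k : ℕ} (m : Fin k → E n) (f : 𝓢(E n, ℂ)) :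
    ∂^{m} (𝓕 f) = 𝓕 (SchwartzMap.smulLeftCLM ℂ (symb m) f) := by
  induction k with
  | zero =>
    have : symb m = fun _ => 1 := by ext ξ; simp [symb]
    rw [this, iteratedLineDerivOp_fin_zero]
    simp
  | succ k ih =>
    rw [iteratedLineDerivOp_succ_left, ih, SchwartzMap.lineDerivOp_fourier_eq,
      smulLeftCLM_symb_succ]

theorem fourierInv_iteratedLineDerivOp {k : ℕ} (m : Fin k → E n) (f : 𝓢(E n, ℂ)) :
    𝓕⁻ (∂^{m} f) = SchwartzMap.smulLeftCLM ℂ (symb m) (𝓕⁻ f) := by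
  have h := iteratedLineDerivOp_fourier m (𝓕⁻ f)
  rw [FourierTransform.fourier_fourierInv_eq] at h
  rw [h, FourierTransform.fourierInv_fourier_eq]

/-- The multiplier operator `g ↦ 𝓕 (ψ 𝓕⁻ g)`. -/
def multOp (ψ : E n → ℂ) (g : 𝓢(E n, ℂ)) : 𝓢(E n, ℂ) :=
  𝓕 (SchwartzMap.smulLeftCLM ℂ ψ (𝓕⁻ g))

theorem multOp_iteratedLineDerivOp {k : ℕ} (m : Fin k → E n) {ψ : E n → ℂ}
    (hψ : ψ.HasTemperateGrowth) (g : 𝓢(E n, ℂ)) :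
    multOp ψ (∂^{m} g) = multOp (fun ξ => ψ ξ * symb m ξ) g := by
  rw [multOp, fourierInv_iteratedLineDerivOp,
    SchwartzMap.smulLeftCLM_smulLeftCLM_apply hψ (symb_hasTemperateGrowth m)]
  rfl

theorem iteratedLineDerivOp_multOp {k : ℕ} (m : Fin k → E n) {ψ : E n → ℂ}
    (hψ : ψ.HasTemperateGrowth) (g : 𝓢(E n, ℂ)) :
    ∂^{m} (multOp ψ g) = multOp (fun ξ => symb m ξ * ψ ξ) g := by
  rw [multOp, iteratedLineDerivOp_fourier,
    SchwartzMap.smulLeftCLM_smulLeftCLM_apply (symb_hasTemperateGrowth m) hψ]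
  rfl

theorem multOp_multOp {ψ₁ ψ₂ : E n → ℂ} (h₁ : ψ₁.HasTemperateGrowth)
    (h₂ : ψ₂.HasTemperateGrowth) (g : 𝓢(E n, ℂ)) :
    multOp ψ₁ (multOp ψ₂ g) = multOp (fun ξ => ψ₁ ξ * ψ₂ ξ) g := by
  rw [multOp, multOp, FourierTransform.fourierInv_fourier_eq,
    SchwartzMap.smulLeftCLM_smulLeftCLM_apply h₁ h₂]
  rfl

theorem multOp_const_mul (a : ℂ) {ψ : E n → ℂ} (hψ : ψ.HasTemperateGrowth) (g : 𝓢(E n, ℂ)) :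
    multOp (fun ξ => a * ψ ξ) g = a • multOp ψ g := by
  have : (fun ξ => a * ψ ξ) = a • ψ := rfl
  rw [multOp, multOp, this, SchwartzMap.smulLeftCLM_smul hψ, smul_apply, FourierTransform.fourier_smul]

theorem multOp_sum {ι : Type*} (s : Finset ι) {ψ : ι → E n → ℂ}
    (hψ : ∀ i ∈ s, (ψ i).HasTemperateGrowth) (g : 𝓢(E n, ℂ)) :
    multOp (fun ξ => ∑ i ∈ s, ψ i ξ) g = ∑ i ∈ s, multOp (ψ i) g := by
  simp only [multOp]
  rw [SchwartzMap.smulLeftCLM_sum hψ, sum_apply]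
  exact map_sum (FourierTransform.fourierCLM ℂ 𝓢(E n, ℂ)) _ _

/-- The standard unit vectors with indices `I`. -/
def dirs {k : ℕ} (I : Fin k → Fin n) (j : Fin k) : E n := EuclideanSpace.single (I j) 1

theorem symb_dirs {k : ℕ} (I : Fin k → Fin n) (ξ : E n) :
    symb (dirs I) ξ = ∏ j, (-(2 * Real.pi * Complex.I) * (ξ (I j) : ℂ)) := by
  simp [symb, dirs, EuclideanSpace.inner_single_right]

/-- Weak derivatives are defined with real test functions; applying the definition to the real and
the imaginary part of `g` gives the complex identity. -/
theorem HasWeakGrad.integral_complex {k : ℕ} {u : E n → ℝ}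
    {v : E n → EuclideanSpace ℝ (Fin k → Fin n)} (h : HasWeakGrad k u v)
    (hu : TempInt fun x => (u x : ℂ)) (I : Fin k → Fin n) (hv : TempInt fun x => (v x I : ℂ))
    {g : 𝓢(E n, ℂ)} (hg : HasCompactSupport g) :
    ∫ x, (∂^{dirs I} g : 𝓢(E n, ℂ)) x * (u x : ℂ) = (-1) ^ k * ∫ x, g x * (v x I : ℂ) := by
  have hi1 := hu.integrable_mul (∂^{dirs I} g)
  have hi2 := hv.integrable_mul g
  have key : ∀ L : ℂ →L[ℝ] ℝ, (∀ (z : ℂ) (t : ℝ), L (z * t) = L z * t) →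
      L (∫ x, (∂^{dirs I} g : 𝓢(E n, ℂ)) x * (u x : ℂ)) =
        (-1) ^ k * L (∫ x, g x * (v x I : ℂ)) := by
    intro L hL
    have hsm : ContDiff ℝ ∞ (fun x => L (g x)) := L.contDiff.comp (g.smooth ⊤)
    have hcs : HasCompactSupport (fun x => L (g x)) := hg.comp_left (map_zero L)
    have hp := h.parts I (fun x => L (g x)) hsm hcs
    rw [← L.integral_comp_comm hi1, ← L.integral_comp_comm hi2]
    refine Eq.trans (integral_congr_ae (.of_forall fun x => ?_)) (hp.trans ?_)
    · simp only
      rw [hL, SchwartzMap.iteratedLineDerivOp_eq_iteratedFDeriv, mul_comm]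
      congr 1
      have := L.iteratedFDeriv_comp_left (g.smooth k).contDiffAt (x := x) (i := k) le_rfl
      change _ = (iteratedFDeriv ℝ k (L ∘ g) x) (dirs I)
      rw [this]
      rfl
    · congr 1
      refine integral_congr_ae (.of_forall fun x => ?_)
      simp only
      rw [hL, mul_comm]
  have hre := key Complex.reCLM (fun z t => by simp)
  have him := key Complex.imCLM (fun z t => by simp)
  simp only [Complex.reCLM_apply, Complex.imCLM_apply] at hre him
  have e : ((-1 : ℂ)) ^ k = (((-1 : ℝ) ^ k : ℝ) : ℂ) := by push_cast; rfl
  apply Complex.ext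
  · rw [hre, e, Complex.re_ofReal_mul]
  · rw [him, e, Complex.im_ofReal_mul]

/-- Both sides are continuous in the Schwartz topology, where compactly supported functions are
dense by cutting off. -/
theorem HasWeakGrad.integral_schwartz {φ₀ : E n → ℝ} (hφ : IsGenerator φ₀) {k : ℕ} {u : E n → ℝ}
    {v : E n → EuclideanSpace ℝ (Fin k → Fin n)} (h : HasWeakGrad k u v)
    (hu : TempInt fun x => (u x : ℂ)) (I : Fin k → Fin n) (hv : TempInt fun x => (v x I : ℂ))
    (g : 𝓢(E n, ℂ)) :
    ∫ x, (∂^{dirs I} g : 𝓢(E n, ℂ)) x * (u x : ℂ) = (-1) ^ k * ∫ x, g x * (v x I : ℂ) := by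
  have ht := tendsto_smulLeftCLM_cutoff hφ.toSchwartz hφ.toSchwartz_eq_one
    (c := fun N => ((2 : ℝ) ^ N)⁻¹) (fun N => by positivity)
    (fun N => inv_le_one_of_one_le₀ (one_le_pow₀ one_le_two)) tendsto_two_pow_inv g
  have hc1 : Continuous fun g : 𝓢(E n, ℂ) => hu.toDist (∂^{dirs I} g) :=
    (map_continuous hu.toDist).comp (continuous_iteratedLineDerivOp (dirs I))
  have hT1 := (hc1.tendsto g).comp ht
  have hT2 := (((map_continuous hv.toDist).tendsto g).comp ht).const_mul ((-1) ^ k)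
  refine tendsto_nhds_unique (hT1.congr fun N => ?_) hT2
  have hN : ((2 : ℝ) ^ N)⁻¹ ≠ 0 := by positivity
  exact h.integral_complex hu I hv
    (hasCompactSupport_smulLeftCLM hφ.hasCompactSupport_toSchwartz hN g)

end Derivatives

end FracOrlicz

namespace FracOrlicz

/-! ### Factoring derivatives out of a symbol; kernels of mean zero -/

section Factorization

variable {n : ℕ}

open FourierTransform LineDeriv

theorem symb_mul_self {k : ℕ} (I : Fin k → Fin n) (ξ : E n) :
    symb (dirs I) ξ * symb (dirs I) ξ =
      (-1) ^ k * (4 * Real.pi ^ 2) ^ k * ∏ j, (ξ (I j) : ℂ) ^ 2 := by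
  rw [symb_dirs, ← Finset.prod_mul_distrib]
  have : ∀ j, (-(2 * Real.pi * Complex.I) * (ξ (I j) : ℂ)) *
      (-(2 * Real.pi * Complex.I) * (ξ (I j) : ℂ)) =
      ((-1) * (4 * Real.pi ^ 2)) * (ξ (I j) : ℂ) ^ 2 := by
    intro j
    linear_combination (4 * Real.pi ^ 2 * (ξ (I j) : ℂ) ^ 2) * Complex.I_mul_I
  simp only [this]
  rw [Finset.prod_mul_distrib, Finset.prod_const, Finset.card_univ, Fintype.card_fin, mul_pow]

theorem sum_symb_mul_self (k : ℕ) (ξ : E n) :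
    ∑ I : Fin k → Fin n, symb (dirs I) ξ * symb (dirs I) ξ =
      (-1) ^ k * (4 * Real.pi ^ 2) ^ k * ((‖ξ‖ ^ 2 : ℝ) : ℂ) ^ k := by
  simp only [symb_mul_self]
  rw [← Finset.mul_sum, EuclideanSpace.real_norm_sq_eq, Complex.ofReal_sum, Finset.sum_pow']
  push_cast
  rfl

/-- A symbol vanishing near the origin is a combination of the symbols of the derivatives of
order `k`, with coefficients vanishing at the origin. -/
theorem exists_factorization (k : ℕ) (Φ : 𝓢(E n, ℂ)) (hΦ : HasCompactSupport Φ)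
    (h0 : ∀ᶠ ξ in nhds 0, Φ ξ = 0) :
    ∃ ψ : (Fin k → Fin n) → 𝓢(E n, ℂ), (∀ I, ψ I 0 = 0) ∧
      ∀ ξ, Φ ξ = ∑ I, symb (dirs I) ξ * ψ I ξ := by
  let d : E n → ℂ := fun ξ => (-1) ^ k * (4 * Real.pi ^ 2) ^ k * ((‖ξ‖ ^ 2 : ℝ) : ℂ) ^ k
  have hd : ContDiff ℝ ∞ d := by
    have h1 : ContDiff ℝ ∞ fun ξ : E n => ((‖ξ‖ ^ 2 : ℝ) : ℂ) :=
      Complex.ofRealCLM.contDiff.comp (contDiff_norm_sq ℝ)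
    exact contDiff_const.mul (h1.pow k)
  have hd0 : ∀ ξ, ξ ≠ 0 → d ξ ≠ 0 := by
    intro ξ hξ
    have h1 : ‖ξ‖ ≠ 0 := norm_ne_zero_iff.2 hξ
    have h2 : (Real.pi : ℂ) ≠ 0 := by exact_mod_cast Real.pi_ne_zero
    have h3 : ((‖ξ‖ ^ 2 : ℝ) : ℂ) ≠ 0 := by exact_mod_cast pow_ne_zero 2 h1
    simp only [d]
    exact mul_ne_zero (mul_ne_zero (pow_ne_zero _ (by norm_num))
      (pow_ne_zero _ (mul_ne_zero (by norm_num) (pow_ne_zero _ h2)))) (pow_ne_zero _ h3)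
  -- Since `d` is the sum of the squares of the derivative symbols, multiplying `Φ` by `symb / d`
  -- and pairing with `symb` recovers `Φ`. The only zero of `d` that can occur is the origin, near
  -- which `Φ` vanishes, so `f I` is smooth.
  let f : (Fin k → Fin n) → E n → ℂ := fun I ξ => Φ ξ * (symb (dirs I) ξ * (d ξ)⁻¹)
  have hcs : ∀ I, HasCompactSupport (f I) := fun I => hΦ.mul_right
  have hsm : ∀ I, ContDiff ℝ ∞ (f I) := by
    intro I
    rw [contDiff_iff_contDiffAt]
    intro ξ
    rcases eq_or_ne ξ 0 with rfl | hξ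
    · have : f I =ᶠ[nhds 0] fun _ => 0 := by
        filter_upwards [h0] with ξ hξ
        simp only [f, hξ, zero_mul]
      exact contDiffAt_const.congr_of_eventuallyEq this
    · exact (Φ.smooth ⊤).contDiffAt.mul
        ((symb_hasTemperateGrowth (dirs I)).1.contDiffAt.mul (hd.contDiffAt.inv (hd0 ξ hξ)))
  refine ⟨fun I => (hcs I).toSchwartzMap (hsm I), fun I => ?_, fun ξ => ?_⟩
  · change f I 0 = 0
    simp only [f, h0.self_of_nhds, zero_mul]
  · change Φ ξ = ∑ I, symb (dirs I) ξ * (Φ ξ * (symb (dirs I) ξ * (d ξ)⁻¹))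
    rcases eq_or_ne ξ 0 with rfl | hξ
    · simp [h0.self_of_nhds]
    · have h1 : ∑ I : Fin k → Fin n, symb (dirs I) ξ * (Φ ξ * (symb (dirs I) ξ * (d ξ)⁻¹)) =
          Φ ξ * (d ξ)⁻¹ * ∑ I : Fin k → Fin n, symb (dirs I) ξ * symb (dirs I) ξ := by
        rw [Finset.mul_sum]
        exact Finset.sum_congr rfl fun I _ => by ring
      rw [h1, sum_symb_mul_self, mul_assoc]
      change Φ ξ = Φ ξ * ((d ξ)⁻¹ * d ξ)
      rw [inv_mul_cancel₀ (hd0 ξ hξ), mul_one]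

theorem integral_fourierInv_eq (ψ : 𝓢(E n, ℂ)) : ∫ x, (𝓕⁻ ψ : 𝓢(E n, ℂ)) x = ψ 0 := by
  have h : (𝓕 (𝓕⁻ ψ : 𝓢(E n, ℂ)) : 𝓢(E n, ℂ)) 0 = ψ 0 := by
    rw [FourierTransform.fourier_fourierInv_eq]
  rw [← h, SchwartzMap.fourier_coe, Real.fourier_eq]
  simp

theorem integral_dil (c : ℝ) (hc : 0 < c) (κ : 𝓢(E n, ℂ)) :
    ∫ x, dil c hc.ne' κ x = ∫ x, κ x := by
  simp only [dil_apply]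
  rw [integral_const_mul, Measure.integral_comp_smul_of_nonneg _ _ _ (hR := hc.le)]
  simp only [finrank_euclideanSpace, Fintype.card_fin]
  rw [Complex.real_smul, ← mul_assoc]
  push_cast
  rw [mul_inv_cancel₀, one_mul]
  exact pow_ne_zero _ (by exact_mod_cast hc.ne')

/-- For a kernel of mean zero, the convolution is controlled by differences. -/
theorem enorm_kconv_le_of_integral_eq_zero {c : ℝ} (hc : 0 < c) {κ : 𝓢(E n, ℂ)}
    (hκ : ∫ x, κ x = 0) (f : E n → ℂ) (x : E n) :
    ‖kconv (dil c hc.ne' κ) f x‖ₑ ≤ ∫⁻ z, ‖c‖ₑ ^ n * ‖κ (c • z)‖ₑ * ‖f x - f (x - z)‖ₑ := by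
  have hz : ∫ y, dil c hc.ne' κ (x - y) = 0 := by
    rw [integral_sub_left_eq_self, integral_dil c hc, hκ]
  have hi : Integrable fun y => dil c hc.ne' κ (x - y) :=
    (dil c hc.ne' κ).integrable.comp_sub_left x
  by_cases hint : Integrable fun y => dil c hc.ne' κ (x - y) * f y
  · have h1 : kconv (dil c hc.ne' κ) f x = ∫ y, dil c hc.ne' κ (x - y) * (f y - f x) := by
      simp only [mul_sub]
      rw [integral_sub hint (hi.mul_const _), integral_mul_const, hz, zero_mul, sub_zero, kconv]
    rw [h1]
    refine (enorm_integral_le_lintegral_enorm _).trans (le_of_eq ?_)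
    rw [← lintegral_sub_left_eq_self _ x]
    refine lintegral_congr fun z => ?_
    rw [sub_sub_cancel, enorm_mul, enorm_dil, enorm_sub_rev]
  · rw [kconv, integral_undef hint, enorm_zero]
    exact zero_le

end Factorization

/-! ### Decay of kernels against powers of the norm -/

section Kernels

variable {n : ℕ}

theorem exists_sum_enorm_le {ι : Type*} [Fintype ι] (κ : ι → 𝓢(E n, ℂ)) (k : ℕ) :
    ∃ C : ℝ≥0∞, C ≠ ⊤ ∧ ∀ x, ∑ I, ‖κ I x‖ₑ ≤ C * wt x ^ k := by
  choose C hC h using fun I => exists_schwartz_enorm_le (κ I) k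
  refine ⟨∑ I, C I, by simpa using hC, fun x => ?_⟩
  rw [Finset.sum_mul]
  exact Finset.sum_le_sum fun I _ => h I x

theorem wt_sq_mul_rpow_le {σ : ℝ} (hσ0 : 0 ≤ σ) (hσ1 : σ ≤ 1) (z : E n) :
    wt z ^ 2 * ‖z‖ₑ ^ σ ≤ wt z := by
  have h1 : wt z * ‖z‖ₑ ^ σ ≤ 1 := by
    rw [wt, mul_comm, ← div_eq_mul_inv]
    refine ENNReal.div_le_of_le_mul ?_
    rw [one_mul]
    calc ‖z‖ₑ ^ σ ≤ (1 + ‖z‖ₑ) ^ σ := by gcongr; exact le_add_self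
      _ ≤ (1 + ‖z‖ₑ) ^ ((n + 1 : ℕ) : ℝ) := by
        apply ENNReal.rpow_le_rpow_of_exponent_le le_self_add
        push_cast
        have : (0 : ℝ) ≤ n := n.cast_nonneg
        linarith
      _ = _ := ENNReal.rpow_natCast _ _
  calc wt z ^ 2 * ‖z‖ₑ ^ σ = wt z * (wt z * ‖z‖ₑ ^ σ) := by ring
    _ ≤ wt z * 1 := by gcongr
    _ = wt z := mul_one _

/-- The square of the weight is `(1 + |z|)^{-(2n+2)}`, which absorbs `|z|ⁿ` (leaving `|z|^σ`) and
also `|z|^{2σ+n}` (leaving `|z|^{-σ}`). This supplies the hypothesis `hΘω` of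
`tsum_lintegral_yext_kernel_le`. -/
theorem wt_sq_mul_rpow_mul_pow_le {σ : ℝ} (hσ0 : 0 < σ) (hσ1 : σ ≤ 1) (z : E n) :
    wt z ^ 2 * ‖z‖ₑ ^ σ * ‖z‖ₑ ^ n ≤ omega σ ‖z‖ₑ := by
  rcases eq_or_ne z 0 with rfl | hz
  · simp [ENNReal.zero_rpow_of_pos hσ0]
  have hz0 : ‖z‖ₑ ≠ 0 := by simpa using hz
  have hzt : ‖z‖ₑ ≠ ⊤ := by simp
  have hw : wt z ^ 2 = ((1 + ‖z‖ₑ) ^ (2 * n + 2))⁻¹ := by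
    rw [wt, ← ENNReal.inv_pow, ← pow_mul]
    congr 2
    ring
  have hp : ∀ r : ℝ, 0 ≤ r → r ≤ 2 * n + 2 → ((1 + ‖z‖ₑ) ^ (2 * n + 2))⁻¹ * ‖z‖ₑ ^ r ≤ 1 := by
    intro r hr0 hr
    rw [mul_comm, ← div_eq_mul_inv]
    refine ENNReal.div_le_of_le_mul ?_
    rw [one_mul]
    calc ‖z‖ₑ ^ r ≤ (1 + ‖z‖ₑ) ^ r := by gcongr; exact le_add_self
      _ ≤ (1 + ‖z‖ₑ) ^ ((2 * n + 2 : ℕ) : ℝ) := by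
        apply ENNReal.rpow_le_rpow_of_exponent_le le_self_add
        push_cast
        exact hr
      _ = _ := ENNReal.rpow_natCast _ _
  have hn0 : (0 : ℝ) ≤ n := n.cast_nonneg
  rw [hw]
  refine le_min ?_ ?_
  · calc _ = ((1 + ‖z‖ₑ) ^ (2 * n + 2))⁻¹ * ‖z‖ₑ ^ (n : ℝ) * ‖z‖ₑ ^ σ := by
          rw [ENNReal.rpow_natCast]; ring
      _ ≤ 1 * ‖z‖ₑ ^ σ := by gcongr; exact hp n hn0 (by linarith)
      _ = _ := one_mul _
  · have h1 : ‖z‖ₑ ^ σ * ‖z‖ₑ ^ n = ‖z‖ₑ ^ (2 * σ + n) * ‖z‖ₑ ^ (-σ) := by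
      rw [← ENNReal.rpow_natCast, ← ENNReal.rpow_add _ _ hz0 hzt, ← ENNReal.rpow_add _ _ hz0 hzt]
      congr 1
      ring
    rw [mul_assoc, h1, ← mul_assoc]
    calc _ ≤ 1 * ‖z‖ₑ ^ (-σ) := by gcongr; exact hp _ (by linarith) (by linarith)
      _ = _ := one_mul _

end Kernels

end FracOrlicz

namespace FracOrlicz

/-! ### Dyadic blocks expressed through the highest weak gradient -/

section DyadicSymbols

variable {n : ℕ} {φ₀ : E n → ℝ}

open FourierTransform LineDeriv

/-- The dilation `x ↦ ψ(c x)` of a Schwartz function. -/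
def scale (c : ℝ) (hc : c ≠ 0) (ψ : 𝓢(E n, ℂ)) : 𝓢(E n, ℂ) :=
  SchwartzMap.compCLMOfContinuousLinearEquiv ℂ
    (ContinuousLinearEquiv.smulLeft (Units.mk0 c hc)) ψ

theorem hasCompactSupport_scale {c : ℝ} (hc : c ≠ 0) {ψ : 𝓢(E n, ℂ)} (hψ : HasCompactSupport ψ) :
    HasCompactSupport (scale c hc ψ) := by
  have h : ⇑(scale c hc ψ) = fun x => ψ (c • x) := rfl
  rw [h]
  exact hψ.comp_smul hc

/-- The symbol `φ₀(2π ξ)`. -/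
def IsGenerator.symb₀ (h : IsGenerator φ₀) : 𝓢(E n, ℂ) :=
  scale (2 * Real.pi) Real.two_pi_pos.ne' h.toSchwartz

theorem IsGenerator.symb₀_apply (h : IsGenerator φ₀) (ξ : E n) :
    h.symb₀ ξ = (φ₀ ((2 * Real.pi) • ξ) : ℂ) := rfl

/-- The symbol `φ₀(2π ξ) - φ₀(4π ξ)`. -/
def IsGenerator.symb₁ (h : IsGenerator φ₀) : 𝓢(E n, ℂ) :=
  h.symb₀ - scale 2 two_ne_zero h.symb₀

theorem IsGenerator.symb₁_apply (h : IsGenerator φ₀) (ξ : E n) :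
    h.symb₁ ξ = h.symb₀ ξ - h.symb₀ ((2 : ℝ) • ξ) := rfl

theorem IsGenerator.hasCompactSupport_symb₀ (h : IsGenerator φ₀) : HasCompactSupport h.symb₀ :=
  hasCompactSupport_scale _ h.hasCompactSupport_toSchwartz

theorem IsGenerator.hasCompactSupport_symb₁ (h : IsGenerator φ₀) : HasCompactSupport h.symb₁ :=
  h.hasCompactSupport_symb₀.sub (hasCompactSupport_scale two_ne_zero h.hasCompactSupport_symb₀)

/-- Both terms of the difference equal `1` near the origin. This cancellation makes
`exists_factorization` applicable to all blocks but the first. -/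
theorem IsGenerator.symb₁_eventually_zero (h : IsGenerator φ₀) :
    ∀ᶠ ξ in nhds 0, h.symb₁ ξ = 0 := by
  have hev : ∀ c : ℝ, ∀ᶠ ξ : E n in nhds 0, c • ξ ∈ Metric.ball (0 : E n) 1 := by
    intro c
    have hc : Continuous fun ξ : E n => c • ξ := continuous_const_smul c
    have h0 : Metric.ball (0 : E n) 1 ∈ nhds (c • (0 : E n)) := by
      rw [smul_zero]
      exact Metric.ball_mem_nhds _ one_pos
    exact hc.continuousAt.eventually h0
  filter_upwards [hev (2 * Real.pi), hev (2 * Real.pi * 2)] with ξ h1 h2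
  rw [h.symb₁_apply, h.symb₀_apply, h.symb₀_apply, smul_smul, h.eq_one _ h1, h.eq_one _ h2, sub_self]

theorem IsGenerator.dyadic_zero (h : IsGenerator φ₀) (ξ : E n) :
    ((dyadic φ₀ 0 ((2 * Real.pi) • ξ) : ℝ) : ℂ) = h.symb₀ ξ := rfl

theorem IsGenerator.dyadic_succ (h : IsGenerator φ₀) (j : ℕ) (ξ : E n) :
    ((dyadic φ₀ (j + 1) ((2 * Real.pi) • ξ) : ℝ) : ℂ) =
      h.symb₁ (((2 : ℝ) ^ (j + 1))⁻¹ • ξ) := by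
  rw [h.symb₁_apply, h.symb₀_apply, h.symb₀_apply, dyadic, Complex.ofReal_sub]
  have e1 : (2 * Real.pi) • ((2 : ℝ) ^ (j + 1))⁻¹ • ξ = ((2 : ℝ) ^ (j + 1))⁻¹ • (2 * Real.pi) • ξ :=
    smul_comm _ _ _
  have e2 : (2 * Real.pi) • (2 : ℝ) • ((2 : ℝ) ^ (j + 1))⁻¹ • ξ =
      ((2 : ℝ) ^ j)⁻¹ • (2 * Real.pi) • ξ := by
    rw [smul_smul, smul_smul, smul_smul]
    congr 1
    rw [pow_succ]
    field_simp
  rw [e1, e2]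

theorem dyadicOp_apply (i : ℕ) (T : 𝓢'(E n, ℂ)) (g : 𝓢(E n, ℂ)) :
    dyadicOp φ₀ i T g = T (multOp (fun ξ => ((dyadic φ₀ i ((2 * Real.pi) • ξ) : ℝ) : ℂ)) g) := rfl

theorem TempInt.toDist_multOp {f : E n → ℂ} (hf : TempInt f) (ψ g : 𝓢(E n, ℂ)) {c : ℝ}
    (hc : 0 < c) :
    hf.toDist (multOp (fun ξ => ψ (c⁻¹ • ξ)) g) =
      ∫ y, g y * FracOrlicz.kconv (dil c hc.ne' (𝓕⁻ ψ)) f y :=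
  hf.integral_multiplier_mul ψ g hc

theorem IsGenerator.dyadicOp_zero_apply (h : IsGenerator φ₀) {f : E n → ℂ} (hf : TempInt f)
    (g : 𝓢(E n, ℂ)) :
    dyadicOp φ₀ 0 hf.toDist g =
      ∫ y, g y * kconv (dil 1 one_ne_zero (𝓕⁻ h.symb₀)) f y := by
  have := hf.toDist_multOp h.symb₀ g one_pos
  simp only [inv_one, one_smul] at this
  exact this

/-- By homogeneity, the symbols of order `m` at `ξ / c` give `c^{-m}` times those at `ξ`. The latter
are derivatives of the test function, and integration by parts passes them to `u`, producing `v` and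
the sign `(-1)^m`. -/
theorem IsGenerator.dyadicOp_succ_apply (h : IsGenerator φ₀) {m : ℕ}
    {ψ : (Fin m → Fin n) → 𝓢(E n, ℂ)} (hψ : ∀ ξ, h.symb₁ ξ = ∑ I, symb (dirs I) ξ * ψ I ξ)
    {u : E n → ℝ} {v : E n → EuclideanSpace ℝ (Fin m → Fin n)} (huv : HasWeakGrad m u v)
    (hu : TempInt fun x => (u x : ℂ)) (hv : ∀ I, TempInt fun x => (v x I : ℂ)) (j : ℕ)
    (g : 𝓢(E n, ℂ)) :
    dyadicOp φ₀ (j + 1) hu.toDist g =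
      ∫ y, g y * ∑ I, (((((2 : ℝ) ^ (j + 1))⁻¹ : ℝ) : ℂ) ^ m * (-1) ^ m *
        kconv (dil ((2 : ℝ) ^ (j + 1)) (by positivity) (𝓕⁻ (ψ I))) (fun x => (v x I : ℂ)) y) := by
  obtain ⟨c, hc⟩ : ∃ c : ℝ, c = 2 ^ (j + 1) := ⟨_, rfl⟩
  have hc0 : 0 < c := by rw [hc]; positivity
  have hg : ∀ I, (fun ξ => ψ I (c⁻¹ • ξ)).HasTemperateGrowth := fun I =>
    hasTemperateGrowth_comp_smul _ _
  have e1 : multOp (fun ξ => ((dyadic φ₀ (j + 1) ((2 * Real.pi) • ξ) : ℝ) : ℂ)) g =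
      ∑ I, ((c⁻¹ : ℝ) : ℂ) ^ m • ∂^{dirs I} (multOp (fun ξ => ψ I (c⁻¹ • ξ)) g) := by
    have e2 : (fun ξ => ((dyadic φ₀ (j + 1) ((2 * Real.pi) • ξ) : ℝ) : ℂ)) =
        fun ξ => ∑ I, ((c⁻¹ : ℝ) : ℂ) ^ m * (symb (dirs I) ξ * ψ I (c⁻¹ • ξ)) := by
      ext ξ
      rw [h.dyadic_succ, ← hc, hψ]
      refine Finset.sum_congr rfl fun I _ => ?_
      rw [symb_smul, mul_assoc]
    have h1 : ∀ I, (fun ξ => symb (dirs I) ξ * ψ I (c⁻¹ • ξ)).HasTemperateGrowth := fun I =>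
      (symb_hasTemperateGrowth _).mul (hg I)
    have h2 : ∀ I, (fun ξ => ((c⁻¹ : ℝ) : ℂ) ^ m *
        (symb (dirs I) ξ * ψ I (c⁻¹ • ξ))).HasTemperateGrowth := fun I =>
      (Function.HasTemperateGrowth.const _).mul (h1 I)
    rw [e2, multOp_sum _ (fun I _ => h2 I)]
    refine Finset.sum_congr rfl fun I _ => ?_
    rw [multOp_const_mul _ (h1 I), iteratedLineDerivOp_multOp _ (hg I)]
  subst hc
  rw [dyadicOp_apply, e1, map_sum]
  simp only [Finset.mul_sum]
  rw [integral_finsetSum]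
  · refine Finset.sum_congr rfl fun I _ => ?_
    rw [map_smul, hu.toDist_apply, huv.integral_schwartz h hu I (hv I)]
    have := (hv I).toDist_multOp (ψ I) g hc0
    rw [(hv I).toDist_apply] at this
    rw [this, smul_eq_mul, ← mul_assoc, ← integral_const_mul]
    refine integral_congr_ae (.of_forall fun y => ?_)
    simp only
    ring
  · intro I _
    have := (((hv I).kconv (dil _ hc0.ne' (𝓕⁻ (ψ I)))).integrable_mul g).const_mul
      (((((2 : ℝ) ^ (j + 1))⁻¹ : ℝ) : ℂ) ^ m * (-1) ^ m)
    refine this.congr (.of_forall fun y => ?_)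
    simp only
    ring

theorem IsYoung.apply_rpow_mul_div {A : ℝ≥0 → ℝ≥0∞} (hA : IsYoung A) (r : ℝ) (z : ℂ) {l : ℝ≥0}
    (hl : l ≠ 0) : A ((2 : ℝ≥0) ^ r * ‖z‖₊ / l) = yext A ((2 : ℝ≥0∞) ^ r * ‖z‖ₑ / l) := by
  rw [hA.apply_div _ hl, ENNReal.coe_mul, ENNReal.coe_rpow_of_ne_zero two_ne_zero]
  rfl

theorem sconv_div {c : ℝ} {W F : E n → ℝ≥0∞} {l : ℝ≥0∞} (hl : l ≠ 0) (x : E n) :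
    sconv c W (fun y => F y / l) x = sconv c W F x / l := by
  simp only [sconv, div_eq_mul_inv, ← mul_assoc]
  exact lintegral_mul_const' _ _ (ENNReal.inv_ne_top.2 hl)

/-- The condition `ψ I 0 = 0` says that the kernels have mean zero, so `v x` may be subtracted
inside each convolution. -/
theorem enorm_sum_kconv_le {m : ℕ} {ψ : (Fin m → Fin n) → 𝓢(E n, ℂ)} (hψ0 : ∀ I, ψ I 0 = 0)
    {v : E n → EuclideanSpace ℝ (Fin m → Fin n)} (hv : Measurable v) {c : ℝ} (hc : 0 < c)
    (a : ℂ) (x : E n) :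
    ‖∑ I, (a * kconv (dil c hc.ne' (𝓕⁻ (ψ I))) (fun x => (v x I : ℂ)) x)‖ₑ ≤
      ‖a‖ₑ * ∫⁻ z, ‖c‖ₑ ^ n * (∑ I, ‖(𝓕⁻ (ψ I) : 𝓢(E n, ℂ)) (c • z)‖ₑ) * ‖v x - v (x - z)‖ₑ := by
  have hm : ∀ I, Measurable fun z => ‖(𝓕⁻ (ψ I) : 𝓢(E n, ℂ)) (c • z)‖ₑ := fun I =>
    ((𝓕⁻ (ψ I) : 𝓢(E n, ℂ)).continuous.comp (continuous_const_smul c)).enorm.measurable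
  have h1 : ∀ I, ‖kconv (dil c hc.ne' (𝓕⁻ (ψ I))) (fun x => (v x I : ℂ)) x‖ₑ ≤
      ∫⁻ z, ‖c‖ₑ ^ n * ‖(𝓕⁻ (ψ I) : 𝓢(E n, ℂ)) (c • z)‖ₑ * ‖v x - v (x - z)‖ₑ := by
    intro I
    have h0 : ∫ x, (𝓕⁻ (ψ I) : 𝓢(E n, ℂ)) x = 0 := by rw [integral_fourierInv_eq, hψ0]
    refine (enorm_kconv_le_of_integral_eq_zero hc h0 _ x).trans (lintegral_mono fun z => ?_)
    gcongr
    rw [← Complex.ofReal_sub, ← ofReal_norm, Complex.norm_real, ← ofReal_norm]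
    exact ENNReal.ofReal_le_ofReal (PiLp.norm_apply_le (v x - v (x - z)) I)
  refine (enorm_sum_le _ _).trans ?_
  simp only [enorm_mul]
  rw [← Finset.mul_sum]
  gcongr
  calc _ ≤ ∑ I, ∫⁻ z, ‖c‖ₑ ^ n * ‖(𝓕⁻ (ψ I) : 𝓢(E n, ℂ)) (c • z)‖ₑ * ‖v x - v (x - z)‖ₑ :=
        Finset.sum_le_sum fun I _ => h1 I
    _ = ∫⁻ z, ∑ I, ‖c‖ₑ ^ n * ‖(𝓕⁻ (ψ I) : 𝓢(E n, ℂ)) (c • z)‖ₑ * ‖v x - v (x - z)‖ₑ := by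
        rw [lintegral_finsetSum]
        intro I _
        have := hm I
        fun_prop
    _ = _ := by
        refine lintegral_congr fun z => ?_
        rw [Finset.mul_sum, Finset.sum_mul]

end DyadicSymbols

end FracOrlicz

namespace FracOrlicz

/-! ### Littlewood-Paley norm bounded by the Sobolev norm -/

section UpperBound

variable {n : ℕ} {φ₀ : E n → ℝ}

open FourierTransform LineDeriv

theorem FNorm_le {s : ℝ} {A : ℝ≥0 → ℝ≥0∞} (hA : IsYoung A) {T : 𝓢'(E n, ℂ)} {f : ℕ → E n → ℂ}
    (hf : ∀ i, Represents (dyadicOp φ₀ i T) (f i)) {l : ℝ≥0} (hl : 0 < l)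
    (h : ∑' i : ℕ, ∫⁻ x, yext A ((2 : ℝ≥0∞) ^ ((i : ℝ) * s) * ‖f i x‖ₑ / l) ≤ 1) :
    FNorm φ₀ s A T ≤ l := by
  refine (iInf₂_le f hf).trans ?_
  refine (iInf₂_le l hl).trans (iInf_le _ ?_)
  simp only [hA.apply_rpow_mul_div _ _ hl.ne']
  exact h

/-- The factor `c^σ` is split as `(c t)^σ t^{-σ}`: the first part enters the kernel, the second the
difference quotient. At `t = 0` the difference `D` vanishes anyway. -/
theorem rpow_kernel_identity {σ : ℝ} (hσ : 0 < σ) {c b : ℝ≥0∞} {a S D t : ℝ≥0∞}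
    (hD : t = 0 → D = 0) (htt : t ≠ ⊤) (hb : b = c ^ σ) :
    b * (a * S * D) ≤ a * (S * (c * t) ^ σ) * (D / t ^ σ) := by
  rcases eq_or_ne t 0 with h | h
  · simp [hD h]
  have h0 : t ^ σ ≠ 0 := by simp [ENNReal.rpow_eq_zero_iff, h, htt]
  have h1 : t ^ σ ≠ ⊤ := by simp [ENNReal.rpow_eq_top_iff, h, htt]
  rw [ENNReal.mul_rpow_of_nonneg _ _ hσ.le, hb]
  calc c ^ σ * (a * S * D) = c ^ σ * (a * S * D) * (t ^ σ * (t ^ σ)⁻¹) := by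
        rw [ENNReal.mul_inv_cancel h0 h1, mul_one]
    _ = a * (S * (c ^ σ * t ^ σ)) * (D / t ^ σ) := by
        rw [div_eq_mul_inv]; ring
    _ ≤ _ := le_rfl

/-- The Littlewood-Paley norm is bounded by the fractional Orlicz-Sobolev norm. -/
theorem exists_FNorm_le (hn : 1 ≤ n) (hφ : IsGenerator φ₀) (m : ℕ) {σ : ℝ} (hσ0 : 0 < σ)
    (hσ1 : σ < 1) :
    ∃ C : ℝ≥0, 0 < C ∧ ∀ A : ℝ≥0 → ℝ≥0∞, IsYoung A → ∀ (u : E n → ℝ)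
      (v : E n → EuclideanSpace ℝ (Fin m → Fin n)), Measurable u → Measurable v →
      HasWeakGrad m u v → ∀ hu : TempInt (fun x => (u x : ℂ)), TempInt v → ∀ l : ℝ≥0, 0 < l →
      ∫⁻ x, yext A (‖u x‖ₑ / l) ≤ 1 →
      ∫⁻ x : E n, ∫⁻ h : E n, yext A (‖v x - v (x - h)‖ₑ / (l * ‖h‖ₑ ^ σ)) / ‖h‖ₑ ^ n ≤ 1 →
      FNorm φ₀ (m + σ) A hu.toDist ≤ C * l := by
  obtain ⟨ψ, hψ0, hψ⟩ := exists_factorization m hφ.symb₁ hφ.hasCompactSupport_symb₁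
    hφ.symb₁_eventually_zero
  obtain ⟨C0, hC0, hκ⟩ := exists_sum_enorm_le (fun I => (𝓕⁻ (ψ I) : 𝓢(E n, ℂ))) 2
  obtain ⟨K, hK, hKsum⟩ := exists_tsum_omega_le hσ0
  let κ0 : 𝓢(E n, ℂ) := 𝓕⁻ hφ.symb₀
  let S : E n → ℝ≥0∞ := fun z => ∑ I, ‖(𝓕⁻ (ψ I) : 𝓢(E n, ℂ)) z‖ₑ
  have hS : Measurable S := Finset.measurable_sum _ fun I _ =>
    (𝓕⁻ (ψ I) : 𝓢(E n, ℂ)).continuous.enorm.measurable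
  let Θ : E n → ℝ≥0∞ := fun z => S z * ‖z‖ₑ ^ σ
  have hΘ : Measurable Θ := by simp only [Θ]; fun_prop
  have hΘω : ∀ z, Θ z * ‖z‖ₑ ^ n ≤ C0 * omega σ ‖z‖ₑ := fun z => by
    calc S z * ‖z‖ₑ ^ σ * ‖z‖ₑ ^ n ≤ C0 * wt z ^ 2 * ‖z‖ₑ ^ σ * ‖z‖ₑ ^ n := by
          gcongr; exact hκ z
      _ = C0 * (wt z ^ 2 * ‖z‖ₑ ^ σ * ‖z‖ₑ ^ n) := by ring
      _ ≤ _ := by gcongr; exact wt_sq_mul_rpow_mul_pow_le hσ0 hσ1.le z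
  let M1 : ℝ≥0∞ := C0 * ∫⁻ z : E n, wt z
  have hM1 : M1 ≠ ⊤ := ENNReal.mul_ne_top hC0 lintegral_wt_lt_top.ne
  have hΘM : ∫⁻ z, Θ z ≤ M1 := by
    simp only [M1]
    rw [← lintegral_const_mul' _ _ hC0]
    refine lintegral_mono fun z => ?_
    calc S z * ‖z‖ₑ ^ σ ≤ C0 * wt z ^ 2 * ‖z‖ₑ ^ σ := by gcongr; exact hκ z
      _ = C0 * (wt z ^ 2 * ‖z‖ₑ ^ σ) := by ring
      _ ≤ _ := by gcongr; exact wt_sq_mul_rpow_le hσ0.le hσ1.le z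
  let M0 : ℝ≥0∞ := (∫⁻ z, ‖κ0 z‖ₑ) + 1
  have hM0 : M0 ≠ ⊤ := ENNReal.add_ne_top.2 ⟨κ0.integrable.2.ne, ENNReal.one_ne_top⟩
  have hM00 : M0 ≠ 0 := by simp [M0]
  -- `L` dominates the mass `M1` needed for Jensen, and it makes the high blocks contribute at most
  -- `1/2`. The low block contributes the other `1/2` through the factor `2` in front of `M0` in the
  -- final constant.
  let L : ℝ≥0∞ := M1 + 2 * (C0 * K) + 1
  have hL : L ≠ ⊤ := by simp only [L]; finiteness
  have hL0 : L ≠ 0 := by simp [L]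
  have hLK : L⁻¹ * (C0 * K) ≤ 2⁻¹ := by
    rw [mul_comm, ← div_eq_mul_inv]
    refine ENNReal.div_le_of_le_mul ?_
    calc C0 * K = 2⁻¹ * (2 * (C0 * K)) := by
          rw [← mul_assoc, ENNReal.inv_mul_cancel two_ne_zero ENNReal.ofNat_ne_top, one_mul]
      _ ≤ 2⁻¹ * L := by
          gcongr
          exact le_add_right le_add_self
  have hCt : 2 * M0 + L ≠ ⊤ := by finiteness
  refine ⟨(2 * M0 + L).toNNReal, ENNReal.toNNReal_pos (by simp [hL0]) hCt, ?_⟩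
  intro A hA u v hum hvm huv hu hv l hl hmu hmv
  rw [← ENNReal.coe_mul]
  have hlC : 0 < (2 * M0 + L).toNNReal * l :=
    mul_pos (ENNReal.toNNReal_pos (by simp [hL0]) hCt) hl
  have hl0 : (l : ℝ≥0∞) ≠ 0 := by exact_mod_cast hl.ne'
  have hvI : ∀ I, TempInt fun x => (v x I : ℂ) := fun I => by
    refine hv.mono ?_ fun x => ?_
    · have : Continuous fun y : EuclideanSpace ℝ (Fin m → Fin n) => (y I : ℂ) := by fun_prop
      exact this.comp_aestronglyMeasurable hv.1
    · rw [← ofReal_norm, Complex.norm_real, ← ofReal_norm]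
      exact ENNReal.ofReal_le_ofReal (PiLp.norm_apply_le (v x) I)
  let a : ℕ → ℂ := fun j => ((((2 : ℝ) ^ (j + 1))⁻¹ : ℝ) : ℂ) ^ m * (-1) ^ m
  have ha : ∀ j, ‖a j‖ₑ = ((2 : ℝ≥0∞) ^ (j + 1))⁻¹ ^ m := by
    intro j
    simp only [a]
    rw [enorm_mul, enorm_pow, enorm_pow, ← ofReal_norm ((((2 : ℝ) ^ (j + 1))⁻¹ : ℝ) : ℂ),
      Complex.norm_real, ofReal_norm, enorm_inv (by positivity), enorm_two_pow]
    simp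
  let f : ℕ → E n → ℂ := fun i => match i with
    | 0 => kconv (dil 1 one_ne_zero κ0) (fun x => (u x : ℂ))
    | j + 1 => fun y => ∑ I, (a j * kconv (dil ((2 : ℝ) ^ (j + 1)) (by positivity) (𝓕⁻ (ψ I)))
        (fun x => (v x I : ℂ)) y)
  have hf : ∀ i, Represents (dyadicOp φ₀ i hu.toDist) (f i) := by
    rintro (_ | j)
    · exact ⟨(hu.kconv _).locallyIntegrable, fun g _ => hφ.dyadicOp_zero_apply hu g⟩
    · refine ⟨?_, fun g _ => hφ.dyadicOp_succ_apply hψ huv hu hvI j g⟩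
      refine locallyIntegrable_finsetSum _ fun I _ => ?_
      exact ((hvI I).kconv _).locallyIntegrable.smul (a j)
  refine FNorm_le hA hf hlC ?_
  have hcoe : (((2 * M0 + L).toNNReal * l : ℝ≥0) : ℝ≥0∞) = (2 * M0 + L) * l := by
    rw [ENNReal.coe_mul, ENNReal.coe_toNNReal hCt]
  rw [hcoe, tsum_eq_zero_add' ENNReal.summable, ← ENNReal.inv_two_add_inv_two]
  gcongr ?_ + ?_
  · have hu' : Measurable fun x => ‖u x‖ₑ / (l : ℝ≥0∞) := by fun_prop
    have h1 := lintegral_yext_sconv_le (A := A) (c := 1) one_ne_zero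
      (W := fun z => ‖κ0 z‖ₑ) (F := fun x => ‖u x‖ₑ / l) κ0.continuous.enorm.measurable hu'
      hM00 hM0 le_self_add
    calc _ ≤ ∫⁻ x, 2⁻¹ * yext A (M0⁻¹ * sconv 1 (fun z => ‖κ0 z‖ₑ) (fun x => ‖u x‖ₑ / l) x) := by
          refine lintegral_mono fun x => ?_
          refine le_trans (yext_mono ?_) (yext_mul_le (by simp) _)
          rw [sconv_div hl0]
          have h2 := enorm_kconv_dil_le 1 one_ne_zero κ0 (fun x => (u x : ℂ)) x
          have h3 : ∀ y, ‖(u y : ℂ)‖ₑ = ‖u y‖ₑ := fun y => by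
            rw [← ofReal_norm, Complex.norm_real, ofReal_norm]
          simp only [h3] at h2
          have h4 : (2 : ℝ≥0∞) ^ (((0 : ℕ) : ℝ) * (m + σ)) = 1 := by simp
          rw [h4, one_mul]
          calc ‖f 0 x‖ₑ / ((2 * M0 + L) * l)
              ≤ sconv 1 (fun z => ‖κ0 z‖ₑ) (fun y => ‖u y‖ₑ) x / (2 * M0 * l) := by
                gcongr
                exact le_self_add
            _ = _ := by
                rw [div_eq_mul_inv, div_eq_mul_inv, ENNReal.mul_inv (by left; simp [hM00])
                  (by left; finiteness), ENNReal.mul_inv (by left; simp) (by left; simp)]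
                ring
      _ = 2⁻¹ * ∫⁻ x, yext A (M0⁻¹ * sconv 1 (fun z => ‖κ0 z‖ₑ) (fun x => ‖u x‖ₑ / l) x) :=
          lintegral_const_mul' _ _ (by simp)
      _ ≤ 2⁻¹ * 1 := by gcongr; exact h1.trans hmu
      _ = 2⁻¹ := mul_one _
  · let D : E n → E n → ℝ≥0∞ := fun x h => ‖v x - v (x - h)‖ₑ / (l * ‖h‖ₑ ^ σ)
    have hD : Measurable (Function.uncurry D) := by
      simp only [Function.uncurry_def, D]
      fun_prop
    have h1 := tsum_lintegral_yext_kernel_le (A := A) hn hΘ hD hΘω hΘM hKsum hL0 hL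
      (le_trans le_self_add le_self_add)
    have hpt : ∀ (j : ℕ) (x : E n),
        (2 : ℝ≥0∞) ^ (((j + 1 : ℕ) : ℝ) * (m + σ)) * ‖f (j + 1) x‖ₑ / ((2 * M0 + L) * l) ≤
        L⁻¹ * ∫⁻ z, ‖(2 : ℝ) ^ (j + 1)‖ₑ ^ n * Θ ((2 : ℝ) ^ (j + 1) • z) * D x z := by
      intro j x
      obtain ⟨c, hc⟩ : ∃ c : ℝ, c = 2 ^ (j + 1) := ⟨_, rfl⟩
      have hc0 : 0 < c := by rw [hc]; positivity
      have hce : ‖c‖ₑ = 2 ^ (j + 1) := by rw [hc, enorm_two_pow]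
      have h2 := enorm_sum_kconv_le hψ0 hvm hc0 (a j) x
      have h3 : ‖f (j + 1) x‖ₑ ≤ ‖a j‖ₑ * ∫⁻ z, ‖c‖ₑ ^ n * S (c • z) * ‖v x - v (x - z)‖ₑ := by
        subst hc
        exact h2
      rw [← hc]
      -- The `m` derivatives use up the integer part of `s`; only the scale to the power `σ`
      -- remains.
      have h4 : (2 : ℝ≥0∞) ^ (((j + 1 : ℕ) : ℝ) * (m + σ)) * ‖a j‖ₑ = ‖c‖ₑ ^ σ := by
        rw [ha, hce, mul_add, ENNReal.rpow_add _ _ two_ne_zero ENNReal.ofNat_ne_top,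
          ENNReal.rpow_mul, ENNReal.rpow_mul, ENNReal.rpow_natCast, ENNReal.rpow_natCast,
          mul_right_comm, ← mul_pow, ENNReal.mul_inv_cancel (by simp) (by simp), one_pow, one_mul]
      have h5 : ∀ z, ‖c‖ₑ ^ σ * (‖c‖ₑ ^ n * S (c • z) * ‖v x - v (x - z)‖ₑ) ≤
          l * (‖c‖ₑ ^ n * Θ (c • z) * D x z) := by
        intro z
        refine (rpow_kernel_identity hσ0 (c := ‖c‖ₑ) (t := ‖z‖ₑ) ?_ (by simp) rfl).trans
          (le_of_eq ?_)
        · intro h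
          have : z = 0 := by simpa using h
          simp [this]
        · simp only [Θ, D, enorm_smul]
          rw [div_eq_mul_inv, div_eq_mul_inv, ENNReal.mul_inv (by left; exact hl0) (by left; simp)]
          calc _ = ‖c‖ₑ ^ n * (S (c • z) * (‖c‖ₑ * ‖z‖ₑ) ^ σ) *
                (‖v x - v (x - z)‖ₑ * (‖z‖ₑ ^ σ)⁻¹) * ((l : ℝ≥0∞) * (l : ℝ≥0∞)⁻¹) := by
                rw [ENNReal.mul_inv_cancel hl0 ENNReal.coe_ne_top, mul_one]
            _ = _ := by ring
      calc _ ≤ (2 : ℝ≥0∞) ^ (((j + 1 : ℕ) : ℝ) * (m + σ)) *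
            (‖a j‖ₑ * ∫⁻ z, ‖c‖ₑ ^ n * S (c • z) * ‖v x - v (x - z)‖ₑ) / (L * l) := by
            gcongr
            exact le_add_self
        _ = (∫⁻ z, ‖c‖ₑ ^ σ * (‖c‖ₑ ^ n * S (c • z) * ‖v x - v (x - z)‖ₑ)) / (L * l) := by
            rw [← mul_assoc, h4, lintegral_const_mul']
            exact ENNReal.rpow_ne_top_of_nonneg hσ0.le (by simp)
        _ ≤ (∫⁻ z, l * (‖c‖ₑ ^ n * Θ (c • z) * D x z)) / (L * l) := by
            exact ENNReal.div_le_div_right (lintegral_mono h5) _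
        _ = _ := by
            rw [lintegral_const_mul' _ _ ENNReal.coe_ne_top, div_eq_mul_inv,
              ENNReal.mul_inv (by left; exact hL0) (by left; exact hL)]
            calc _ = L⁻¹ * (∫⁻ z, ‖c‖ₑ ^ n * Θ (c • z) * D x z) *
                  ((l : ℝ≥0∞) * (l : ℝ≥0∞)⁻¹) := by ring
              _ = _ := by rw [ENNReal.mul_inv_cancel hl0 ENNReal.coe_ne_top, mul_one]
    calc _ ≤ ∑' j : ℕ, ∫⁻ x : E n, yext A (L⁻¹ *
          ∫⁻ z, ‖(2 : ℝ) ^ (j + 1)‖ₑ ^ n * Θ ((2 : ℝ) ^ (j + 1) • z) * D x z) :=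
          ENNReal.tsum_le_tsum fun j => lintegral_mono fun x => yext_mono (hpt j x)
      _ ≤ ∑' i : ℕ, ∫⁻ x : E n, yext A (L⁻¹ *
          ∫⁻ z, ‖(2 : ℝ) ^ i‖ₑ ^ n * Θ ((2 : ℝ) ^ i • z) * D x z) :=
          ENNReal.tsum_comp_le_tsum_of_injective (add_left_injective 1)
            (fun i : ℕ => ∫⁻ x : E n, yext A (L⁻¹ *
              ∫⁻ z, ‖(2 : ℝ) ^ i‖ₑ ^ n * Θ ((2 : ℝ) ^ i • z) * D x z))
      _ ≤ L⁻¹ * (C0 * K) * 1 := h1.trans (by gcongr)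
      _ ≤ 2⁻¹ := by rw [mul_one]; exact hLK

end UpperBound

end FracOrlicz

namespace FracOrlicz

/-! ### Summing tempered series -/

section Sums

variable {n : ℕ}

/-- By linear growth, `F` is at most `(k/a)(A(F/k) + b)`; the first term is integrable, and the
constant becomes integrable once the weight is applied. -/
theorem IsYoung.lintegral_mul_wt_lt_top {A : ℝ≥0 → ℝ≥0∞} (hA : IsYoung A) {F : E n → ℝ≥0∞}
    {k : ℝ≥0∞} (hk0 : k ≠ 0) (hk : k ≠ ⊤) (h : ∫⁻ x, yext A (F x / k) ≤ 1) :
    ∫⁻ x, F x * wt x < ⊤ := by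
  obtain ⟨a, b, ha, hab⟩ := hA.exists_growth
  have ha0 : (a : ℝ≥0∞) ≠ 0 := by exact_mod_cast ha.ne'
  have hc : k * (a : ℝ≥0∞)⁻¹ ≠ ⊤ := ENNReal.mul_ne_top hk (ENNReal.inv_ne_top.2 ha0)
  calc ∫⁻ x, F x * wt x ≤ ∫⁻ x, k * (a : ℝ≥0∞)⁻¹ * (yext A (F x / k) + b * wt x) := by
        refine lintegral_mono fun x => ?_
        calc F x * wt x = k * (a : ℝ≥0∞)⁻¹ * (a * (F x / k)) * wt x := by
              rw [div_eq_mul_inv]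
              calc F x * wt x = (k * k⁻¹) * ((a : ℝ≥0∞)⁻¹ * a) * F x * wt x := by
                    rw [ENNReal.mul_inv_cancel hk0 hk, ENNReal.inv_mul_cancel ha0 ENNReal.coe_ne_top,
                      one_mul, one_mul]
                _ = _ := by ring
          _ ≤ k * (a : ℝ≥0∞)⁻¹ * (yext A (F x / k) + b) * wt x := by gcongr; exact hab _
          _ = k * (a : ℝ≥0∞)⁻¹ * (yext A (F x / k) * wt x + b * wt x) := by ring
          _ ≤ _ := by
            gcongr
            exact mul_le_of_le_one_right' (wt_le_one x)
    _ = k * (a : ℝ≥0∞)⁻¹ * ((∫⁻ x, yext A (F x / k)) + b * ∫⁻ x : E n, wt x) := by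
        rw [lintegral_const_mul' _ _ hc, lintegral_add_right _ (by fun_prop),
          lintegral_const_mul _ (by fun_prop)]
    _ < ⊤ := by
        refine ENNReal.mul_lt_top hc.lt_top (ENNReal.add_lt_top.2 ⟨?_, ?_⟩)
        · exact h.trans_lt ENNReal.one_lt_top
        · exact ENNReal.mul_lt_top ENNReal.coe_lt_top lintegral_wt_lt_top

theorem ae_summable_of_lintegral {f : ℕ → E n → ℂ} (hf : ∀ i, AEStronglyMeasurable (f i) volume)
    (h : ∫⁻ x, (∑' i, ‖f i x‖ₑ) * wt x < ⊤) : ∀ᵐ x, Summable fun i => f i x := by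
  have hm : AEMeasurable (fun x => (∑' i, ‖f i x‖ₑ) * wt x) volume :=
    (AEMeasurable.tsum fun i => (hf i).enorm).mul measurable_wt.aemeasurable
  filter_upwards [ae_lt_top' hm h.ne] with x hx
  have h1 : ∑' i, ‖f i x‖ₑ ≠ ⊤ := fun h => by
    rw [h, ENNReal.top_mul (wt_ne_zero x)] at hx
    exact lt_irrefl _ hx
  have h2 := ENNReal.summable_toReal h1
  simp only [toReal_enorm] at h2
  exact h2.of_norm

theorem tempInt_tsum {f : ℕ → E n → ℂ} (hf : ∀ i, AEStronglyMeasurable (f i) volume)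
    (h : ∫⁻ x, (∑' i, ‖f i x‖ₑ) * wt x < ⊤) : TempInt fun x => ∑' i, f i x := by
  refine ⟨?_, lt_of_le_of_lt (lintegral_mono fun x => ?_) h⟩
  · refine aestronglyMeasurable_of_tendsto_ae Filter.atTop
      (f := fun N x => ∑ i ∈ Finset.range N, f i x) (fun N => ?_) ?_
    · exact Finset.aestronglyMeasurable_fun_sum _ fun i _ => hf i
    · filter_upwards [ae_summable_of_lintegral hf h] with x hx
      exact hx.hasSum.tendsto_sum_nat
  · gcongr
    exact enorm_tsum_le_tsum_enorm

theorem hasSum_integral_mul {f : ℕ → E n → ℂ} (hf : ∀ i, AEStronglyMeasurable (f i) volume)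
    (h : ∫⁻ x, (∑' i, ‖f i x‖ₑ) * wt x < ⊤) (g : 𝓢(E n, ℂ)) :
    HasSum (fun i => ∫ x, g x * f i x) (∫ x, g x * ∑' i, f i x) := by
  have hfi : ∀ i, TempInt (f i) := fun i => ⟨hf i, lt_of_le_of_lt
    (lintegral_mono fun x => by gcongr; exact ENNReal.le_tsum (f := fun i => ‖f i x‖ₑ) i) h⟩
  obtain ⟨C, hC, hg⟩ := exists_schwartz_enorm_le g 1
  have hsum : ∑' i, ∫⁻ x, ‖g x * f i x‖ₑ ≠ ⊤ := by
    have hm : ∀ i, AEMeasurable (fun x => ‖g x * f i x‖ₑ) volume := fun i =>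
      (g.continuous.aestronglyMeasurable.mul (hf i)).enorm
    rw [← lintegral_tsum hm]
    refine ne_top_of_le_ne_top (ENNReal.mul_ne_top hC h.ne) ?_
    rw [← lintegral_const_mul' _ _ hC]
    refine lintegral_mono fun x => ?_
    simp only [enorm_mul]
    rw [ENNReal.tsum_mul_left]
    calc _ ≤ C * wt x ^ 1 * ∑' i, ‖f i x‖ₑ := by gcongr; exact hg x
      _ = _ := by ring
  have h1 := hasSum_integral_of_summable_integral_norm (fun i => (hfi i).integrable_mul g) (by
    have := ENNReal.summable_toReal hsum
    refine this.congr fun i => ?_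
    exact (integral_norm_eq_lintegral_enorm ((hfi i).integrable_mul g).1).symm)
  simpa only [tsum_mul_left] using h1

end Sums

/-! ### Size and smoothness bounds for convolutions -/

section Differences

variable {n : ℕ}

theorem TempInt.integrable_kernel {f : E n → ℂ} (hf : TempInt f) (κ : 𝓢(E n, ℂ)) (x : E n) :
    Integrable fun y => κ (x - y) * f y := by
  obtain ⟨C, hC, hκ⟩ := exists_schwartz_enorm_le κ 1
  refine ⟨(κ.continuous.comp (continuous_const.sub continuous_id)).aestronglyMeasurable.mul hf.1, ?_⟩
  have hc : C * (wt x)⁻¹ ≠ ⊤ := ENNReal.mul_ne_top hC (ENNReal.inv_ne_top.2 (wt_ne_zero x))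
  refine lt_of_le_of_lt (lintegral_mono (g := fun y => C * (wt x)⁻¹ * (‖f y‖ₑ * wt y)) fun y => ?_) ?_
  · have h1 : wt (x - y) ≤ (wt x)⁻¹ * wt y := by
      have h2 := wt_mul_wt_le (x - y) (-x)
      rw [sub_add_eq_add_sub, add_neg_cancel, zero_sub, wt_neg, wt_neg] at h2
      calc wt (x - y) = (wt x)⁻¹ * (wt (x - y) * wt x) := by
            rw [mul_comm (wt (x - y)), ← mul_assoc,
              ENNReal.inv_mul_cancel (wt_ne_zero x) (wt_ne_top x), one_mul]
        _ ≤ _ := by gcongr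
    simp only [enorm_mul]
    calc _ ≤ C * wt (x - y) ^ 1 * ‖f y‖ₑ := by gcongr; exact hκ _
      _ ≤ C * ((wt x)⁻¹ * wt y) * ‖f y‖ₑ := by rw [pow_one]; gcongr
      _ = _ := by ring
  · rw [lintegral_const_mul' _ _ hc]
    exact ENNReal.mul_lt_top hc.lt_top hf.2

theorem exists_fderiv_enorm_le (κ : 𝓢(E n, ℂ)) :
    ∃ C : ℝ≥0∞, C ≠ ⊤ ∧ ∀ x, ‖fderiv ℝ κ x‖ₑ ≤ C * wt x := by
  let B : ℝ := 2 ^ (n + 1) * (Finset.Iic (n + 1, 1)).sup (fun m => SchwartzMap.seminorm ℂ m.1 m.2) κ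
  refine ⟨ENNReal.ofReal B, ENNReal.ofReal_ne_top, fun x => ?_⟩
  have h := SchwartzMap.one_add_le_sup_seminorm_apply (𝕜 := ℂ) (m := (n + 1, 1))
    le_rfl le_rfl κ x
  rw [norm_iteratedFDeriv_one] at h
  have h2 := ENNReal.ofReal_le_ofReal h
  rw [ENNReal.ofReal_mul (by positivity), ENNReal.ofReal_pow (by positivity),
    ENNReal.ofReal_add zero_le_one (norm_nonneg x), ENNReal.ofReal_one, ofReal_norm,
    ofReal_norm] at h2
  rw [wt, ← div_eq_mul_inv,
    ENNReal.le_div_iff_mul_le (by left; positivity) (by left; finiteness), mul_comm]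
  exact h2

theorem wt_sub_le {z y : E n} (hy : ‖y‖ ≤ 1) : wt (z - y) ≤ 2 ^ (n + 1) * wt z := by
  have h := wt_mul_wt_le (z - y) y
  rw [sub_add_cancel] at h
  have h1 : (wt y)⁻¹ ≤ 2 ^ (n + 1) := by
    rw [wt, inv_inv]
    gcongr
    have : ‖y‖ₑ ≤ 1 := by
      rw [← ofReal_norm]
      exact ENNReal.ofReal_le_one.2 hy
    calc 1 + ‖y‖ₑ ≤ 1 + 1 := by gcongr
      _ = 2 := one_add_one_eq_two
  calc wt (z - y) = (wt y)⁻¹ * (wt (z - y) * wt y) := by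
        rw [mul_comm (wt (z - y)), ← mul_assoc,
          ENNReal.inv_mul_cancel (wt_ne_zero y) (wt_ne_top y), one_mul]
    _ ≤ _ := by gcongr

/-- For `|h| ≤ 1` this is the mean value inequality, the weight being comparable along the segment
from `z - h` to `z`. For `|h| ≥ 1` it is the triangle inequality, which is why the weight at both
endpoints appears. -/
theorem exists_enorm_sub_le (κ : 𝓢(E n, ℂ)) :
    ∃ C : ℝ≥0∞, C ≠ ⊤ ∧ ∀ z h, ‖κ z - κ (z - h)‖ₑ ≤ C * (min 1 ‖h‖ₑ * (wt z + wt (z - h))) := by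
  obtain ⟨C0, hC0, h0⟩ := exists_schwartz_enorm_le κ 1
  obtain ⟨C1, hC1, h1⟩ := exists_fderiv_enorm_le κ
  simp only [pow_one] at h0
  refine ⟨C0 + C1 * 2 ^ (n + 1), by finiteness, fun z h => ?_⟩
  rcases le_total ‖h‖ 1 with hh | hh
  · have he : ‖h‖ₑ ≤ 1 := by
      rw [← ofReal_norm]
      exact ENNReal.ofReal_le_one.2 hh
    have hb : C1 * (2 ^ (n + 1) * wt z) ≠ ⊤ := by have := wt_ne_top z; finiteness
    have hbound : ∀ x ∈ segment ℝ (z - h) z,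
        ‖fderiv ℝ κ x‖ ≤ (C1 * (2 ^ (n + 1) * wt z)).toReal := by
      intro x hx
      rw [segment_symm, segment_eq_image'] at hx
      obtain ⟨t, ht, rfl⟩ := hx
      rw [← toReal_enorm]
      refine ENNReal.toReal_mono hb ((h1 _).trans ?_)
      gcongr
      have e : z + t • (z - h - z) = z - t • h := by
        rw [sub_sub_cancel_left, smul_neg, sub_eq_add_neg]
      change wt (z + t • (z - h - z)) ≤ _
      rw [e]
      refine wt_sub_le ?_
      rw [norm_smul, Real.norm_of_nonneg ht.1]
      exact mul_le_one₀ ht.2 (norm_nonneg h) hh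
    have hmv := (convex_segment (z - h) z).norm_image_sub_le_of_norm_fderiv_le
      (fun x _ => κ.differentiableAt) hbound (left_mem_segment ℝ _ _) (right_mem_segment ℝ _ _)
    rw [sub_sub_cancel] at hmv
    have h2 := ENNReal.ofReal_le_ofReal hmv
    rw [ENNReal.ofReal_mul ENNReal.toReal_nonneg, ENNReal.ofReal_toReal hb, ofReal_norm,
      ofReal_norm] at h2
    rw [min_eq_right he]
    calc _ ≤ _ := h2
      _ = C1 * 2 ^ (n + 1) * (‖h‖ₑ * wt z) := by ring
      _ ≤ _ := by
        gcongr
        · exact le_add_self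
        · exact le_self_add
  · have he : 1 ≤ ‖h‖ₑ := by
      rw [← ofReal_norm]
      exact ENNReal.one_le_ofReal.2 hh
    rw [min_eq_left he, one_mul]
    calc _ ≤ ‖κ z‖ₑ + ‖κ (z - h)‖ₑ := enorm_sub_le
      _ ≤ C0 * wt z + C0 * wt (z - h) := add_le_add (h0 z) (h0 _)
      _ = C0 * (wt z + wt (z - h)) := by ring
      _ ≤ _ := by gcongr; exact le_self_add

theorem sconv_mono {c : ℝ} {W W' F : E n → ℝ≥0∞} (h : ∀ z, W z ≤ W' z) (x : E n) :
    sconv c W F x ≤ sconv c W' F x := by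
  unfold sconv
  gcongr with z
  exact h _

theorem sconv_const_mul {c : ℝ} {W F : E n → ℝ≥0∞} {C : ℝ≥0∞} (hC : C ≠ ⊤) (x : E n) :
    sconv c (fun z => C * W z) F x = C * sconv c W F x := by
  unfold sconv
  rw [← lintegral_const_mul' _ _ hC]
  refine lintegral_congr fun z => ?_
  ring

theorem sconv_eq_sub (c : ℝ) (W F : E n → ℝ≥0∞) (x : E n) :
    sconv c W F x = ∫⁻ y, ‖c‖ₑ ^ n * W (c • (x - y)) * F y := by
  rw [sconv, ← lintegral_sub_left_eq_self _ x]
  simp only [sub_sub_cancel]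

theorem exists_kconv_bounds {ι : Type*} [Fintype ι] (κ : ι → 𝓢(E n, ℂ)) :
    ∃ C : ℝ≥0∞, C ≠ ⊤ ∧ ∀ (c : ℝ) (hc : c ≠ 0) (f : E n → ℂ), TempInt f →
      (∀ x, ∑ I, ‖kconv (dil c hc (κ I)) f x‖ₑ ≤ C * sconv c wt (fun y => ‖f y‖ₑ) x) ∧
      (∀ x h, ∑ I, ‖kconv (dil c hc (κ I)) f x - kconv (dil c hc (κ I)) f (x - h)‖ₑ ≤
        C * (min 1 (‖c‖ₑ * ‖h‖ₑ) *
          (sconv c wt (fun y => ‖f y‖ₑ) x + sconv c wt (fun y => ‖f y‖ₑ) (x - h)))) := by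
  choose C0 hC0 h0 using fun I => exists_schwartz_enorm_le (κ I) 1
  choose C1 hC1 h1 using fun I => exists_enorm_sub_le (κ I)
  have hs0 : ∑ I, C0 I ≠ ⊤ := by simpa using hC0
  have hs1 : ∑ I, C1 I ≠ ⊤ := by simpa using hC1
  refine ⟨∑ I, C0 I + ∑ I, C1 I, by finiteness, fun c hc f hf => ⟨fun x => ?_, fun x h => ?_⟩⟩
  · calc _ ≤ ∑ I, C0 I * sconv c wt (fun y => ‖f y‖ₑ) x := by
          refine Finset.sum_le_sum fun I _ => (enorm_kconv_dil_le c hc (κ I) f x).trans ?_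
          rw [← sconv_const_mul (hC0 I)]
          refine sconv_mono (fun z => ?_) x
          simpa using h0 I z
      _ = (∑ I, C0 I) * sconv c wt (fun y => ‖f y‖ₑ) x := by rw [Finset.sum_mul]
      _ ≤ _ := by gcongr; exact le_self_add
  · have key : ∀ I, ‖kconv (dil c hc (κ I)) f x - kconv (dil c hc (κ I)) f (x - h)‖ₑ ≤
        C1 I * (min 1 (‖c‖ₑ * ‖h‖ₑ) *
          (sconv c wt (fun y => ‖f y‖ₑ) x + sconv c wt (fun y => ‖f y‖ₑ) (x - h))) := by
      intro I
      rw [kconv, kconv, ← integral_sub (hf.integrable_kernel _ _) (hf.integrable_kernel _ _)]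
      refine (enorm_integral_le_lintegral_enorm _).trans ?_
      have hfm := hf.1.enorm
      have hm1 : AEMeasurable (fun y => ‖c‖ₑ ^ n * wt (c • (x - y)) * ‖f y‖ₑ) volume := by fun_prop
      rw [sconv_eq_sub, sconv_eq_sub, ← lintegral_add_left' hm1, ← lintegral_const_mul',
        ← lintegral_const_mul' _ _ (hC1 I)]
      · refine lintegral_mono fun y => ?_
        have h2 := h1 I (c • (x - y)) (c • h)
        have e : c • (x - y) - c • h = c • (x - h - y) := by
          rw [← smul_sub]
          congr 1
          abel
        rw [e, enorm_smul] at h2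
        simp only
        rw [← sub_mul, enorm_mul, dil_apply, dil_apply, ← mul_sub, enorm_mul, enorm_pow]
        have e2 : ‖(c : ℂ)‖ₑ = ‖c‖ₑ := by rw [← ofReal_norm, Complex.norm_real, ofReal_norm]
        rw [e2]
        calc _ ≤ ‖c‖ₑ ^ n * (C1 I * (min 1 (‖c‖ₑ * ‖h‖ₑ) *
              (wt (c • (x - y)) + wt (c • (x - h - y))))) * ‖f y‖ₑ := by gcongr
          _ = _ := by ring
      · exact ne_top_of_le_ne_top ENNReal.one_ne_top (min_le_left _ _)
    calc _ ≤ ∑ I, C1 I * (min 1 (‖c‖ₑ * ‖h‖ₑ) *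
          (sconv c wt (fun y => ‖f y‖ₑ) x + sconv c wt (fun y => ‖f y‖ₑ) (x - h))) :=
          Finset.sum_le_sum fun I _ => key I
      _ = (∑ I, C1 I) * _ := by rw [Finset.sum_mul]
      _ ≤ _ := by gcongr; exact le_add_self

end Differences

end FracOrlicz

namespace FracOrlicz

/-! ### Reproducing kernels of the blocks and the Littlewood-Paley decomposition -/

section Reproducing

variable {n : ℕ} {φ₀ : E n → ℝ}

open FourierTransform LineDeriv

/-- The symbol `φ₀(π ξ)`, which equals `1` on the supports of `symb₀` and `symb₁`. -/
def IsGenerator.wide (h : IsGenerator φ₀) : 𝓢(E n, ℂ) := scale 2⁻¹ (by norm_num) h.symb₀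

theorem IsGenerator.wide_eq_one (h : IsGenerator φ₀) {ξ : E n}
    (hξ : ‖(2 * Real.pi) • ξ‖ < 2) : h.wide ξ = 1 := by
  have h1 : h.wide ξ = h.symb₀ ((2⁻¹ : ℝ) • ξ) := rfl
  rw [h1, h.symb₀_apply, smul_comm, h.eq_one, Complex.ofReal_one]
  rw [mem_ball_zero_iff, norm_smul, Real.norm_of_nonneg (by norm_num)]
  linarith

theorem IsGenerator.norm_lt_of_symb₀_ne_zero (h : IsGenerator φ₀) {ξ : E n} (hξ : h.symb₀ ξ ≠ 0) :
    ‖(2 * Real.pi) • ξ‖ < 2 := by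
  rw [h.symb₀_apply] at hξ
  have h1 : φ₀ ((2 * Real.pi) • ξ) ≠ 0 := fun h0 => hξ (by rw [h0, Complex.ofReal_zero])
  simpa using h.supp (subset_tsupport _ h1)

theorem IsGenerator.symb₀_mul_wide (h : IsGenerator φ₀) (ξ : E n) :
    h.symb₀ ξ * h.wide ξ = h.symb₀ ξ := by
  rcases eq_or_ne (h.symb₀ ξ) 0 with h0 | h0
  · rw [h0, zero_mul]
  · rw [h.wide_eq_one (h.norm_lt_of_symb₀_ne_zero h0), mul_one]

theorem IsGenerator.symb₁_mul_wide (h : IsGenerator φ₀) (ξ : E n) :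
    h.symb₁ ξ * h.wide ξ = h.symb₁ ξ := by
  have h1 : h.symb₀ ((2 : ℝ) • ξ) * h.wide ξ = h.symb₀ ((2 : ℝ) • ξ) := by
    rcases eq_or_ne (h.symb₀ ((2 : ℝ) • ξ)) 0 with h0 | h0
    · rw [h0, zero_mul]
    · have h2 := h.norm_lt_of_symb₀_ne_zero h0
      rw [smul_comm, norm_smul, Real.norm_of_nonneg zero_le_two] at h2
      rw [h.wide_eq_one (by linarith [norm_nonneg ((2 * Real.pi) • ξ)]), mul_one]
  rw [h.symb₁_apply, sub_mul, h.symb₀_mul_wide, h1]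

theorem IsGenerator.dyadic_mul_wide (h : IsGenerator φ₀) (i : ℕ) (ξ : E n) :
    ((dyadic φ₀ i ((2 * Real.pi) • ξ) : ℝ) : ℂ) * h.wide (((2 : ℝ) ^ i)⁻¹ • ξ) =
      ((dyadic φ₀ i ((2 * Real.pi) • ξ) : ℝ) : ℂ) := by
  rcases i with _ | j
  · rw [h.dyadic_zero, pow_zero, inv_one, one_smul, h.symb₀_mul_wide]
  · rw [h.dyadic_succ, h.symb₁_mul_wide]

theorem IsGenerator.dyadic_hasTemperateGrowth (h : IsGenerator φ₀) (i : ℕ) :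
    (fun ξ => ((dyadic φ₀ i ((2 * Real.pi) • ξ) : ℝ) : ℂ)).HasTemperateGrowth := by
  rcases i with _ | j
  · exact h.symb₀.hasTemperateGrowth
  · simp only [h.dyadic_succ]
    exact hasTemperateGrowth_comp_smul _ _

/-- The reproducing formula: the wide symbol is `1` wherever the dyadic one is nonzero. Derivatives
of a block can thus be put on a smooth kernel. -/
theorem IsGenerator.dyadicOp_multOp_wide (h : IsGenerator φ₀) (i : ℕ) (T : 𝓢'(E n, ℂ))
    (g : 𝓢(E n, ℂ)) :
    dyadicOp φ₀ i T (multOp (fun ξ => h.wide (((2 : ℝ) ^ i)⁻¹ • ξ)) g) = dyadicOp φ₀ i T g := by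
  rw [dyadicOp_apply, dyadicOp_apply, multOp_multOp (h.dyadic_hasTemperateGrowth i)
    (hasTemperateGrowth_comp_smul _ _)]
  simp only [h.dyadic_mul_wide]

/-- The kernels with which the derivatives of `φᵢ(D)u` are obtained from `φᵢ(D)u`. -/
def IsGenerator.derivKernel (h : IsGenerator φ₀) {k : ℕ} (I : Fin k → Fin n) : 𝓢(E n, ℂ) :=
  𝓕⁻ (SchwartzMap.smulLeftCLM ℂ (symb (dirs I)) h.wide)

/-- The weak derivatives of `f` when `f` is reproduced by `wide (2⁻ⁱ ·)`. -/
def IsGenerator.blockDeriv (h : IsGenerator φ₀) (i : ℕ) (f : E n → ℂ) {k : ℕ}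
    (I : Fin k → Fin n) (x : E n) : ℂ :=
  (-1) ^ k * (((2 : ℝ) ^ i : ℝ) : ℂ) ^ k *
    kconv (dil ((2 : ℝ) ^ i) (by positivity) (h.derivKernel I)) f x

/-- After inserting the wide symbol, the derivative becomes multiplication by `symb`; homogeneity
rewrites it at scale `2^i` at the cost of `2^{ik}`. -/
theorem IsGenerator.integral_deriv_mul (h : IsGenerator φ₀) {i : ℕ} {T : 𝓢'(E n, ℂ)} {f : E n → ℂ}
    (hf : TempInt f) (hT : ∀ g, dyadicOp φ₀ i T g = ∫ x, g x * f x) {k : ℕ} (I : Fin k → Fin n)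
    (g : 𝓢(E n, ℂ)) :
    ∫ x, (∂^{dirs I} g : 𝓢(E n, ℂ)) x * f x = (-1) ^ k * ∫ x, g x * h.blockDeriv i f I x := by
  rw [← hT, ← h.dyadicOp_multOp_wide, hT, multOp_iteratedLineDerivOp _
    (hasTemperateGrowth_comp_smul _ _)]
  obtain ⟨c, hc⟩ : ∃ c : ℝ, c = 2 ^ i := ⟨_, rfl⟩
  have hc0 : 0 < c := by rw [hc]; positivity
  have e : (fun ξ => h.wide (((2 : ℝ) ^ i)⁻¹ • ξ) * symb (dirs I) ξ) =
      fun ξ => (c : ℂ) ^ k *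
        (SchwartzMap.smulLeftCLM ℂ (symb (dirs I)) h.wide : 𝓢(E n, ℂ)) (c⁻¹ • ξ) := by
    ext ξ
    rw [SchwartzMap.smulLeftCLM_apply_apply (symb_hasTemperateGrowth _), symb_smul, ← hc, smul_eq_mul,
      Complex.ofReal_inv, ← mul_assoc, ← mul_assoc, inv_pow, mul_inv_cancel₀, one_mul, mul_comm]
    exact pow_ne_zero _ (Complex.ofReal_ne_zero.2 hc0.ne')
  rw [e, multOp_const_mul _ (hasTemperateGrowth_comp_smul _ _)]
  have h1 := hf.toDist_multOp (SchwartzMap.smulLeftCLM ℂ (symb (dirs I)) h.wide) g hc0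
  rw [hf.toDist_apply] at h1
  simp only [smul_apply, smul_eq_mul, mul_assoc]
  rw [integral_const_mul, h1]
  simp only [IsGenerator.blockDeriv]
  rw [← integral_const_mul, ← integral_const_mul]
  subst hc
  refine integral_congr_ae (.of_forall fun x => ?_)
  simp only
  have e1 : ((-1 : ℂ)) ^ k * (-1) ^ k = 1 := by rw [← mul_pow]; simp
  rw [IsGenerator.derivKernel]
  linear_combination (-((((2 : ℝ) ^ i : ℝ) : ℂ) ^ k * (g x * kconv (dil ((2 : ℝ) ^ i) hc0.ne'
    (𝓕⁻ (SchwartzMap.smulLeftCLM ℂ (symb (dirs I)) h.wide))) f x))) * e1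

theorem IsGenerator.sum_dyadic (h : IsGenerator φ₀) (N : ℕ) (ξ : E n) :
    ∑ i ∈ Finset.range (N + 1), ((dyadic φ₀ i ((2 * Real.pi) • ξ) : ℝ) : ℂ) =
      h.toSchwartz ((2 * Real.pi * ((2 : ℝ) ^ N)⁻¹) • ξ) := by
  induction N with
  | zero => simp [dyadic, h.toSchwartz_apply]
  | succ N ih =>
    rw [Finset.sum_range_succ, ih, dyadic, Complex.ofReal_sub, h.toSchwartz_apply,
      h.toSchwartz_apply, smul_smul, smul_smul, mul_comm (2 * Real.pi), mul_comm (2 * Real.pi)]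
    ring

/-- The partial sums telescope to one dilated cut-off on the Fourier side, which tends to the
identity. Summability is assumed so that a subsequence of the partial sums identifies the sum. -/
theorem IsGenerator.hasSum_of_summable (h : IsGenerator φ₀) {T : 𝓢'(E n, ℂ)} {g : 𝓢(E n, ℂ)}
    (hs : Summable fun i => dyadicOp φ₀ i T g) : HasSum (fun i => dyadicOp φ₀ i T g) (T g) := by
  have h1 := hs.hasSum
  suffices hTg : ∑' i, dyadicOp φ₀ i T g = T g by rwa [hTg] at h1
  -- The cut-off lemma wants dilation factors at most `1`. Since `2π ≤ 2^3`, this holds once the sum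
  -- has at least four terms.
  have h2 := (Filter.tendsto_add_atTop_iff_nat 4).2 h1.tendsto_sum_nat
  refine tendsto_nhds_unique h2 ?_
  have hc : Filter.Tendsto (fun N : ℕ => 2 * Real.pi * ((2 : ℝ) ^ (N + 3))⁻¹) Filter.atTop
      (nhds 0) := by
    have := ((Filter.tendsto_add_atTop_iff_nat 3).2 tendsto_two_pow_inv).const_mul (2 * Real.pi)
    simpa using this
  have ht := tendsto_smulLeftCLM_cutoff h.toSchwartz h.toSchwartz_eq_one
    (c := fun N => 2 * Real.pi * ((2 : ℝ) ^ (N + 3))⁻¹) (fun N => by positivity) (fun N => by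
      rw [← div_eq_mul_inv, div_le_one (by positivity)]
      have h8 : (2 : ℝ) ^ 3 ≤ 2 ^ (N + 3) := pow_le_pow_right₀ one_le_two (by omega)
      linarith [Real.pi_lt_four]) hc (𝓕⁻ g)
  have hcont : Continuous fun g : 𝓢(E n, ℂ) => T (𝓕 g) :=
    (map_continuous T).comp (FourierTransform.fourierCLM ℂ 𝓢(E n, ℂ)).continuous
  have h3 := (hcont.tendsto (𝓕⁻ g)).comp ht
  rw [FourierTransform.fourier_fourierInv_eq] at h3
  refine h3.congr fun N => ?_
  have e : (fun ξ => h.toSchwartz ((2 * Real.pi * ((2 : ℝ) ^ (N + 3))⁻¹) • ξ)) =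
      fun ξ => ∑ i ∈ Finset.range (N + 4), ((dyadic φ₀ i ((2 * Real.pi) • ξ) : ℝ) : ℂ) := by
    ext ξ
    rw [h.sum_dyadic]
  simp only [Function.comp_def]
  rw [e]
  change T (multOp _ g) = _
  rw [multOp_sum _ fun i _ => h.dyadic_hasTemperateGrowth i, map_sum]
  rfl

end Reproducing

/-! ### Real distributions and uniqueness of representing functions -/

section RealDistributions

variable {n : ℕ}

theorem IsRealDistribution.im_eq_zero {T : 𝓢'(E n, ℂ)} (hT : IsRealDistribution T) {U : E n → ℂ}
    (hU : TempInt U) (hTU : ∀ g, T g = ∫ x, g x * U x) : ∀ᵐ x, (U x).im = 0 := by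
  have him : LocallyIntegrable (fun x => (U x).im) := by
    refine (hU.mono (g := fun x => (U x).im) ?_ fun x => ?_).locallyIntegrable
    · exact Complex.continuous_im.comp_aestronglyMeasurable hU.1
    · rw [← ofReal_norm, ← ofReal_norm]
      exact ENNReal.ofReal_le_ofReal (Complex.abs_im_le_norm _)
  refine ae_eq_zero_of_integral_contDiff_smul_eq_zero him fun g hg hgc => ?_
  let G : 𝓢(E n, ℂ) := HasCompactSupport.toSchwartzMap (f := fun x => (g x : ℂ))
    (hgc.comp_left Complex.ofReal_zero) (Complex.ofRealCLM.contDiff.comp hg)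
  have hG : ∀ x, G x = (g x : ℂ) := fun x => rfl
  have h1 := hT G fun x => by rw [hG, Complex.ofReal_im]
  rw [hTU] at h1
  have h2 := Complex.imCLM.integral_comp_comm (hU.integrable_mul G)
  simp only [Complex.imCLM_apply] at h2
  rw [h1] at h2
  rw [← h2]
  refine integral_congr_ae (.of_forall fun x => ?_)
  simp only
  rw [hG, Complex.im_ofReal_mul, smul_eq_mul]

theorem ae_eq_of_represents {T : 𝓢'(E n, ℂ)} {u v : E n → ℝ}
    (hu : Represents T fun x => (u x : ℂ)) (hv : Represents T fun x => (v x : ℂ)) :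
    u =ᵐ[volume] v := by
  have h := ae_eq_of_integral_contDiff_smul_eq hu.1 hv.1 fun g hg hgc => by
    let G : 𝓢(E n, ℂ) := HasCompactSupport.toSchwartzMap (f := fun x => (g x : ℂ))
      (hgc.comp_left Complex.ofReal_zero) (Complex.ofRealCLM.contDiff.comp hg)
    have hG : HasCompactSupport G := hgc.comp_left Complex.ofReal_zero
    have h1 := hu.2 G hG
    rw [hv.2 G hG] at h1
    exact h1.symm
  filter_upwards [h] with x hx
  exact_mod_cast hx

end RealDistributions

end FracOrlicz

namespace FracOrlicz

/-! ### Recognizing weak gradients -/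

section WeakGradients

variable {n : ℕ}

theorem HasWeakGrad.congr {k : ℕ} {u u' : E n → ℝ} {v v' : E n → EuclideanSpace ℝ (Fin k → Fin n)}
    (h : HasWeakGrad k u v) (hu : u =ᵐ[volume] u') (hv : v =ᵐ[volume] v') :
    HasWeakGrad k u' v' := by
  refine ⟨h.locInt.congr hu, h.locInt_grad.congr hv, fun I η hη hηc => ?_⟩
  have h1 := h.parts I η hη hηc
  have e1 : ∫ x, u' x * iteratedFDeriv ℝ k η x (fun j => EuclideanSpace.single (I j) 1) =
      ∫ x, u x * iteratedFDeriv ℝ k η x (fun j => EuclideanSpace.single (I j) 1) := by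
    refine integral_congr_ae ?_
    filter_upwards [hu] with x hx
    rw [hx]
  have e2 : ∫ x, v' x I * η x = ∫ x, v x I * η x := by
    refine integral_congr_ae ?_
    filter_upwards [hv] with x hx
    rw [hx]
  rw [e1, e2, h1]

theorem enorm_le_sum_enorm {ι : Type*} [Fintype ι] (v : EuclideanSpace ℝ ι) :
    ‖v‖ₑ ≤ ∑ I, ‖v I‖ₑ := by
  classical
  have h := (EuclideanSpace.basisFun ι ℝ).sum_repr v
  calc ‖v‖ₑ = ‖∑ I, (EuclideanSpace.basisFun ι ℝ).repr v I • EuclideanSpace.basisFun ι ℝ I‖ₑ := by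
        rw [h]
    _ ≤ ∑ I, ‖(EuclideanSpace.basisFun ι ℝ).repr v I • EuclideanSpace.basisFun ι ℝ I‖ₑ :=
        enorm_sum_le _ _
    _ = _ := by
        refine Finset.sum_congr rfl fun I _ => ?_
        rw [enorm_smul, ← ofReal_norm (EuclideanSpace.basisFun ι ℝ I),
          (EuclideanSpace.basisFun ι ℝ).norm_eq_one]
        simp

/-- For a real test function and real `u`, the real part of the identity only involves the real part
of `V I`. -/
theorem hasWeakGrad_of_integral_complex {k : ℕ} {u : E n → ℝ} (hu : TempInt fun x => (u x : ℂ))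
    {V : (Fin k → Fin n) → E n → ℂ} (hV : ∀ I, TempInt (V I))
    (h : ∀ I (g : 𝓢(E n, ℂ)), ∫ x, (LineDeriv.iteratedLineDerivOp (dirs I) g : 𝓢(E n, ℂ)) x * (u x : ℂ) =
      (-1) ^ k * ∫ x, g x * V I x) :
    HasWeakGrad k u fun x => WithLp.toLp 2 fun I => (V I x).re := by
  refine ⟨?_, ?_, fun I η hη hηc => ?_⟩
  · refine (hu.mono (g := u) ?_ fun x => ?_).locallyIntegrable
    · exact Complex.continuous_re.comp_aestronglyMeasurable hu.1
    · rw [← ofReal_norm, ← ofReal_norm, Complex.norm_real]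
  · have hm : AEStronglyMeasurable
        (fun x => (WithLp.toLp 2 fun I => (V I x).re : EuclideanSpace ℝ (Fin k → Fin n))) volume := by
      refine (PiLp.continuous_toLp 2 _).comp_aestronglyMeasurable ?_
      exact (aemeasurable_pi_lambda _ fun I =>
        (Complex.continuous_re.comp_aestronglyMeasurable (hV I).1).aemeasurable).aestronglyMeasurable
    refine TempInt.locallyIntegrable ⟨hm, ?_⟩
    calc _ ≤ ∫⁻ x, ∑ I, ‖V I x‖ₑ * wt x := by
          refine lintegral_mono fun x => ?_
          simp only
          rw [← Finset.sum_mul]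
          gcongr
          refine (enorm_le_sum_enorm _).trans (Finset.sum_le_sum fun I _ => ?_)
          rw [← ofReal_norm, ← ofReal_norm]
          exact ENNReal.ofReal_le_ofReal (Complex.abs_re_le_norm _)
      _ = ∑ I, ∫⁻ x, ‖V I x‖ₑ * wt x :=
          lintegral_finsetSum' _ fun I _ => (hV I).1.enorm.mul measurable_wt.aemeasurable
      _ < ⊤ := ENNReal.sum_lt_top.2 fun I _ => (hV I).2
  · let G : 𝓢(E n, ℂ) := HasCompactSupport.toSchwartzMap (f := fun x => (η x : ℂ))
      (hηc.comp_left Complex.ofReal_zero) (Complex.ofRealCLM.contDiff.comp hη)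
    have hG : ∀ x, G x = (η x : ℂ) := fun x => rfl
    have hG2 : ∀ x, (LineDeriv.iteratedLineDerivOp (dirs I) G : 𝓢(E n, ℂ)) x =
        ((iteratedFDeriv ℝ k η x (fun j => EuclideanSpace.single (I j) 1) : ℝ) : ℂ) := by
      intro x
      rw [SchwartzMap.iteratedLineDerivOp_eq_iteratedFDeriv]
      have hk : ContDiff ℝ k η := hη.of_le (by exact_mod_cast le_top)
      have := Complex.ofRealCLM.iteratedFDeriv_comp_left hk.contDiffAt (x := x) (i := k) le_rfl
      change (iteratedFDeriv ℝ k (Complex.ofRealCLM ∘ η) x) (dirs I) = _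
      rw [this]
      rfl
    have h1 := congrArg Complex.re (h I G)
    have e : ((-1 : ℂ)) ^ k = (((-1 : ℝ) ^ k : ℝ) : ℂ) := by push_cast; rfl
    have h2 := Complex.reCLM.integral_comp_comm
      (hu.integrable_mul (LineDeriv.iteratedLineDerivOp (dirs I) G))
    have h3 := Complex.reCLM.integral_comp_comm ((hV I).integrable_mul G)
    simp only [Complex.reCLM_apply] at h2 h3
    rw [e, Complex.re_ofReal_mul, ← h2, ← h3] at h1
    simp only [hG, hG2, Complex.re_ofReal_mul, Complex.ofReal_re] at h1
    simp only [mul_comm (u _), mul_comm _ (η _)]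
    exact h1

end WeakGradients

/-! ### Averages of blocks and geometric Jensen estimates -/

section Averages

variable {n : ℕ}

/-- The weighted averages of the rescaled frequency blocks. -/
def avg (s : ℝ) (l : ℝ≥0) (f : ℕ → E n → ℂ) (i : ℕ) (x : E n) : ℝ≥0∞ :=
  (∫⁻ z : E n, wt z)⁻¹ *
    sconv ((2 : ℝ) ^ i) wt (fun y => (2 : ℝ≥0∞) ^ ((i : ℝ) * s) * ‖f i y‖ₑ / l) x

theorem lintegral_wt_ne_zero : ∫⁻ z : E n, wt z ≠ 0 := by
  rw [Ne, lintegral_eq_zero_iff measurable_wt]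
  intro h
  have : ∀ᵐ _ : E n, False := h.mono fun x hx => wt_ne_zero x hx
  rw [Filter.eventually_false_iff_eq_bot, ae_eq_bot] at this
  exact (NeZero.ne (volume : Measure (E n))) this

theorem measurable_avg (s : ℝ) (l : ℝ≥0) {f : ℕ → E n → ℂ} (hf : ∀ i, Measurable (f i)) (i : ℕ) :
    Measurable (avg s l f i) := by
  have hfi := hf i
  unfold avg
  refine (measurable_sconv measurable_wt ?_).const_mul _
  fun_prop

theorem tsum_lintegral_yext_avg_le {A : ℝ≥0 → ℝ≥0∞} (s : ℝ) (l : ℝ≥0) {f : ℕ → E n → ℂ}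
    (hf : ∀ i, Measurable (f i)) :
    ∑' i, ∫⁻ x, yext A (avg s l f i x) ≤
      ∑' i : ℕ, ∫⁻ x, yext A ((2 : ℝ≥0∞) ^ ((i : ℝ) * s) * ‖f i x‖ₑ / l) := by
  refine ENNReal.tsum_le_tsum fun i => ?_
  have hfi := hf i
  exact lintegral_yext_sconv_le (pow_ne_zero i two_ne_zero) measurable_wt (by fun_prop)
    lintegral_wt_ne_zero lintegral_wt_lt_top.ne le_rfl

theorem sconv_eq_avg (s : ℝ) {l : ℝ≥0} (hl : 0 < l) (f : ℕ → E n → ℂ) (i : ℕ) (x : E n) :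
    sconv ((2 : ℝ) ^ i) wt (fun y => ‖f i y‖ₑ) x =
      (∫⁻ z : E n, wt z) * l * (2 : ℝ≥0∞) ^ (-((i : ℝ) * s)) * avg s l f i x := by
  have hl0 : (l : ℝ≥0∞) ≠ 0 := by exact_mod_cast hl.ne'
  have ha : (2 : ℝ≥0∞) ^ ((i : ℝ) * s) ≠ ⊤ := by
    simp [ENNReal.rpow_eq_top_iff]
  have h1 : sconv ((2 : ℝ) ^ i) wt (fun y => (2 : ℝ≥0∞) ^ ((i : ℝ) * s) * ‖f i y‖ₑ / l) x =
      (2 : ℝ≥0∞) ^ ((i : ℝ) * s) * sconv ((2 : ℝ) ^ i) wt (fun y => ‖f i y‖ₑ) x / l := by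
    rw [sconv_div hl0]
    congr 1
    unfold sconv
    rw [← lintegral_const_mul' _ _ ha]
    refine lintegral_congr fun z => ?_
    ring
  rw [avg, h1, div_eq_mul_inv]
  set W := ∫⁻ z : E n, wt z
  set S := sconv ((2 : ℝ) ^ i) wt (fun y => ‖f i y‖ₑ) x
  have e1 : (2 : ℝ≥0∞) ^ (-((i : ℝ) * s)) * 2 ^ ((i : ℝ) * s) = 1 := by
    rw [← ENNReal.rpow_add _ _ two_ne_zero ENNReal.ofNat_ne_top, neg_add_cancel, ENNReal.rpow_zero]
  calc S = (W * W⁻¹) * ((l : ℝ≥0∞) * (l : ℝ≥0∞)⁻¹) *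
        ((2 : ℝ≥0∞) ^ (-((i : ℝ) * s)) * 2 ^ ((i : ℝ) * s)) * S := by
        rw [e1, ENNReal.mul_inv_cancel lintegral_wt_ne_zero lintegral_wt_lt_top.ne,
          ENNReal.mul_inv_cancel hl0 ENNReal.coe_ne_top, one_mul, one_mul, one_mul]
    _ = _ := by ring

theorem tsum_two_rpow_ne_top {r : ℝ} (hr : r < 0) :
    ∑' i : ℕ, (2 : ℝ≥0∞) ^ ((i : ℝ) * r) ≠ ⊤ := by
  have h1 : ∀ i : ℕ, (2 : ℝ≥0∞) ^ ((i : ℝ) * r) = (2 ^ r) ^ i := fun i => by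
    rw [mul_comm, ENNReal.rpow_mul, ENNReal.rpow_natCast]
  simp only [h1]
  rw [ENNReal.tsum_geometric]
  have h2 : (2 : ℝ≥0∞) ^ r < 1 := ENNReal.rpow_lt_one_of_one_lt_of_neg (by norm_num) hr
  have h3 : (1 : ℝ≥0∞) - 2 ^ r ≠ 0 := (tsub_pos_of_lt h2).ne'
  finiteness

theorem tsum_two_rpow_ne_zero {r : ℝ} : ∑' i : ℕ, (2 : ℝ≥0∞) ^ ((i : ℝ) * r) ≠ 0 := by
  rw [Ne, ENNReal.tsum_eq_zero]
  intro h
  simpa using h 0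

/-- Jensen over `i` with the normalized geometric weights. It applies to every derivative of order
below `s`, with `r = k - s`. -/
theorem lintegral_yext_tsum_two_rpow_le {A : ℝ≥0 → ℝ≥0∞} {P : ℕ → E n → ℝ≥0∞}
    (hP : ∀ i, Measurable (P i)) {r : ℝ} (hr : r < 0) :
    ∫⁻ x, yext A ((∑' i : ℕ, (2 : ℝ≥0∞) ^ ((i : ℝ) * r) * P i x) /
      ∑' i : ℕ, (2 : ℝ≥0∞) ^ ((i : ℝ) * r)) ≤ ∑' i, ∫⁻ x, yext A (P i x) := by
  simp only [div_eq_mul_inv]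
  simp only [mul_comm _ (∑' i : ℕ, (2 : ℝ≥0∞) ^ ((i : ℝ) * r))⁻¹]
  exact lintegral_yext_tsum_le hP tsum_two_rpow_ne_zero (tsum_two_rpow_ne_top hr) le_rfl

theorem IsYoung.lintegral_tsum_mul_wt_lt_top {A : ℝ≥0 → ℝ≥0∞} (hA : IsYoung A)
    {P : ℕ → E n → ℝ≥0∞} (hP : ∀ i, Measurable (P i)) (h : ∑' i, ∫⁻ x, yext A (P i x) ≤ 1) {r : ℝ}
    (hr : r < 0) : ∫⁻ x, (∑' i : ℕ, (2 : ℝ≥0∞) ^ ((i : ℝ) * r) * P i x) * wt x < ⊤ :=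
  hA.lintegral_mul_wt_lt_top tsum_two_rpow_ne_zero (tsum_two_rpow_ne_top hr)
    ((lintegral_yext_tsum_two_rpow_le hP hr).trans h)

end Averages

end FracOrlicz

namespace FracOrlicz

/-! ### Gradients of the sum of blocks -/

section LowerBound

variable {n : ℕ} {φ₀ : E n → ℝ}

open FourierTransform LineDeriv

/-- `k` derivatives cost `2^{ik}`, and undoing the normalization in `avg` yields `2^{-is}`. The gain
`min(1, 2^i|y|)` reflects that the kernel is smooth at scale `2^{-i}`. -/
theorem IsGenerator.exists_blockDeriv_bounds (h : IsGenerator φ₀) (k : ℕ) :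
    ∃ C : ℝ≥0∞, C ≠ ⊤ ∧ ∀ (s : ℝ) (l : ℝ≥0), 0 < l → ∀ f : ℕ → E n → ℂ, (∀ i, TempInt (f i)) →
      (∀ i x, ∑ I : Fin k → Fin n, ‖h.blockDeriv i (f i) I x‖ₑ ≤
        C * l * ((2 : ℝ≥0∞) ^ ((i : ℝ) * (k - s)) * avg s l f i x)) ∧
      (∀ i x y, ∑ I : Fin k → Fin n,
          ‖h.blockDeriv i (f i) I x - h.blockDeriv i (f i) I (x - y)‖ₑ ≤
        C * l * ((2 : ℝ≥0∞) ^ ((i : ℝ) * (k - s)) * (min 1 (2 ^ i * ‖y‖ₑ) *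
          (avg s l f i x + avg s l f i (x - y))))) := by
  obtain ⟨C, hC, hb⟩ := exists_kconv_bounds (fun I : Fin k → Fin n => h.derivKernel I)
  refine ⟨C * ∫⁻ z : E n, wt z, ENNReal.mul_ne_top hC lintegral_wt_lt_top.ne,
    fun s l hl f hf => ?_⟩
  have hk : ∀ i : ℕ, ‖(-1 : ℂ) ^ k * (((2 : ℝ) ^ i : ℝ) : ℂ) ^ k‖ₑ = ((2 : ℝ≥0∞) ^ i) ^ k := by
    intro i
    rw [enorm_mul, enorm_pow, enorm_pow, enorm_neg, enorm_one, one_pow, one_mul,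
      ← ofReal_norm, Complex.norm_real, ofReal_norm, enorm_two_pow]
  have hks : ∀ i : ℕ, (2 : ℝ≥0∞) ^ ((i : ℝ) * (k - s)) = (2 ^ i) ^ k * 2 ^ (-((i : ℝ) * s)) := by
    intro i
    rw [mul_sub, sub_eq_add_neg, ENNReal.rpow_add _ _ two_ne_zero ENNReal.ofNat_ne_top,
      ENNReal.rpow_mul, ENNReal.rpow_natCast, ENNReal.rpow_natCast]
  refine ⟨fun i x => ?_, fun i x y => ?_⟩
  · have h1 := (hb ((2 : ℝ) ^ i) (by positivity) (f i) (hf i)).1 x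
    rw [sconv_eq_avg s hl] at h1
    simp only [IsGenerator.blockDeriv, enorm_mul _ (kconv _ _ _), hk]
    rw [← Finset.mul_sum, hks]
    refine (mul_le_mul' le_rfl h1).trans (le_of_eq ?_)
    ring
  · have h1 := (hb ((2 : ℝ) ^ i) (by positivity) (f i) (hf i)).2 x y
    rw [sconv_eq_avg s hl, sconv_eq_avg s hl, enorm_two_pow] at h1
    simp only [IsGenerator.blockDeriv, ← mul_sub, enorm_mul _ (kconv _ _ _ - _), hk]
    rw [← Finset.mul_sum, hks]
    refine (mul_le_mul' le_rfl h1).trans (le_of_eq ?_)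
    ring

/-- The weak gradients of a sum of frequency blocks, with pointwise bounds. -/
theorem IsGenerator.exists_gradient (h : IsGenerator φ₀) (k : ℕ) :
    ∃ C : ℝ≥0∞, C ≠ ⊤ ∧ ∀ A, IsYoung A → ∀ s : ℝ, (k : ℝ) < s → ∀ (T : 𝓢'(E n, ℂ))
      (f : ℕ → E n → ℂ), (∀ i, Measurable (f i)) → (∀ i, TempInt (f i)) →
      (∀ i g, dyadicOp φ₀ i T g = ∫ x, g x * f i x) →
      (∀ g, HasSum (fun i => dyadicOp φ₀ i T g) (T g)) → ∀ l : ℝ≥0, 0 < l →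
      ∑' i, ∫⁻ x, yext A (avg s l f i x) ≤ 1 →
      ∀ u : E n → ℝ, TempInt (fun x => (u x : ℂ)) → (∀ g, T g = ∫ x, g x * (u x : ℂ)) →
      ∃ v : E n → EuclideanSpace ℝ (Fin k → Fin n), Measurable v ∧ HasWeakGrad k u v ∧
      ∃ G : Set (E n), (∀ᵐ x, x ∈ G) ∧
        (∀ x ∈ G, ‖v x‖ₑ ≤ C * l * ∑' i : ℕ, (2 : ℝ≥0∞) ^ ((i : ℝ) * (k - s)) * avg s l f i x) ∧
        (∀ x ∈ G, ∀ y, x - y ∈ G → ‖v x - v (x - y)‖ₑ ≤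
          C * l * ∑' i : ℕ, (2 : ℝ≥0∞) ^ ((i : ℝ) * (k - s)) * (min 1 (2 ^ i * ‖y‖ₑ) *
            (avg s l f i x + avg s l f i (x - y)))) := by
  obtain ⟨C, hC, hb⟩ := h.exists_blockDeriv_bounds k
  refine ⟨C, hC, fun A hA s hks T f hfm hf hT hsum l hl hmod u hu hTu => ?_⟩
  obtain ⟨hb1, hb2⟩ := hb s l hl f hf
  have hCl : C * l ≠ ⊤ := ENNReal.mul_ne_top hC ENNReal.coe_ne_top
  let w : (Fin k → Fin n) → ℕ → E n → ℂ := fun I i => h.blockDeriv i (f i) I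
  have hw : ∀ I i, AEStronglyMeasurable (w I i) volume := fun I i =>
    ((hf i).kconv _).1.const_mul _
  have hwint : ∀ I, ∫⁻ x, (∑' i, ‖w I i x‖ₑ) * wt x < ⊤ := by
    intro I
    refine lt_of_le_of_lt ?_ (ENNReal.mul_lt_top hCl.lt_top
      (hA.lintegral_tsum_mul_wt_lt_top (measurable_avg s l hfm) hmod (sub_neg.2 hks)))
    rw [← lintegral_const_mul' _ _ hCl]
    refine lintegral_mono fun x => ?_
    simp only
    rw [← mul_assoc, ← ENNReal.tsum_mul_left]
    gcongr with i
    exact (Finset.single_le_sum (f := fun I => ‖w I i x‖ₑ) (fun _ _ => zero_le)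
      (Finset.mem_univ I)).trans (hb1 i x)
  let V : (Fin k → Fin n) → E n → ℂ := fun I x => ∑' i, w I i x
  have hV : ∀ I, TempInt (V I) := fun I => tempInt_tsum (hw I) (hwint I)
  have hparts : ∀ I (g : 𝓢(E n, ℂ)), ∫ x, (∂^{dirs I} g : 𝓢(E n, ℂ)) x * (u x : ℂ) =
      (-1) ^ k * ∫ x, g x * V I x := by
    intro I g
    rw [← hTu]
    refine (hsum _).unique ?_
    simp only [hT]
    have h1 := (hasSum_integral_mul (hw I) (hwint I) g).mul_left ((-1) ^ k)
    simpa only [h.integral_deriv_mul (hf _) (hT _) I g] using h1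
  have hgrad := hasWeakGrad_of_integral_complex hu hV hparts
  have hvm := hgrad.locInt_grad.aestronglyMeasurable
  refine ⟨hvm.mk _, hvm.stronglyMeasurable_mk.measurable,
    hgrad.congr (Filter.EventuallyEq.refl _ _) hvm.ae_eq_mk,
    -- The bounds hold only where the series converge and the measurable representative agrees with
    -- them. A difference bound needs both points in this conull set.
    {x | (∀ I, Summable fun i => w I i x) ∧ hvm.mk _ x = WithLp.toLp 2 fun I => (V I x).re},
    ?_, ?_, ?_⟩
  · filter_upwards [ae_all_iff.2 fun I => ae_summable_of_lintegral (hw I) (hwint I),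
      hvm.ae_eq_mk] with x hx1 hx2
    exact ⟨hx1, hx2.symm⟩
  · rintro x ⟨-, hx⟩
    rw [hx, ← ENNReal.tsum_mul_left]
    refine (enorm_le_sum_enorm _).trans ?_
    calc _ ≤ ∑ I, ∑' i, ‖w I i x‖ₑ := by
          refine Finset.sum_le_sum fun I _ => ?_
          refine le_trans ?_ (enorm_tsum_le_tsum_enorm (f := fun i => w I i x))
          rw [← ofReal_norm, ← ofReal_norm]
          exact ENNReal.ofReal_le_ofReal (Complex.abs_re_le_norm _)
      _ = ∑' i, ∑ I, ‖w I i x‖ₑ := (Summable.tsum_finsetSum fun _ _ => ENNReal.summable).symm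
      _ ≤ _ := ENNReal.tsum_le_tsum fun i => hb1 i x
  · rintro x ⟨hs1, hx⟩ y ⟨hs2, hxy⟩
    rw [hx, hxy, ← ENNReal.tsum_mul_left]
    refine (enorm_le_sum_enorm _).trans ?_
    calc _ ≤ ∑ I, ∑' i, ‖w I i x - w I i (x - y)‖ₑ := by
          refine Finset.sum_le_sum fun I _ => ?_
          refine le_trans ?_ (enorm_tsum_le_tsum_enorm (f := fun i => w I i x - w I i (x - y)))
          rw [(hs1 I).tsum_sub (hs2 I), ← ofReal_norm, ← ofReal_norm]
          exact ENNReal.ofReal_le_ofReal (Complex.abs_re_le_norm (V I x - V I (x - y)))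
      _ = ∑' i, ∑ I, ‖w I i x - w I i (x - y)‖ₑ :=
          (Summable.tsum_finsetSum fun _ _ => ENNReal.summable).symm
      _ ≤ _ := ENNReal.tsum_le_tsum fun i => hb2 i x y

/-- The left side is `min(t^{-r}, t^{1-r})`, which decays at `0` and at infinity exactly because `0
< r < 1`. -/
theorem rpow_mul_min_le {t : ℝ≥0∞} {r : ℝ} (hr0 : 0 < r) (hr1 : r < 1) (ht0 : t ≠ 0)
    (ht : t ≠ ⊤) : t ^ (-r) * min 1 t ≤ omega (min r (1 - r)) t := by
  have hm : t ^ (-r) * t = t ^ (1 - r) := by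
    conv_lhs => rw [← ENNReal.rpow_one t, ← ENNReal.rpow_mul]
    rw [one_mul, ← ENNReal.rpow_add _ _ ht0 ht]
    congr 1
    ring
  rw [omega, mul_min, mul_one, hm]
  rcases le_total t 1 with h | h
  · refine le_min ((min_le_right _ _).trans ?_) ((min_le_right _ _).trans ?_)
    · exact ENNReal.rpow_le_rpow_of_exponent_ge h (min_le_right _ _)
    · refine ENNReal.rpow_le_rpow_of_exponent_ge h ?_
      have : 0 < min r (1 - r) := lt_min hr0 (by linarith)
      linarith
  · refine le_min ((min_le_left _ _).trans ?_) ((min_le_left _ _).trans ?_)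
    · refine ENNReal.rpow_le_rpow_of_exponent_le h ?_
      have : 0 < min r (1 - r) := lt_min hr0 (by linarith)
      linarith
    · exact ENNReal.rpow_le_rpow_of_exponent_le h (neg_le_neg (min_le_left _ _))

end LowerBound

end FracOrlicz

namespace FracOrlicz

/-! ### Sobolev norm bounded by the Littlewood-Paley norm -/

section LowerBound

variable {n : ℕ} {φ₀ : E n → ℝ}

theorem IsYoung.luxNorm_le {A : ℝ≥0 → ℝ≥0∞} (hA : IsYoung A) {F : Type*} [NormedAddCommGroup F]
    {v : E n → F} {L : ℝ≥0∞} (hL0 : L ≠ 0) (hL : L ≠ ⊤) (h : ∫⁻ x, yext A (‖v x‖ₑ / L) ≤ 1) :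
    luxNorm A v ≤ L := by
  lift L to ℝ≥0 using hL
  have hL0' : L ≠ 0 := by exact_mod_cast hL0
  refine (iInf₂_le L (pos_iff_ne_zero.2 hL0')).trans (iInf_le _ ?_)
  simp only
  rwa [hA.lintegral_luxNorm_eq v hL0']

theorem IsYoung.gagliardo_le {A : ℝ≥0 → ℝ≥0∞} (hA : IsYoung A) {F : Type*} [NormedAddCommGroup F]
    [MeasurableSpace F] [BorelSpace F] [SecondCountableTopology F] {σ : ℝ} (hσ : 0 ≤ σ)
    {v : E n → F} (hv : Measurable v) {L : ℝ≥0∞} (hL0 : L ≠ 0) (hL : L ≠ ⊤)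
    (h : ∫⁻ x : E n, ∫⁻ y : E n, yext A (‖v x - v (x - y)‖ₑ / (L * ‖y‖ₑ ^ σ)) / ‖y‖ₑ ^ n ≤ 1) :
    gagliardo σ A v ≤ L := by
  lift L to ℝ≥0 using hL
  have hL0' : L ≠ 0 := by exact_mod_cast hL0
  refine (iInf₂_le L (pos_iff_ne_zero.2 hL0')).trans (iInf_le _ ?_)
  simp only
  rwa [hA.lintegral_gagliardo_eq hσ hv hL0']

theorem IsGenerator.exists_gradLuxNorm_le (h : IsGenerator φ₀) (k : ℕ) {s : ℝ} (hks : (k : ℝ) < s) :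
    ∃ C : ℝ≥0∞, C ≠ ⊤ ∧ ∀ A, IsYoung A → ∀ (T : 𝓢'(E n, ℂ))
      (f : ℕ → E n → ℂ), (∀ i, Measurable (f i)) → (∀ i, TempInt (f i)) →
      (∀ i g, dyadicOp φ₀ i T g = ∫ x, g x * f i x) →
      (∀ g, HasSum (fun i => dyadicOp φ₀ i T g) (T g)) → ∀ l : ℝ≥0, 0 < l →
      ∑' i, ∫⁻ x, yext A (avg s l f i x) ≤ 1 →
      ∀ u : E n → ℝ, TempInt (fun x => (u x : ℂ)) → (∀ g, T g = ∫ x, g x * (u x : ℂ)) →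
      gradLuxNorm k A u ≤ C * l := by
  obtain ⟨C, hC, hgrad⟩ := h.exists_gradient k
  let K : ℝ≥0∞ := ∑' i : ℕ, (2 : ℝ≥0∞) ^ ((i : ℝ) * (k - s))
  have hr : (k : ℝ) - s < 0 := sub_neg.2 hks
  have hK : K ≠ ⊤ := tsum_two_rpow_ne_top hr
  have hK0 : K ≠ 0 := tsum_two_rpow_ne_zero
  refine ⟨(C + 1) * K, by finiteness, fun A hA T f hfm hf hT hsum l hl hmod u hu hTu => ?_⟩
  have hl0 : (l : ℝ≥0∞) ≠ 0 := by exact_mod_cast hl.ne'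
  obtain ⟨v, hvm, hv, G, hG, hb, -⟩ := hgrad A hA s hks T f hfm hf hT hsum l hl hmod u hu hTu
  refine (iInf₂_le v hv).trans (hA.luxNorm_le (by simp [hK0, hl0]) (by finiteness) ?_)
  refine le_trans (lintegral_mono_ae ?_)
    ((lintegral_yext_tsum_two_rpow_le (measurable_avg s l hfm) hr).trans hmod)
  filter_upwards [hG] with x hx
  refine yext_mono (ENNReal.div_le_of_le_mul ((hb x hx).trans ?_))
  set S := ∑' i : ℕ, (2 : ℝ≥0∞) ^ ((i : ℝ) * (k - s)) * avg s l f i x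
  change _ ≤ S / K * _
  calc C * l * S ≤ (C + 1) * l * S := by gcongr; exact le_self_add
    _ = (K * K⁻¹) * ((C + 1) * l * S) := by rw [ENNReal.mul_inv_cancel hK0 hK, one_mul]
    _ = _ := by rw [div_eq_mul_inv]; ring

theorem IsGenerator.exists_gradGagliardo_le (h : IsGenerator φ₀) (hn : 1 ≤ n) (m : ℕ) {σ : ℝ}
    (hσ0 : 0 < σ) (hσ1 : σ < 1) :
    ∃ C : ℝ≥0∞, C ≠ ⊤ ∧ ∀ A, IsYoung A → ∀ (T : 𝓢'(E n, ℂ))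
      (f : ℕ → E n → ℂ), (∀ i, Measurable (f i)) → (∀ i, TempInt (f i)) →
      (∀ i g, dyadicOp φ₀ i T g = ∫ x, g x * f i x) →
      (∀ g, HasSum (fun i => dyadicOp φ₀ i T g) (T g)) → ∀ l : ℝ≥0, 0 < l →
      ∑' i, ∫⁻ x, yext A (avg (m + σ) l f i x) ≤ 1 →
      ∀ u : E n → ℝ, TempInt (fun x => (u x : ℂ)) → (∀ g, T g = ∫ x, g x * (u x : ℂ)) →
      gradGagliardo m σ A u ≤ C * l := by
  obtain ⟨C, hC, hgrad⟩ := h.exists_gradient m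
  have hα : 0 < min σ (1 - σ) := lt_min hσ0 (by linarith)
  obtain ⟨K1, hK1, hsumω⟩ := exists_tsum_omega_le hα
  let K : ℝ≥0∞ := K1 + (∫⁻ y : E n, omega (min σ (1 - σ)) ‖y‖ₑ / ‖y‖ₑ ^ n) + 1
  have hK : K ≠ ⊤ := by
    have := (lintegral_omega_lt_top hn hα).ne
    simp only [K]
    finiteness
  have hK0 : K ≠ 0 := by simp [K]
  -- `C + 1` instead of `C` keeps the Luxemburg level nonzero, and the `2` compensates the mean of
  -- the values at `x` and `x - y`.
  refine ⟨(C + 1) * (2 * K), by finiteness, fun A hA T f hfm hf hT hsum l hl hmod u hu hTu => ?_⟩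
  have hl0 : (l : ℝ≥0∞) ≠ 0 := by exact_mod_cast hl.ne'
  obtain ⟨v, hvm, hv, G, hG, -, hb⟩ :=
    hgrad A hA (m + σ) (by linarith) T f hfm hf hT hsum l hl hmod u hu hTu
  refine (iInf₂_le v hv).trans (hA.gagliardo_le hσ0.le hvm (by simp [hK0, hl0]) (by finiteness) ?_)
  refine le_trans (lintegral_mono_ae ?_)
    (lintegral_yext_difference_le (measurable_avg (m + σ) l hfm) hmod hK0 hK
      (fun t => (hsumω t).trans (le_add_right le_self_add)) (le_add_right le_add_self))
  filter_upwards [hG] with x hx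
  -- For fixed `x`, the map `y ↦ x - y` is quasi-measure-preserving, so almost every `y` is
  -- admissible.
  have hG' : ∀ᵐ y, x - y ∈ G :=
    (quasiMeasurePreserving_sub_left (volume : Measure (E n)) x).ae hG
  refine lintegral_mono_ae ?_
  filter_upwards [hG'] with y hy
  refine ENNReal.div_le_div_right (yext_mono ?_) _
  rcases eq_or_ne y 0 with rfl | hy0
  · simp
  have ht0 : ‖y‖ₑ ≠ 0 := by simpa using hy0
  have ht : ‖y‖ₑ ≠ ⊤ := by simp
  have hs0 : ‖y‖ₑ ^ σ ≠ 0 := by simp [ENNReal.rpow_eq_zero_iff, hy0]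
  have hst : ‖y‖ₑ ^ σ ≠ ⊤ := ENNReal.rpow_ne_top_of_nonneg hσ0.le ht
  refine ENNReal.div_le_of_le_mul ((hb x hx y hy).trans ?_)
  -- Writing `2^{-iσ}` as `|y|^σ (2^i|y|)^{-σ}` cancels the denominator of the seminorm and leaves
  -- an expression in `2^i|y|` alone.
  have key : ∀ i : ℕ, (2 : ℝ≥0∞) ^ ((i : ℝ) * (m - (m + σ))) * (min 1 (2 ^ i * ‖y‖ₑ) *
      (avg (m + σ) l f i x + avg (m + σ) l f i (x - y))) ≤
      ‖y‖ₑ ^ σ * (omega (min σ (1 - σ)) (2 ^ i * ‖y‖ₑ) *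
        (avg (m + σ) l f i x + avg (m + σ) l f i (x - y))) := by
    intro i
    have h1 := rpow_mul_min_le hσ0 hσ1 (t := 2 ^ i * ‖y‖ₑ) (by simp [hy0]) (by finiteness)
    have h2 : (2 : ℝ≥0∞) ^ ((i : ℝ) * (m - (m + σ))) = ‖y‖ₑ ^ σ * (2 ^ i * ‖y‖ₑ) ^ (-σ) := by
      rw [ENNReal.mul_rpow_of_ne_top (by finiteness) ht, mul_left_comm,
        ENNReal.rpow_neg ‖y‖ₑ, ENNReal.mul_inv_cancel hs0 hst, mul_one, ← ENNReal.rpow_natCast,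
        ← ENNReal.rpow_mul]
      congr 1
      ring
    calc _ = ‖y‖ₑ ^ σ * ((2 ^ i * ‖y‖ₑ) ^ (-σ) * min 1 (2 ^ i * ‖y‖ₑ) *
          (avg (m + σ) l f i x + avg (m + σ) l f i (x - y))) := by rw [h2]; ring
      _ ≤ _ := by gcongr
  have h3 := ENNReal.tsum_le_tsum key
  rw [ENNReal.tsum_mul_left] at h3
  set S := ∑' i : ℕ, omega (min σ (1 - σ)) (2 ^ i * ‖y‖ₑ) *
    (avg (m + σ) l f i x + avg (m + σ) l f i (x - y))
  calc _ ≤ (C + 1) * l * (‖y‖ₑ ^ σ * S) := by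
        gcongr
        exact le_self_add
    _ = (K * K⁻¹) * (2 * 2⁻¹) * ((C + 1) * l * (‖y‖ₑ ^ σ * S)) := by
        rw [ENNReal.mul_inv_cancel hK0 hK, ENNReal.mul_inv_cancel two_ne_zero ENNReal.ofNat_ne_top,
          one_mul, one_mul]
    _ = _ := by ring

/-- The fractional Orlicz-Sobolev norms are bounded by the Littlewood-Paley norm. -/
theorem IsGenerator.exists_sobolev_le (h : IsGenerator φ₀) (hn : 1 ≤ n) (m : ℕ) {σ : ℝ}
    (hσ0 : 0 < σ) (hσ1 : σ < 1) :
    ∃ C : ℝ≥0∞, C ≠ ⊤ ∧ ∀ A, IsYoung A → ∀ T : 𝓢'(E n, ℂ), IsRealDistribution T →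
      ∀ f : ℕ → E n → ℂ, (∀ i, Measurable (f i)) → (∀ i, Represents (dyadicOp φ₀ i T) (f i)) →
      ∀ l : ℝ≥0, 0 < l →
      ∑' i : ℕ, ∫⁻ x, yext A ((2 : ℝ≥0∞) ^ ((i : ℝ) * (m + σ)) * ‖f i x‖ₑ / l) ≤ 1 →
      ∃ u : E n → ℝ, AEStronglyMeasurable u volume ∧ Represents T (fun x => (u x : ℂ)) ∧
        luxNorm A u + (∑ k ∈ Finset.Icc 1 m, gradLuxNorm k A u) + gradGagliardo m σ A u ≤ C * l := by
  have hlt : ∀ k : Finset.Icc 1 m, ((k : ℕ) : ℝ) < m + σ := fun k => by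
    have h1 : (k : ℕ) ≤ m := (Finset.mem_Icc.1 k.2).2
    have h2 : ((k : ℕ) : ℝ) ≤ m := by exact_mod_cast h1
    linarith
  choose C1 hC1 hgrad using fun k : Finset.Icc 1 m => h.exists_gradLuxNorm_le k (hlt k)
  obtain ⟨C2, hC2, hgag⟩ := h.exists_gradGagliardo_le hn m hσ0 hσ1
  have hs : 0 < (m : ℝ) + σ := by positivity
  let s : ℝ := m + σ
  have hr : -s < 0 := neg_lt_zero.2 hs
  let K : ℝ≥0∞ := ∑' i : ℕ, (2 : ℝ≥0∞) ^ ((i : ℝ) * -s)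
  have hK : K ≠ ⊤ := tsum_two_rpow_ne_top hr
  have hK0 : K ≠ 0 := tsum_two_rpow_ne_zero
  have hsumC : ∑ k : Finset.Icc 1 m, C1 k ≠ ⊤ := by simpa using hC1
  refine ⟨K + (∑ k, C1 k) + C2, by finiteness, fun A hA T hTreal f hfm hfr l hl hmod => ?_⟩
  have hl0 : (l : ℝ≥0∞) ≠ 0 := by exact_mod_cast hl.ne'
  let F : ℕ → E n → ℝ≥0∞ := fun i x => (2 : ℝ≥0∞) ^ ((i : ℝ) * s) * ‖f i x‖ₑ / l
  have hF : ∀ i, Measurable (F i) := fun i => by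
    have := hfm i
    simp only [F]
    fun_prop
  have hfF : ∀ i x, ‖f i x‖ₑ = l * ((2 : ℝ≥0∞) ^ ((i : ℝ) * -s) * F i x) := by
    intro i x
    have e1 : (2 : ℝ≥0∞) ^ ((i : ℝ) * -s) * 2 ^ ((i : ℝ) * s) = 1 := by
      rw [← ENNReal.rpow_add _ _ two_ne_zero ENNReal.ofNat_ne_top, mul_neg, neg_add_cancel,
        ENNReal.rpow_zero]
    simp only [F]
    rw [div_eq_mul_inv]
    calc ‖f i x‖ₑ = ((2 : ℝ≥0∞) ^ ((i : ℝ) * -s) * 2 ^ ((i : ℝ) * s)) *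
          ((l : ℝ≥0∞) * (l : ℝ≥0∞)⁻¹) * ‖f i x‖ₑ := by
          rw [e1, ENNReal.mul_inv_cancel hl0 ENNReal.coe_ne_top, one_mul, one_mul]
      _ = _ := by ring
  have hsumF : ∀ x, ∑' i, ‖f i x‖ₑ = l * ∑' i : ℕ, (2 : ℝ≥0∞) ^ ((i : ℝ) * -s) * F i x := by
    intro x
    rw [← ENNReal.tsum_mul_left]
    exact tsum_congr fun i => hfF i x
  have hint : ∫⁻ x, (∑' i, ‖f i x‖ₑ) * wt x < ⊤ := by
    simp only [hsumF, mul_assoc]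
    rw [lintegral_const_mul' _ _ ENNReal.coe_ne_top]
    exact ENNReal.mul_lt_top ENNReal.coe_lt_top (hA.lintegral_tsum_mul_wt_lt_top hF hmod hr)
  have hfsm : ∀ i, AEStronglyMeasurable (f i) volume := fun i => (hfm i).aestronglyMeasurable
  have hf : ∀ i, TempInt (f i) := fun i => ⟨hfsm i, lt_of_le_of_lt
    (lintegral_mono fun x => by gcongr; exact ENNReal.le_tsum (f := fun i => ‖f i x‖ₑ) i) hint⟩
  have hT : ∀ i g, dyadicOp φ₀ i T g = ∫ x, g x * f i x := fun i g => (hfr i).apply h (hf i) g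
  have hsum : ∀ g, HasSum (fun i => dyadicOp φ₀ i T g) (T g) := fun g => by
    refine h.hasSum_of_summable ?_
    simp only [hT]
    exact (hasSum_integral_mul hfsm hint g).summable
  have hU := tempInt_tsum hfsm hint
  have hTU : ∀ g, T g = ∫ x, g x * ∑' i, f i x := fun g => by
    refine (hsum g).unique ?_
    simp only [hT]
    exact hasSum_integral_mul hfsm hint g
  have him := hTreal.im_eq_zero hU hTU
  -- The sum of the blocks represents the real distribution `T`, so its imaginary part vanishes
  -- almost everywhere and may be dropped.
  let u : E n → ℝ := fun x => (∑' i, f i x).re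
  have hUu : (fun x => ∑' i, f i x) =ᵐ[volume] fun x => (u x : ℂ) := by
    filter_upwards [him] with x hx
    exact Complex.ext (by simp [u]) (by simp [hx])
  have hu : TempInt fun x => (u x : ℂ) := hU.congr hUu
  have hTu : ∀ g, T g = ∫ x, g x * (u x : ℂ) := fun g => by
    rw [hTU]
    refine integral_congr_ae ?_
    filter_upwards [hUu] with x hx
    rw [hx]
  have havg : ∑' i, ∫⁻ x, yext A (avg s l f i x) ≤ 1 :=
    (tsum_lintegral_yext_avg_le s l hfm).trans hmod
  refine ⟨u, Complex.continuous_re.comp_aestronglyMeasurable hU.1,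
    ⟨hu.locallyIntegrable, fun g _ => hTu g⟩, ?_⟩
  rw [add_mul, add_mul]
  gcongr ?_ + ?_ + ?_
  · refine hA.luxNorm_le (by simp [hK0, hl0]) (by finiteness) ?_
    refine le_trans (lintegral_mono fun x => yext_mono ?_)
      ((lintegral_yext_tsum_two_rpow_le hF hr).trans hmod)
    refine ENNReal.div_le_of_le_mul ?_
    calc ‖u x‖ₑ ≤ ∑' i, ‖f i x‖ₑ := by
          refine le_trans ?_ enorm_tsum_le_tsum_enorm
          rw [← ofReal_norm, ← ofReal_norm]
          exact ENNReal.ofReal_le_ofReal (Complex.abs_re_le_norm _)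
      _ = (K * K⁻¹) * (l * ∑' i : ℕ, (2 : ℝ≥0∞) ^ ((i : ℝ) * -s) * F i x) := by
          rw [ENNReal.mul_inv_cancel hK0 hK, one_mul, hsumF]
      _ = _ := by rw [div_eq_mul_inv]; ring
  · rw [Finset.sum_mul, ← Finset.sum_coe_sort]
    exact Finset.sum_le_sum fun k _ => hgrad k A hA T f hfm hf hT hsum l hl havg u hu hTu
  · exact hgag A hA T f hfm hf hT hsum l hl havg u hu hTu

end LowerBound

end FracOrlicz

namespace FracOrlicz

/-! ### From modular estimates to the equivalence of norms -/

section Equivalence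

variable {n : ℕ} {φ₀ : E n → ℝ}

theorem le_luxInf_add {ρ₁ ρ₂ : ℝ≥0 → ℝ≥0∞} {B : ℝ≥0∞}
    (h : ∀ l₁ l₂ : ℝ≥0, 0 < l₁ → 0 < l₂ → ρ₁ l₁ ≤ 1 → ρ₂ l₂ ≤ 1 → B ≤ l₁ + l₂) :
    B ≤ luxInf ρ₁ + luxInf ρ₂ := by
  simp only [luxInf, ENNReal.iInf_add, ENNReal.add_iInf]
  exact le_iInf fun l₂ => le_iInf fun h₂ => le_iInf fun h₂' => le_iInf fun l₁ => le_iInf fun h₁ =>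
    le_iInf fun h₁' => h _ _ ‹_› ‹_› ‹_› ‹_›

theorem exists_of_luxInf_lt_top {ρ : ℝ≥0 → ℝ≥0∞} (h : luxInf ρ < ⊤) :
    ∃ l : ℝ≥0, 0 < l ∧ ρ l ≤ 1 := by
  by_contra! hne
  refine h.ne ?_
  simp only [luxInf, iInf_eq_top]
  exact fun l hl hρ => absurd hρ (hne l hl).not_ge

theorem IsYoung.tempInt_of_luxNorm_lt_top {A : ℝ≥0 → ℝ≥0∞} (hA : IsYoung A) {F : Type*}
    [NormedAddCommGroup F] {v : E n → F} (hv : AEStronglyMeasurable v volume)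
    (h : luxNorm A v < ⊤) : TempInt v := by
  obtain ⟨l, hl, hρ⟩ := exists_of_luxInf_lt_top h
  rw [hA.lintegral_luxNorm_eq v hl.ne'] at hρ
  exact ⟨hv, hA.lintegral_mul_wt_lt_top (by exact_mod_cast hl.ne') ENNReal.coe_ne_top hρ⟩

theorem Represents.congr {T : 𝓢'(E n, ℂ)} {f g : E n → ℂ} (h : Represents T f)
    (hfg : f =ᵐ[volume] g) : Represents T g := by
  refine ⟨h.1.congr hfg, fun η hη => (h.2 η hη).trans (integral_congr_ae ?_)⟩
  filter_upwards [hfg] with x hx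
  rw [hx]

theorem HasWeakGrad.ae_eq {k : ℕ} {u : E n → ℝ} {v v' : E n → EuclideanSpace ℝ (Fin k → Fin n)}
    (h : HasWeakGrad k u v) (h' : HasWeakGrad k u v') : v =ᵐ[volume] v' := by
  have hloc : ∀ {w : E n → EuclideanSpace ℝ (Fin k → Fin n)}, LocallyIntegrable w → ∀ I,
      LocallyIntegrable (fun x => w x I) := by
    intro w hw I
    refine hw.mono ?_ (.of_forall fun x => PiLp.norm_apply_le (w x) I)
    have : Continuous fun y : EuclideanSpace ℝ (Fin k → Fin n) => y I := by fun_prop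
    exact this.comp_aestronglyMeasurable hw.aestronglyMeasurable
  have h1 : ∀ I, ∀ᵐ x, v x I = v' x I := by
    intro I
    refine ae_eq_of_integral_contDiff_smul_eq (hloc h.locInt_grad I) (hloc h'.locInt_grad I)
      fun η hη hηc => ?_
    have h2 := h.parts I η hη hηc
    rw [h'.parts I η hη hηc] at h2
    have h3 := mul_left_cancel₀ (pow_ne_zero k (by norm_num)) h2
    simp only [smul_eq_mul, mul_comm (η _)]
    exact h3.symm
  filter_upwards [ae_all_iff.2 h1] with x hx
  ext I
  exact hx I

theorem hasWeakGrad_zero {u : E n → ℝ} (hu : LocallyIntegrable u) :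
    HasWeakGrad 0 u fun x => WithLp.toLp 2 fun _ => u x := by
  refine ⟨hu, ?_, fun I η hη hηc => ?_⟩
  · let L : ℝ →L[ℝ] EuclideanSpace ℝ (Fin 0 → Fin n) :=
      (EuclideanSpace.equiv (Fin 0 → Fin n) ℝ).symm.toContinuousLinearMap.comp
        (ContinuousLinearMap.pi fun _ => ContinuousLinearMap.id ℝ ℝ)
    intro x
    obtain ⟨s, hs, hus⟩ := hu x
    exact ⟨s, hs, L.integrable_comp hus⟩
  · simp

/-- The gradient of order `[s]` of a function in `W^{s,A}` is tempered. -/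
theorem IsYoung.tempInt_grad {A : ℝ≥0 → ℝ≥0∞} (hA : IsYoung A) {m : ℕ} {u : E n → ℝ}
    (hu : TempInt u) (hfin : ∑ k ∈ Finset.Icc 1 m, gradLuxNorm k A u < ⊤)
    {v : E n → EuclideanSpace ℝ (Fin m → Fin n)} (hv : HasWeakGrad m u v) : TempInt v := by
  rcases Nat.eq_zero_or_pos m with rfl | hm
  · refine TempInt.congr (f := fun x => WithLp.toLp 2 fun _ => u x) ?_
      ((hasWeakGrad_zero hu.locallyIntegrable).ae_eq hv)
    refine hu.mono (hasWeakGrad_zero hu.locallyIntegrable).locInt_grad.aestronglyMeasurable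
      fun x => ?_
    refine (enorm_le_sum_enorm _).trans (le_of_eq ?_)
    simp
  · have h1 := (ENNReal.sum_lt_top.1 hfin) m (Finset.mem_Icc.2 ⟨hm, le_rfl⟩)
    simp only [gradLuxNorm, iInf_lt_iff] at h1
    obtain ⟨v', hv', h2⟩ := h1
    exact (hA.tempInt_of_luxNorm_lt_top hv'.locInt_grad.aestronglyMeasurable h2).congr (hv'.ae_eq hv)

theorem luxNorm_congr {A : ℝ≥0 → ℝ≥0∞} {F : Type*} [NormedAddCommGroup F] {v w : E n → F}
    (h : v =ᵐ[volume] w) : luxNorm A v = luxNorm A w := by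
  unfold luxNorm
  congr 1
  ext l
  refine lintegral_congr_ae ?_
  filter_upwards [h] with x hx
  rw [hx]

theorem WNorm_congr {s : ℝ} {A : ℝ≥0 → ℝ≥0∞} {u u' : E n → ℝ} (h : u =ᵐ[volume] u') :
    WNorm s A u = WNorm s A u' := by
  have hiff : ∀ (k : ℕ) (v : E n → EuclideanSpace ℝ (Fin k → Fin n)),
      HasWeakGrad k u v ↔ HasWeakGrad k u' v := fun k v =>
    ⟨fun hv => hv.congr h (.refl _ _), fun hv => hv.congr h.symm (.refl _ _)⟩
  simp only [WNorm, gradLuxNorm, gradGagliardo, hiff, luxNorm_congr h]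

/-- `exists_FNorm_le` needs one common level and measurable functions. The level `l₁ + l₂` is
admissible for both modulars by monotonicity, and Borel representatives change neither the modulars
nor `T`. -/
theorem FNorm_le_of_modular {m : ℕ} {σ : ℝ} {A : ℝ≥0 → ℝ≥0∞} (hA : IsYoung A) (hσ : 0 ≤ σ)
    (hφ : IsGenerator φ₀) {C : ℝ≥0}
    (hC : ∀ (u : E n → ℝ) (v : E n → EuclideanSpace ℝ (Fin m → Fin n)), Measurable u →
      Measurable v → HasWeakGrad m u v → ∀ hu : TempInt (fun x => (u x : ℂ)), TempInt v →
      ∀ l : ℝ≥0, 0 < l → ∫⁻ x, yext A (‖u x‖ₑ / l) ≤ 1 →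
      ∫⁻ x : E n, ∫⁻ h : E n, yext A (‖v x - v (x - h)‖ₑ / (l * ‖h‖ₑ ^ σ)) / ‖h‖ₑ ^ n ≤ 1 →
      FNorm φ₀ (m + σ) A hu.toDist ≤ C * l)
    {T : 𝓢'(E n, ℂ)} {u : E n → ℝ} (hT : Represents T fun x => (u x : ℂ)) (hu : TempInt u)
    {v : E n → EuclideanSpace ℝ (Fin m → Fin n)} (hv : HasWeakGrad m u v) (hvt : TempInt v)
    {l₁ l₂ : ℝ≥0} (hl₁ : 0 < l₁) (hl₂ : 0 < l₂) (h₁ : ∫⁻ x, A (‖u x‖₊ / l₁) ≤ 1)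
    (h₂ : ∫⁻ p : E n × E n, A (‖v p.1 - v p.2‖₊ / (l₂ * ‖p.1 - p.2‖₊ ^ σ)) /
      (‖p.1 - p.2‖₊ : ℝ≥0∞) ^ n ≤ 1) :
    FNorm φ₀ (m + σ) A T ≤ C * (l₁ + l₂) := by
  let u' := hu.1.mk u
  let v' := hvt.1.mk v
  have hu' : u =ᵐ[volume] u' := hu.1.ae_eq_mk
  have hv' : v =ᵐ[volume] v' := hvt.1.ae_eq_mk
  have hum : Measurable u' := hu.1.stronglyMeasurable_mk.measurable
  have hvm : Measurable v' := hvt.1.stronglyMeasurable_mk.measurable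
  have huc : TempInt fun x => (u' x : ℂ) := by
    refine (hu.congr hu').mono ?_ fun x => ?_
    · exact (Complex.measurable_ofReal.comp hum).aestronglyMeasurable
    · rw [← ofReal_norm, Complex.norm_real, ofReal_norm]
  have hTu : T = huc.toDist := by
    have hT' : Represents T fun x => (u' x : ℂ) := hT.congr (by
      filter_upwards [hu'] with x hx
      rw [hx])
    ext g
    rw [hT'.apply hφ huc, huc.toDist_apply]
  rw [hTu, ← ENNReal.coe_add]
  refine hC u' v' hum hvm (hv.congr hu' hv') huc (hvt.congr hv') (l₁ + l₂) (by positivity) ?_ ?_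
  · calc _ ≤ ∫⁻ x, yext A (‖u x‖ₑ / l₁) := by
          refine lintegral_mono_ae ?_
          filter_upwards [hu'] with x hx
          rw [hx]
          refine yext_mono (ENNReal.div_le_div_left ?_ _)
          exact_mod_cast le_self_add
      _ ≤ 1 := by rwa [← hA.lintegral_luxNorm_eq u hl₁.ne']
  · calc _ ≤ ∫⁻ x : E n, ∫⁻ h : E n,
          yext A (‖v' x - v' (x - h)‖ₑ / (l₂ * ‖h‖ₑ ^ σ)) / ‖h‖ₑ ^ n := by
          refine lintegral_mono fun x => lintegral_mono fun y => ?_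
          refine ENNReal.div_le_div_right (yext_mono (ENNReal.div_le_div_left ?_ _)) _
          gcongr
          exact le_add_self
      _ = ∫⁻ p : E n × E n, A (‖v' p.1 - v' p.2‖₊ / (l₂ * ‖p.1 - p.2‖₊ ^ σ)) /
          (‖p.1 - p.2‖₊ : ℝ≥0∞) ^ n := (hA.lintegral_gagliardo_eq hσ hvm hl₂.ne').symm
      _ = ∫⁻ p : E n × E n, A (‖v p.1 - v p.2‖₊ / (l₂ * ‖p.1 - p.2‖₊ ^ σ)) /
          (‖p.1 - p.2‖₊ : ℝ≥0∞) ^ n := by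
          refine lintegral_congr_ae ?_
          filter_upwards [Measure.quasiMeasurePreserving_fst.ae hv',
            Measure.quasiMeasurePreserving_snd.ae hv'] with p hp1 hp2
          rw [hp1, hp2]
      _ ≤ 1 := h₂

/-- Only the Luxemburg norm of `u` and the seminorm enter the estimate. Finiteness of the gradient
norms serves to make the highest gradient tempered. -/
theorem IsGenerator.exists_FNorm_le_mul_WNorm (hφ : IsGenerator φ₀) (hn : 1 ≤ n) {s : ℝ}
    (hs0 : 0 ≤ s) (hsN : ∀ k : ℕ, s ≠ k) :
    ∃ C : ℝ≥0, 0 < C ∧ ∀ A : ℝ≥0 → ℝ≥0∞, IsYoung A → ∀ (T : 𝓢'(E n, ℂ)) (u : E n → ℝ),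
      Represents T (fun x => (u x : ℂ)) → MemW s A u → FNorm φ₀ s A T ≤ C * WNorm s A u := by
  have hσ0 : 0 < s - ⌊s⌋₊ :=
    sub_pos.2 ((Nat.floor_le hs0).lt_of_ne fun h => hsN _ h.symm)
  have hσ1 : s - ⌊s⌋₊ < 1 := by linarith [Nat.lt_floor_add_one s]
  obtain ⟨C, hC0, hC⟩ := exists_FNorm_le hn hφ ⌊s⌋₊ hσ0 hσ1
  refine ⟨C, hC0, fun A hA T u hT hu => ?_⟩
  have hC0' : (C : ℝ≥0∞) ≠ 0 := by exact_mod_cast hC0.ne'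
  have hfin := hu.2
  simp only [WNorm, ENNReal.add_lt_top] at hfin
  have hut : TempInt u := hA.tempInt_of_luxNorm_lt_top hu.1 hfin.1.1
  have key : (C : ℝ≥0∞)⁻¹ * FNorm φ₀ s A T ≤
      luxNorm A u + gradGagliardo ⌊s⌋₊ (s - ⌊s⌋₊) A u := by
    simp only [gradGagliardo, ENNReal.add_iInf]
    refine le_iInf₂ fun v hv => le_luxInf_add fun l₁ l₂ hl₁ hl₂ h₁ h₂ => ?_
    have h3 := FNorm_le_of_modular hA hσ0.le hφ (hC A hA) hT hut hv
      (hA.tempInt_grad hut hfin.1.2 hv) hl₁ hl₂ h₁ h₂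
    rw [add_sub_cancel] at h3
    rw [mul_comm, ← div_eq_mul_inv]
    exact ENNReal.div_le_of_le_mul (by rwa [mul_comm])
  calc FNorm φ₀ s A T = C * ((C : ℝ≥0∞)⁻¹ * FNorm φ₀ s A T) := by
        rw [← mul_assoc, ENNReal.mul_inv_cancel hC0' ENNReal.coe_ne_top, one_mul]
    _ ≤ C * (luxNorm A u + gradGagliardo ⌊s⌋₊ (s - ⌊s⌋₊) A u) := by gcongr
    _ ≤ C * WNorm s A u := by
        rw [WNorm]
        gcongr
        exact le_self_add

theorem IsGenerator.exists_WNorm_le_mul_FNorm (hφ : IsGenerator φ₀) (hn : 1 ≤ n) {s : ℝ}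
    (hs0 : 0 ≤ s) (hsN : ∀ k : ℕ, s ≠ k) :
    ∃ C : ℝ≥0, 0 < C ∧ ∀ A : ℝ≥0 → ℝ≥0∞, IsYoung A → ∀ T : 𝓢'(E n, ℂ), MemF φ₀ s A T →
      ∃ u : E n → ℝ, Represents T (fun x => (u x : ℂ)) ∧ MemW s A u ∧
        (C : ℝ≥0∞) * WNorm s A u ≤ FNorm φ₀ s A T := by
  have hσ0 : 0 < s - ⌊s⌋₊ :=
    sub_pos.2 ((Nat.floor_le hs0).lt_of_ne fun h => hsN _ h.symm)
  have hσ1 : s - ⌊s⌋₊ < 1 := by linarith [Nat.lt_floor_add_one s]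
  obtain ⟨C, hCtop, hC⟩ := hφ.exists_sobolev_le hn ⌊s⌋₊ hσ0 hσ1
  simp only [add_sub_cancel] at hC
  lift C to ℝ≥0 using hCtop
  refine ⟨(C + 1)⁻¹, by positivity, fun A hA T hT => ?_⟩
  have main : ∀ f : ℕ → E n → ℂ, (∀ i, Represents (dyadicOp φ₀ i T) (f i)) → ∀ l : ℝ≥0, 0 < l →
      ∑' i : ℕ, ∫⁻ x, A ((2 : ℝ≥0) ^ ((i : ℝ) * s) * ‖f i x‖₊ / l) ≤ 1 →
      ∃ u : E n → ℝ, AEStronglyMeasurable u volume ∧ Represents T (fun x => (u x : ℂ)) ∧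
        WNorm s A u ≤ C * l := by
    intro f hf l hl hρ
    have hfm := fun i => (hf i).1.aestronglyMeasurable
    refine hC A hA T hT.1 (fun i => (hfm i).mk (f i))
      (fun i => (hfm i).stronglyMeasurable_mk.measurable)
      (fun i => (hf i).congr (hfm i).ae_eq_mk) l hl (le_trans (le_of_eq ?_) hρ)
    refine tsum_congr fun i => lintegral_congr_ae ?_
    filter_upwards [(hfm i).ae_eq_mk] with x hx
    rw [hA.apply_rpow_mul_div _ _ hl.ne', hx]
  have hfin := hT.2
  simp only [FNorm, iInf_lt_iff] at hfin
  obtain ⟨f, hf, hfl⟩ := hfin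
  obtain ⟨l, hl, hρ⟩ := exists_of_luxInf_lt_top hfl
  obtain ⟨u, hum, hTu, hu⟩ := main f hf l hl hρ
  refine ⟨u, hTu, ⟨hum, hu.trans_lt (by finiteness)⟩, ?_⟩
  -- Each competitor in the infimum yields its own function; all of them represent `T`, hence agree
  -- almost everywhere with `u` and share its norm.
  refine le_iInf₂ fun f' hf' => le_iInf fun l' => le_iInf₂ fun hl' hρ' => ?_
  obtain ⟨u', -, hTu', hu'⟩ := main f' hf' l' hl' hρ'
  rw [WNorm_congr (ae_eq_of_represents hTu hTu'), ENNReal.coe_inv (by positivity), mul_comm,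
    ← div_eq_mul_inv]
  refine ENNReal.div_le_of_le_mul (hu'.trans ?_)
  rw [mul_comm, ENNReal.coe_add]
  gcongr
  exact le_self_add

theorem TempInt.isRealDistribution {u : E n → ℝ} (hu : TempInt fun x => (u x : ℂ)) :
    IsRealDistribution hu.toDist := by
  intro g hg
  rw [hu.toDist_apply]
  have h := Complex.imCLM.integral_comp_comm (hu.integrable_mul g)
  simp only [Complex.imCLM_apply, Complex.im_mul_ofReal, hg, zero_mul, integral_zero] at h
  exact h.symm

end Equivalence

end FracOrlicz

end

theorem theorem3p3 (n : ℕ) (hn : 1 ≤ n) (s : ℝ) (hs : 0 < s) (hsN : ∀ k : ℕ, s ≠ (k : ℝ))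
    (φ₀ : FracOrlicz.E n → ℝ) (hφ₀ : FracOrlicz.IsGenerator φ₀) :
    ∃ c C : ℝ≥0, 0 < c ∧ 0 < C ∧ ∀ A : ℝ≥0 → ℝ≥0∞, FracOrlicz.IsYoung A →
      (∀ u : FracOrlicz.E n → ℝ, FracOrlicz.MemW s A u →
        ∃ T : 𝓢'(FracOrlicz.E n, ℂ), FracOrlicz.Represents T (fun x => (u x : ℂ)) ∧
          FracOrlicz.MemF φ₀ s A T) ∧
      (∀ T : 𝓢'(FracOrlicz.E n, ℂ), FracOrlicz.MemF φ₀ s A T →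
        ∃ u : FracOrlicz.E n → ℝ, FracOrlicz.Represents T (fun x => (u x : ℂ)) ∧
          FracOrlicz.MemW s A u) ∧
      (∀ (T : 𝓢'(FracOrlicz.E n, ℂ)) (u : FracOrlicz.E n → ℝ),
        FracOrlicz.Represents T (fun x => (u x : ℂ)) →
        FracOrlicz.MemF φ₀ s A T → FracOrlicz.MemW s A u →
          (c : ℝ≥0∞) * FracOrlicz.WNorm s A u ≤ FracOrlicz.FNorm φ₀ s A T ∧
          FracOrlicz.FNorm φ₀ s A T ≤ (C : ℝ≥0∞) * FracOrlicz.WNorm s A u) := by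
  obtain ⟨c, hc, hlow⟩ := hφ₀.exists_WNorm_le_mul_FNorm hn hs.le hsN
  obtain ⟨C, hC, hupp⟩ := hφ₀.exists_FNorm_le_mul_WNorm hn hs.le hsN
  refine ⟨c, C, hc, hC, fun A hA => ⟨fun u hu => ?_, fun T hT => ?_, fun T u hTu hT hu => ⟨?_, ?_⟩⟩⟩
  · have hfin := hu.2
    simp only [FracOrlicz.WNorm, ENNReal.add_lt_top] at hfin
    have hut : FracOrlicz.TempInt fun x => (u x : ℂ) := by
      refine (hA.tempInt_of_luxNorm_lt_top hu.1 hfin.1.1).mono ?_ fun x => ?_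
      · exact Complex.continuous_ofReal.comp_aestronglyMeasurable hu.1
      · rw [← ofReal_norm, Complex.norm_real, ofReal_norm]
    exact ⟨hut.toDist, hut.represents, hut.isRealDistribution,
      (hupp A hA _ u hut.represents hu).trans_lt (ENNReal.mul_lt_top ENNReal.coe_lt_top hu.2)⟩
  · obtain ⟨u, hTu, hu, -⟩ := hlow A hA T hT
    exact ⟨u, hTu, hu⟩
  · obtain ⟨u', hTu', -, h⟩ := hlow A hA T hT
    rwa [FracOrlicz.WNorm_congr (FracOrlicz.ae_eq_of_represents hTu hTu')]
  · exact hupp A hA T u hTu hu
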